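/- **Setting.** Let $M$ be a Polish space, $\lambda\neq 0$ a $\sigma$-finite Borel measure on $M$ (for instance a $\sigma$-finite Radon measure), $\mathbb M$ and $\mathscr P$ the sets of finite, respectively probability, Borel measures on $M$ with the topology of weak convergence, and $\mathbb M^{ac}$, $\mathscr P^{ac}$ the subsets of measures absolutely continuous with respect to $\lambda$, equipped with the total variation distance and its Borel $\sigma$-algebra. *Extrinsic derivatives.* $C_b^{E,1}(\mathbb M)$ is the set of bounded continuous $u:\mathbb M\to\mathbb R$ such that $D^Eu(\mu)(x)=\lim_{\varepsilon\downarrow0}\frac{u(\mu+\varepsilon\delta_x)-u(\mu)}{\varepsilon}$ exists for all $(\mu,x)\in\mathbb M\times M$ and is bounded and continuous on $\mathbb M\times M$; $C_{b,2}^{E,1}(\mathbb M)$ consists of those $u\in C_b^{E,1}(\mathbb M)$ with $\sup_{\mu\in\mathbb M^{ac}}\|D^Eu(\mu)\|_{L^2(\mu)}<\infty$. $C_b^{E,1}(\mathscr P)$ is defined as $C_b^{E,1}(\mathbb M)$, with $\mathscr P$ in place of $\mathbb M$ and $\widetilde D^Eu(\mu)(x)=\lim_{\varepsilon\downarrow0}\frac{u((1-\varepsilon)\mu+\varepsilon\delta_x)-u(\mu)}{\varepsilon}$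 in place of $D^Eu$. *Maps and reference measures.* Let $H=L^2(M,\lambda)$, $H_0=H\setminus\{0\}$, and let $\Psi_{\mathbb M}:H\to\mathbb M^{ac}$, $h\mapsto h^2\lambda$, and $\Psi_{\mathscr P}:H_0\to\mathscr P^{ac}$, $h\mapsto h^2\lambda/\lambda(h^2)$. Let $\Lambda_0$ be a Borel probability measure on $H$ with $\Lambda_0(\{0\})=0$, and put $\Lambda_{\mathbb M}=\Lambda_0\circ\Psi_{\mathbb M}^{-1}$, $\Lambda_{\mathscr P}=\Lambda_0\circ\Psi_{\mathscr P}^{-1}$. *Coefficients.* Situation $(A_{\mathbb M})$: for every $\mu\in\mathbb M^{ac}$, $A(\mu)$ is a symmetric positive (semi-definite) bounded linear operator on $L^2(\mu)$; for every bounded continuous $\eta$ on $\mathbb M^{ac}\times M$, $(\mu,x)\mapsto (A(\mu)\eta(\mu,\cdot))(x)$ has a jointly measurable version; and $\int\|A(\mu)\|\,d\Lambda_{\mathbb M}(\mu)<\infty$. Situation $(A_{\mathscr P})$ is the same with $\mathscr P^{ac},\Lambda_{\mathscr P}$ in place of $\mathbb M^{ac},\Lambda_{\mathbb M}$. For $h\in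 H_0$ and $h'\in H$ put $A^{\mathbb M}_hh'=h\,A(\Psi_{\mathbb M}(h))(h'/h)$ and $A^{\mathscr P}_hh'=h\,A(\Psi_{\mathscr P}(h))(h'/h)$. *Forms.* With $\nabla$ the Fréchet gradient on $H$, let $C_b^1(H)$ be the set of $f\in C^1(H)$ with $f$ and $\|\nabla f\|_H$ bounded, and for open $U\subseteq H$ let $C_{b,0}^1(U)$ be the set of $f\in C^1(U)$ with $f$ and $h\mapsto\|h\|_H\|\nabla f(h)\|_H$ bounded on $U$. Define $$\mathcal E^A_{\mathbb M}(u,v)=\int_{\mathbb M^{ac}}\langle A(\mu)D^Eu(\mu),D^Ev(\mu)\rangle_{L^2(\mu)}\,d\Lambda_{\mathbb M}(\mu),\qquad \mathcal E^A_{\mathscr P}(u,v)=\int_{\mathscr P^{ac}}\langle A(\mu)\widetilde D^Eu(\mu),\widetilde D^Ev(\mu)\rangle_{L^2(\mu)}\,d\Lambda_{\mathscr P}(\mu),$$ $$\mathcal E^{0,A}_{\mathbb M}(f,g)=\int_H\langle A^{\mathbb M}_h\nabla f(h),\nabla g(h)\rangle_H\,d\Lambda_0(h),\qquad \mathcal E^{0,A}_{\mathscr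 P}(f,g)=\int_{H_0}\langle A^{\mathscr P}_h\nabla f(h),\nabla g(h)\rangle_H\|h\|_H^2\,d\Lambda_0(h).$$ A form $\mathcal E$ on a class $\mathcal C$ of functions is closable in $L^2(\Lambda)$ if $\mathcal E(u_n,u_n)\to0$ for every sequence in $\mathcal C$ with $u_n\to0$ in $L^2(\Lambda)$ and $\mathcal E(u_n-u_m,u_n-u_m)\to0$. Dirichlet forms are symmetric; local and quasi-regular (via the $1$-capacity, nests of closed sets and quasi-continuity) have their usual meaning. **Theorem.** (1) In situation $(A_{\mathbb M})$, for all $u,v\in C_{b,2}^{E,1}(\mathbb M)$ we have $u\circ\Psi_{\mathbb M}\in C_b^1(H)$, the integrals defining $\mathcal E^A_{\mathbb M}(u,v)$ and $\mathcal E^{0,A}_{\mathbb M}(u\circ\Psi_{\mathbb M},v\circ\Psi_{\mathbb M})$ converge absolutely, and $$\mathcal E^A_{\mathbb M}(u,v)=\tfrac14\,\mathcal E^{0,A}_{\mathbb M}(u\circ\Psi_{\mathbb M},v\circ\Psi_{\mathbb M}).$$ If $(\mathcal E^{0,A}_{\mathbb M},C_b^1(H))$ is closable in $L^2(H,\Lambda_0)$,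 then $(\mathcal E^A_{\mathbb M},C_{b,2}^{E,1}(\mathbb M))$ is closable in $L^2(\mathbb M^{ac},\Lambda_{\mathbb M})$, and its closure is a local quasi-regular Dirichlet form. (2) In situation $(A_{\mathscr P})$, for all $u,v\in C_b^{E,1}(\mathscr P)$ we have $u\circ\Psi_{\mathscr P}\in C_{b,0}^1(H_0)$, the integrals defining $\mathcal E^A_{\mathscr P}(u,v)$ and $\mathcal E^{0,A}_{\mathscr P}(u\circ\Psi_{\mathscr P},v\circ\Psi_{\mathscr P})$ converge absolutely, and $$\mathcal E^A_{\mathscr P}(u,v)=\tfrac14\,\mathcal E^{0,A}_{\mathscr P}(u\circ\Psi_{\mathscr P},v\circ\Psi_{\mathscr P}).$$ If $(\mathcal E^{0,A}_{\mathscr P},C_{b,0}^1(H))$ is closable in $L^2(H,\Lambda_0)$, then $(\mathcal E^A_{\mathscr P},C_b^{E,1}(\mathscr P))$ is closable in $L^2(\mathscr P^{ac},\Lambda_{\mathscr P})$, and its closure is a local quasi-regular Dirichlet form. -/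

import Mathlib

open MeasureTheory Filter Topology
open scoped ENNReal NNReal BoundedContinuousFunction

noncomputable section

namespace ExtrinsicForms

/-! ### Dirichlet forms on `L²(X, m)` -/

section DirichletForms

variable {X : Type*} [MeasurableSpace X]

/-- A bilinear form defined on a linear subspace of `L²(X, m)`. -/
structure L2Form (m : Measure X) where
  domain : Submodule ℝ (Lp ℝ 2 m)
  form : domain →ₗ[ℝ] domain →ₗ[ℝ] ℝ

namespace L2Form

variable {m : Measure X} (F : L2Form m)

/-- `ℰ₁(u, v) = ℰ(u, v) + ⟨u, v⟩` in `L²(m)`. -/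
def form₁ (u v : F.domain) : ℝ := F.form u v + inner ℝ (u : Lp ℝ 2 m) (v : Lp ℝ 2 m)

/-- Symmetric Dirichlet forms: densely defined, symmetric, positive, coercive (weak sector
condition), closed, and Markovian. -/
structure IsDirichlet : Prop where
  dense : Dense (F.domain : Set (Lp ℝ 2 m))
  symm : ∀ u v : F.domain, F.form u v = F.form v u
  nonneg : ∀ u : F.domain, 0 ≤ F.form u u
  coercive : ∃ K : ℝ, 0 < K ∧ ∀ u v : F.domain,
    |F.form₁ u v| ≤ K * Real.sqrt (F.form₁ u u * F.form₁ v v)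
  closed : ∀ s : ℕ → F.domain,
    Tendsto (fun p : ℕ × ℕ => F.form₁ (s p.1 - s p.2) (s p.1 - s p.2)) atTop (𝓝 0) →
      ∃ u : F.domain, Tendsto (fun n => F.form₁ (s n - u) (s n - u)) atTop (𝓝 0)
  markov : ∀ u : F.domain, ∃ w : F.domain,
    (∀ᵐ z ∂m, (w : Lp ℝ 2 m) z = min (max ((u : Lp ℝ 2 m) z) 0) 1) ∧
      0 ≤ F.form (u + w) (u - w) ∧ 0 ≤ F.form (u - w) (u + w)

variable [TopologicalSpace X]

/-- The closed support of the measure `|u| m`. -/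
def supp (u : Lp ℝ 2 m) : Set X := (m.withDensity fun z => ‖u z‖ₑ).support

/-- The local property. -/
def IsLocal : Prop :=
  ∀ u v : F.domain, Disjoint (supp (u : Lp ℝ 2 m)) (supp (v : Lp ℝ 2 m)) → F.form u v = 0

/-- The `1`-capacity of an open set (`∞` if no admissible function exists). -/
def capOpen (O : Set X) : ℝ≥0∞ :=
  ⨅ (u : F.domain) (_ : ∀ᵐ z ∂m, z ∈ O → 1 ≤ (u : Lp ℝ 2 m) z), ENNReal.ofReal (F.form₁ u u)

/-- The `1`-capacity of an arbitrary set. -/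
def cap (S : Set X) : ℝ≥0∞ :=
  ⨅ (O : Set X) (_ : IsOpen O) (_ : S ⊆ O), F.capOpen O

/-- Nests of closed sets. -/
def IsNest (K : ℕ → Set X) : Prop :=
  (∀ n, IsClosed (K n)) ∧ Tendsto (fun n => F.cap (K n)ᶜ) atTop (𝓝 0)

/-- Quasi-continuity of a measurable function. -/
def QuasiContinuous (u : X → ℝ) : Prop :=
  Measurable u ∧ ∃ K : ℕ → Set X, F.IsNest K ∧ ∀ n, ContinuousOn u (K n)

/-- Quasi-regularity: a nest of compact sets, a dense subspace of the domain consisting of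
(classes of) quasi-continuous functions, and a sequence of quasi-continuous functions in the
domain that separates the points off a set of capacity zero. -/
structure IsQuasiRegular : Prop where
  compact_nest : ∃ K : ℕ → Set X, F.IsNest K ∧ ∀ n, IsCompact (K n)
  dense_quasiContinuous : ∃ S : Submodule ℝ F.domain,
    (∀ v ∈ S, ∃ w : X → ℝ, F.QuasiContinuous w ∧ ((v : Lp ℝ 2 m) : X → ℝ) =ᵐ[m] w) ∧
    ∀ u : F.domain, ∀ ε : ℝ, 0 < ε → ∃ v ∈ S, F.form₁ (u - v) (u - v) < ε
  separating : ∃ (N : Set X) (w : ℕ → X → ℝ), F.cap N = 0 ∧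
    (∀ n, F.QuasiContinuous (w n) ∧ ∃ v : F.domain, ((v : Lp ℝ 2 m) : X → ℝ) =ᵐ[m] w n) ∧
    ∀ z₁ ∉ N, ∀ z₂ ∉ N, z₁ ≠ z₂ → ∃ n, w n z₁ ≠ w n z₂

end L2Form

/-- A bilinear form given on a class `dom` of elements of `α`, each of which is realized as a
function on `X` by `val` (for instance by restriction to `X`). -/
structure PreForm (α X : Type*) where
  dom : Set α
  val : α → X → ℝ
  form : α → α → ℝ

namespace PreForm

variable {α : Type*} [AddCommGroup α] (P : PreForm α X) (m : Measure X)

/-- `s` is a sequence in the class that is Cauchy for the form. -/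
def IsCauchySeq (s : ℕ → α) : Prop :=
  (∀ n, s n ∈ P.dom) ∧
    Tendsto (fun p : ℕ × ℕ => P.form (s p.1 - s p.2) (s p.1 - s p.2)) atTop (𝓝 0)

/-- Closability in `L²(X, m)`. Applied to constant sequences it also says that the form depends
only on the `m`-classes of its arguments. -/
def IsClosable : Prop :=
  ∀ s : ℕ → α, P.IsCauchySeq s → Tendsto (fun n => eLpNorm (P.val (s n)) 2 m) atTop (𝓝 0) →
    Tendsto (fun n => P.form (s n) (s n)) atTop (𝓝 0)

/-- `s` is Cauchy for the form and converges to `u` in `L²(X, m)`. -/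
def Approximates (s : ℕ → α) (u : Lp ℝ 2 m) : Prop :=
  P.IsCauchySeq s ∧ Tendsto (fun n => eLpNorm (P.val (s n) - (u : X → ℝ)) 2 m) atTop (𝓝 0)

variable {m} in
/-- `F` is the closure of the form in `L²(X, m)`; this determines `F`. -/
structure IsClosure (F : L2Form m) : Prop where
  mem_domain : ∀ u : Lp ℝ 2 m, u ∈ F.domain ↔ ∃ s, P.Approximates m s u
  tendsto_form : ∀ (u v : F.domain) (s t : ℕ → α),
    P.Approximates m s u → P.Approximates m t v →
      Tendsto (fun n => P.form (s n) (t n)) atTop (𝓝 (F.form u v))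

end PreForm

end DirichletForms

/-! ### Spaces of absolutely continuous measures -/

section Measures

variable {M : Type*} [MeasurableSpace M]

/-- The class in `L²(m)` of a square-integrable function (and `0` for all other functions). -/
def toL2 (m : Measure M) (f : M → ℝ) : Lp ℝ 2 m :=
  open Classical in if hf : MemLp f 2 m then hf.toLp f else 0

/-- The density `dμ/dlam` as an element of `L¹(lam)`. -/
def density (lam μ : Measure M) [IsFiniteMeasure μ] : Lp ℝ 1 lam :=
  (memLp_one_iff_integrable.2
    (Measure.integrable_toReal_rnDeriv (μ := μ) (ν := lam))).toLp
      (fun x => (μ.rnDeriv lam x).toReal)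

theorem eq_of_density_eq {lam μ ν : Measure M} [SigmaFinite lam] [IsFiniteMeasure μ]
    [IsFiniteMeasure ν] (hμ : μ ≪ lam) (hν : ν ≪ lam) (h : density lam μ = density lam ν) :
    μ = ν := by
  have h' := (MemLp.toLp_eq_toLp_iff _ _).1 h
  rw [← Measure.withDensity_rnDeriv_eq μ lam hμ, ← Measure.withDensity_rnDeriv_eq ν lam hν]
  refine withDensity_congr_ae ?_
  filter_upwards [h', Measure.rnDeriv_lt_top μ lam, Measure.rnDeriv_lt_top ν lam] with x h1 h2 h3
  exact (ENNReal.toReal_eq_toReal_iff' h2.ne h3.ne).1 h1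

/-- The `L¹(lam)` distance of the densities is the total variation `|μ - ν|(M)`. -/
theorem totalVariation_eq_dist_density {lam μ ν : Measure M} [SigmaFinite lam]
    [IsFiniteMeasure μ] [IsFiniteMeasure ν] (hμ : μ ≪ lam) (hν : ν ≪ lam) :
    (μ.toSignedMeasure - ν.toSignedMeasure).totalVariation Set.univ =
      ENNReal.ofReal (dist (density lam μ) (density lam ν)) := by
  have iμ : Integrable (fun x => (μ.rnDeriv lam x).toReal) lam :=
    Measure.integrable_toReal_rnDeriv
  have iν : Integrable (fun x => (ν.rnDeriv lam x).toReal) lam :=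
    Measure.integrable_toReal_rnDeriv
  have key : ∀ (κ : Measure M) [IsFiniteMeasure κ], κ ≪ lam →
      lam.withDensityᵥ (fun x => (κ.rnDeriv lam x).toReal) = κ.toSignedMeasure := by
    intro κ _ hκ
    ext i hi
    rw [withDensityᵥ_apply Measure.integrable_toReal_rnDeriv hi,
      Measure.setIntegral_toReal_rnDeriv hκ, Measure.toSignedMeasure_apply_measurable hi]
  have hm : Measurable fun x => (μ.rnDeriv lam x).toReal - (ν.rnDeriv lam x).toReal := by
    fun_prop
  have hs : μ.toSignedMeasure - ν.toSignedMeasure = 0 + lam.withDensityᵥ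
      (fun x => (μ.rnDeriv lam x).toReal - (ν.rnDeriv lam x).toReal) := by
    rw [withDensityᵥ_sub' iμ iν, key μ hμ, key ν hν, zero_add]
  rw [SignedMeasure.totalVariation,
    SignedMeasure.toJordanDecomposition_eq_of_eq_add_withDensity hm (iμ.sub iν)
      VectorMeasure.MutuallySingular.zero_left hs]
  simp only [SignedMeasure.toJordanDecomposition_zero, JordanDecomposition.zero_posPart,
    JordanDecomposition.zero_negPart, zero_add, Measure.add_apply]
  rw [withDensity_apply _ MeasurableSet.univ, withDensity_apply _ MeasurableSet.univ,
    Measure.restrict_univ, ← lintegral_add_left (by fun_prop), density, density, dist_eq_norm,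
    ← MemLp.toLp_sub, Lp.norm_toLp, eLpNorm_one_eq_lintegral_enorm, ENNReal.ofReal_toReal]
  · refine lintegral_congr fun x => ?_
    rw [Real.enorm_eq_ofReal_abs]
    simp only [Pi.sub_apply]
    rcases le_total 0 ((μ.rnDeriv lam x).toReal - (ν.rnDeriv lam x).toReal) with h | h
    · rw [abs_of_nonneg h, ENNReal.ofReal_of_nonpos (by linarith : -(_ : ℝ) ≤ 0), add_zero]
    · rw [abs_of_nonpos h, ENNReal.ofReal_of_nonpos h, zero_add]
  · exact (iμ.sub iν).2.ne

/-- Finite measures absolutely continuous with respect to `lam`. -/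
structure AcMeasure (lam : Measure M) where
  toFinite : FiniteMeasure M
  ac : (toFinite : Measure M) ≪ lam

/-- Probability measures absolutely continuous with respect to `lam`. -/
structure AcProb (lam : Measure M) where
  toProb : ProbabilityMeasure M
  ac : (toProb : Measure M) ≪ lam

variable {lam : Measure M}

/-- The underlying measure. -/
abbrev AcMeasure.meas (μ : AcMeasure lam) : Measure M := (μ.toFinite : Measure M)

/-- The underlying measure. -/
abbrev AcProb.meas (μ : AcProb lam) : Measure M := (μ.toProb : Measure M)

/-- The total variation distance `lam |dμ/dlam - dν/dlam|`. -/
instance [SigmaFinite lam] : MetricSpace (AcMeasure lam) :=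
  MetricSpace.induced (fun μ => density lam μ.meas)
    (fun μ ν h => by
      have h' : μ.meas = ν.meas := eq_of_density_eq μ.ac ν.ac h
      have hm : μ.toFinite = ν.toFinite := Subtype.ext h'
      cases μ; cases ν; cases hm; rfl)
    inferInstance

/-- The total variation distance `lam |dμ/dlam - dν/dlam|`. -/
instance [SigmaFinite lam] : MetricSpace (AcProb lam) :=
  MetricSpace.induced (fun μ => density lam μ.meas)
    (fun μ ν h => by
      have h' : μ.meas = ν.meas := eq_of_density_eq μ.ac ν.ac h
      have hm : μ.toProb = ν.toProb := Subtype.ext h'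
      cases μ; cases ν; cases hm; rfl)
    inferInstance

instance [SigmaFinite lam] : MeasurableSpace (AcMeasure lam) := borel _
instance [SigmaFinite lam] : BorelSpace (AcMeasure lam) := ⟨rfl⟩
instance [SigmaFinite lam] : MeasurableSpace (AcProb lam) := borel _
instance [SigmaFinite lam] : BorelSpace (AcProb lam) := ⟨rfl⟩

/-! ### The maps from `L²(lam)` to measures -/

/-- The measure `h² lam`. -/
def sqMeasure (h : Lp ℝ 2 lam) : Measure M := lam.withDensity fun x => ENNReal.ofReal (h x ^ 2)

theorem sqMeasure_univ (h : Lp ℝ 2 lam) : sqMeasure h Set.univ = ENNReal.ofReal (‖h‖ ^ 2) := by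
  have h2 : Integrable (fun x => h x ^ 2) lam := (Lp.memLp h).integrable_sq
  rw [sqMeasure, withDensity_apply _ MeasurableSet.univ, Measure.restrict_univ,
    ← ofReal_integral_eq_lintegral_ofReal h2 (Eventually.of_forall fun x => sq_nonneg _)]
  congr 1
  rw [← real_inner_self_eq_norm_sq, L2.inner_def]
  refine integral_congr_ae (Eventually.of_forall fun x => ?_)
  simp [pow_two]

instance (h : Lp ℝ 2 lam) : IsFiniteMeasure (sqMeasure h) :=
  ⟨by rw [sqMeasure_univ]; exact ENNReal.ofReal_lt_top⟩

/-- `h ↦ h² lam`. -/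
def psiM (h : Lp ℝ 2 lam) : AcMeasure lam :=
  ⟨⟨sqMeasure h, inferInstance⟩, withDensity_absolutelyContinuous _ _⟩

/-- `h ↦ h² lam / lam(h²)` for `h ≠ 0`. -/
def psiP (h : {h : Lp ℝ 2 lam // h ≠ 0}) : AcProb lam :=
  ⟨⟨(sqMeasure h.1 Set.univ)⁻¹ • sqMeasure h.1, ⟨by
      have h0 : 0 < ‖h.1‖ := norm_pos_iff.2 h.2
      rw [Measure.smul_apply, smul_eq_mul]
      refine ENNReal.inv_mul_cancel ?_ (measure_ne_top _ _)
      rw [sqMeasure_univ]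
      exact (ENNReal.ofReal_pos.2 (by positivity)).ne'⟩⟩,
    (withDensity_absolutelyContinuous _ _).smul_left _⟩

/-- The image of `L0` under `psiM`. -/
def lawM [SigmaFinite lam] [MeasurableSpace (Lp ℝ 2 lam)] (L0 : Measure (Lp ℝ 2 lam)) :
    Measure (AcMeasure lam) := L0.map psiM

/-- The restriction of `L0` to `L²(lam) \ {0}`. -/
def restrictNonzero [MeasurableSpace (Lp ℝ 2 lam)] (L0 : Measure (Lp ℝ 2 lam)) :
    Measure {h : Lp ℝ 2 lam // h ≠ 0} :=
  L0.comap Subtype.val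

/-- The image under `psiP` of `L0` on `L²(lam) \ {0}`. -/
def lawP [SigmaFinite lam] [MeasurableSpace (Lp ℝ 2 lam)] (L0 : Measure (Lp ℝ 2 lam)) :
    Measure (AcProb lam) :=
  (restrictNonzero L0).map psiP

/-- A function on probability measures composed with `psiP`, extended by `0` to `h = 0`. -/
def compPsiP (u : ProbabilityMeasure M → ℝ) (h : Lp ℝ 2 lam) : ℝ :=
  open Classical in if hh : h ≠ 0 then u (psiP ⟨h, hh⟩).toProb else 0

end Measures

/-! ### Extrinsic derivatives

`FiniteMeasure M` and `ProbabilityMeasure M` carry the topology of weak convergence. -/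

section Extrinsic

variable {M : Type*} [MeasurableSpace M]

/-- The Dirac measure as a finite measure. -/
def diracF (x : M) : FiniteMeasure M := ⟨Measure.dirac x, inferInstance⟩

/-- `(u(μ + ε δ_x) - u(μ)) / ε`. -/
def extQuot (u : FiniteMeasure M → ℝ) (μ : FiniteMeasure M) (x : M) (ε : ℝ≥0) : ℝ :=
  (u (μ + ε • diracF x) - u μ) / ε

/-- The extrinsic derivative, the limit of the quotients as `ε ↓ 0`. -/
def extDeriv (u : FiniteMeasure M → ℝ) (μ : FiniteMeasure M) (x : M) : ℝ :=
  limUnder (𝓝[>] (0 : ℝ≥0)) (extQuot u μ x)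

/-- `(1 - ε) μ + ε δ_x` for `0 ≤ ε ≤ 1`. -/
def mixDirac (μ : ProbabilityMeasure M) (x : M) (ε : unitInterval) : ProbabilityMeasure M :=
  ⟨ENNReal.ofReal (1 - ε) • (μ : Measure M) + ENNReal.ofReal ε • Measure.dirac x, ⟨by
    simp only [Measure.add_apply, Measure.smul_apply, smul_eq_mul, measure_univ, mul_one]
    rw [← ENNReal.ofReal_add (by linarith [ε.2.2]) ε.2.1]
    simp⟩⟩

/-- `(u((1 - ε) μ + ε δ_x) - u(μ)) / ε`. -/
def convQuot (u : ProbabilityMeasure M → ℝ) (μ : ProbabilityMeasure M) (x : M)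
    (ε : unitInterval) : ℝ :=
  (u (mixDirac μ x ε) - u μ) / ε

/-- The convexity extrinsic derivative, the limit of the quotients as `ε ↓ 0`. -/
def convDeriv (u : ProbabilityMeasure M → ℝ) (μ : ProbabilityMeasure M) (x : M) : ℝ :=
  limUnder (𝓝[>] (0 : unitInterval)) (convQuot u μ x)

variable [TopologicalSpace M] [OpensMeasurableSpace M]

/-- `C_b^{E,1}(𝕄)`: `u` is continuous, its extrinsic derivative exists everywhere and is jointly
continuous, and both are bounded. -/
structure CbE1 (u : FiniteMeasure M → ℝ) : Prop where
  continuous : Continuous u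
  hasDeriv : ∀ μ x, Tendsto (extQuot u μ x) (𝓝[>] 0) (𝓝 (extDeriv u μ x))
  continuous_deriv : Continuous fun p : FiniteMeasure M × M => extDeriv u p.1 p.2
  bounded : ∃ C : ℝ, ∀ μ x, |u μ| + |extDeriv u μ x| ≤ C

/-- `C_{b,2}^{E,1}(𝕄)`: moreover `‖D^E u(μ)‖_{L²(μ)}` is bounded over `μ ≪ lam`. -/
structure CbE12 (lam : Measure M) (u : FiniteMeasure M → ℝ) : Prop extends CbE1 u where
  bounded_L2 : ∃ C : ℝ≥0, ∀ μ : AcMeasure lam, eLpNorm (extDeriv u μ.toFinite) 2 μ.meas ≤ C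

/-- `C_b^{E,1}(𝒫)`. -/
structure CbE1P (u : ProbabilityMeasure M → ℝ) : Prop where
  continuous : Continuous u
  hasDeriv : ∀ μ x, Tendsto (convQuot u μ x) (𝓝[>] 0) (𝓝 (convDeriv u μ x))
  continuous_deriv : Continuous fun p : ProbabilityMeasure M × M => convDeriv u p.1 p.2
  bounded : ∃ C : ℝ, ∀ μ x, |u μ| + |convDeriv u μ x| ≤ C

end Extrinsic

/-! ### Functions on `H = L²(lam)` -/

section Hilbert

variable {H : Type*} [NormedAddCommGroup H] [InnerProductSpace ℝ H] [CompleteSpace H]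

/-- `C_b^1(H)`. -/
def Cb1 (f : H → ℝ) : Prop :=
  ContDiff ℝ 1 f ∧ ∃ C : ℝ, ∀ h, |f h| + ‖gradient f h‖ ≤ C

/-- `C_{b,0}^1` on an open set `U ⊆ H`: continuously differentiable on `U`, with `f` and
`‖h‖ ‖∇f(h)‖` bounded on `U`. -/
def Cb10 (U : Set H) (f : H → ℝ) : Prop :=
  ContDiffOn ℝ 1 f U ∧ ∃ C : ℝ, ∀ h ∈ U, |f h| + ‖h‖ * ‖gradient f h‖ ≤ C

end Hilbert

/-! ### The weighted forms -/

section Forms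

variable {M : Type*} [TopologicalSpace M] [MeasurableSpace M]
  {lam : Measure M} [SigmaFinite lam]

/-- A family of bounded operators `A(μ)` on `L²(μ)`, `μ` finite and absolutely continuous. -/
abbrev FamilyM (lam : Measure M) : Type _ :=
  ∀ μ : AcMeasure lam, Lp ℝ 2 μ.meas →L[ℝ] Lp ℝ 2 μ.meas

/-- A family of bounded operators `A(μ)` on `L²(μ)`, `μ` an absolutely continuous probability. -/
abbrev FamilyP (lam : Measure M) : Type _ :=
  ∀ μ : AcProb lam, Lp ℝ 2 μ.meas →L[ℝ] Lp ℝ 2 μ.meas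

/-- Admissible coefficients on finite measures: every `A(μ)` is symmetric and positive,
`A(μ)η(μ,·)` has a jointly measurable version for bounded continuous `η`, and `‖A(μ)‖` is
integrable. -/
structure AdmissibleM (Lam : Measure (AcMeasure lam)) (A : FamilyM lam) : Prop where
  positive : ∀ μ, (A μ).IsPositive
  measurable : ∀ η : (AcMeasure lam × M) →ᵇ ℝ, ∃ G : AcMeasure lam × M → ℝ, Measurable G ∧
    ∀ μ, ∀ᵐ x ∂μ.meas, A μ (toL2 μ.meas fun y => η (μ, y)) x = G (μ, x)
  integrable : Integrable (fun μ => ‖A μ‖) Lam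

/-- Admissible coefficients on probability measures. -/
structure AdmissibleP (Lam : Measure (AcProb lam)) (A : FamilyP lam) : Prop where
  positive : ∀ μ, (A μ).IsPositive
  measurable : ∀ η : (AcProb lam × M) →ᵇ ℝ, ∃ G : AcProb lam × M → ℝ, Measurable G ∧
    ∀ μ, ∀ᵐ x ∂μ.meas, A μ (toL2 μ.meas fun y => η (μ, y)) x = G (μ, x)
  integrable : Integrable (fun μ => ‖A μ‖) Lam

/-- `⟨A(μ) D^E u(μ), D^E v(μ)⟩` in `L²(μ)`. -/
def integrandM (A : FamilyM lam) (u v : FiniteMeasure M → ℝ) (μ : AcMeasure lam) : ℝ :=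
  inner ℝ (A μ (toL2 μ.meas (extDeriv u μ.toFinite))) (toL2 μ.meas (extDeriv v μ.toFinite))

/-- The same with the convexity extrinsic derivative. -/
def integrandP (A : FamilyP lam) (u v : ProbabilityMeasure M → ℝ) (μ : AcProb lam) : ℝ :=
  inner ℝ (A μ (toL2 μ.meas (convDeriv u μ.toProb))) (toL2 μ.meas (convDeriv v μ.toProb))

/-- The form `ℰ^A` on functions of finite measures, in `L²` over `AcMeasure lam`. -/
def measureFormM [OpensMeasurableSpace M] (Lam : Measure (AcMeasure lam)) (A : FamilyM lam) :
    PreForm (FiniteMeasure M → ℝ) (AcMeasure lam) where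
  dom := {u | CbE12 lam u}
  val u μ := u μ.toFinite
  form u v := ∫ μ, integrandM A u v μ ∂Lam

/-- The form `ℰ^A` on functions of probability measures, in `L²` over `AcProb lam`. -/
def measureFormP [OpensMeasurableSpace M] (Lam : Measure (AcProb lam)) (A : FamilyP lam) :
    PreForm (ProbabilityMeasure M → ℝ) (AcProb lam) where
  dom := {u | CbE1P u}
  val u μ := u μ.toProb
  form u v := ∫ μ, integrandP A u v μ ∂Lam

/-- `A_h h' = h A(h² lam) (h' / h)`. -/
def hilbertOpM (A : FamilyM lam) (h h' : Lp ℝ 2 lam) : Lp ℝ 2 lam :=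
  toL2 lam fun x => h x * A (psiM h) (toL2 (psiM h).meas fun y => h' y / h y) x

/-- `A_h h' = h A(h² lam / lam(h²)) (h' / h)` for `h ≠ 0`. -/
def hilbertOpP (A : FamilyP lam) (h : {h : Lp ℝ 2 lam // h ≠ 0}) (h' : Lp ℝ 2 lam) :
    Lp ℝ 2 lam :=
  toL2 lam fun x => h.1 x * A (psiP h) (toL2 (psiP h).meas fun y => h' y / h.1 y) x

/-- `⟨A_h ∇f(h), ∇g(h)⟩` in `L²(lam)`. -/
def hilbertIntegrandM (A : FamilyM lam) (f g : Lp ℝ 2 lam → ℝ) (h : Lp ℝ 2 lam) : ℝ :=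
  inner ℝ (hilbertOpM A h (gradient f h)) (gradient g h)

/-- `⟨A_h ∇f(h), ∇g(h)⟩ ‖h‖²` in `L²(lam)`, for `h ≠ 0`. -/
def hilbertIntegrandP (A : FamilyP lam) (f g : Lp ℝ 2 lam → ℝ)
    (h : {h : Lp ℝ 2 lam // h ≠ 0}) : ℝ :=
  inner ℝ (hilbertOpP A h (gradient f h.1)) (gradient g h.1) * ‖h.1‖ ^ 2

variable [MeasurableSpace (Lp ℝ 2 lam)]

/-- The form `ℰ^{0,A}` on `C_b^1(L²(lam))`. -/
def hilbertFormM (L0 : Measure (Lp ℝ 2 lam)) (A : FamilyM lam) :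
    PreForm (Lp ℝ 2 lam → ℝ) (Lp ℝ 2 lam) where
  dom := {f | Cb1 f}
  val f := f
  form f g := ∫ h, hilbertIntegrandM A f g h ∂L0

/-- The weighted form `ℰ^{0,A}` on `C_{b,0}^1(L²(lam))`. -/
def hilbertFormP (L0 : Measure (Lp ℝ 2 lam)) (A : FamilyP lam) :
    PreForm (Lp ℝ 2 lam → ℝ) (Lp ℝ 2 lam) where
  dom := {f | Cb10 Set.univ f}
  val f := f
  form f g := ∫ h, hilbertIntegrandP A f g h ∂(restrictNonzero L0)

end Forms

end ExtrinsicForms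

end

/-! The link between the two sides is the chain rule along h ↦ h² lam. If u has a bounded, jointly
continuous extrinsic derivative D, then h ↦ u(h² lam) is C¹ on L²(lam) with gradient 2 h D(h² lam)
(`HasExtDeriv.hasGradientAt`, `HasExtDeriv.contDiff`). Multiplication by h maps L²(h² lam)
isometrically into L²(lam) and carries A(h² lam) to A_h (`inner_lift_eq`). Energy densities
therefore differ by the factor 4, and integration against the image measure gives both identities.

The class only provides derivatives in Dirac directions. The fundamental theorem of calculus for
right derivatives turns them into an integral formula for increments, which is stable under scaling,
sums and weak limits, hence valid in the direction of every finite measure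
(`HasExtDeriv.integratesAlong`). The direction 2hk is not positive, but it equals (h+k)² - h² - k²,
and this suffices to differentiate along lines.

For finite measures the pullback preserves L² norms and lands in C_b^1(H), so closability transfers
at once. For probability measures the pullback is homogeneous of degree zero and need not extend to
a C¹ function at the origin. It is multiplied by a cut-off in k ‖h‖² (`cutExt`). Since s · cut_k'(s)
is bounded uniformly in k, the lost energy is at most a constant, independent of k, times the
integral of ‖A‖ over {k ‖h‖² < 2}. These sets shrink to the empty set in H \ {0}, so a sequence in
the class can be replaced by cut-off functions with vanishing error (`isClosable_measureFormP`).

The Dirichlet property and locality are proved for any form ∫ Γ(u,v) dm whose Γ obeys the chain rule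
(`DiffusionCore`). Here it does, because at a fixed measure φ'(u) is a scalar and commutes with the
operator. The closure is the completion for ℰ₁, and limits of contracted functions come from weak
compactness, in the form of convex hulls of tails.

Quasi-regularity rests on bump functions of √(1 + μ(f)) with f in a countable family (`Barrier`).
Their energy density is at most ‖A‖, a bound inherited by all maxima and minima. Maxima over f
measure the total variation distance to a centre; minima over a dense set of centres decrease to
zero with bounded energy. Convex combinations then converge to zero in the form norm, and a
geometric series of them has small norm and dominates the indicator of the complement of a compact
set (`exists_compact_cap_le`). The same bump functions generate the Borel σ-algebra, which gives
density in L². -/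

noncomputable section

namespace ExtrinsicForms

/-! ### Weak compactness in Hilbert spaces via convex hulls -/

section Mazur

variable {W : Type*} [NormedAddCommGroup W] [InnerProductSpace ℝ W] [CompleteSpace W]

/-- A bounded sequence in a Hilbert space has a point common to the closed convex hulls of all its
tails. -/
theorem exists_mem_closedConvexHull_tails {x : ℕ → W} {R : ℝ} (hR : ∀ n, ‖x n‖ ≤ R) :
    ∃ c, ∀ N, c ∈ closure (convexHull ℝ (x '' Set.Ici N)) := by
  set C : ℕ → Set W := fun N => closure (convexHull ℝ (x '' Set.Ici N)) with hC
  have hanti : ∀ {N N'}, N ≤ N' → C N' ⊆ C N := fun h =>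
    closure_mono (convexHull_mono (Set.image_mono (Set.Ici_subset_Ici.2 h)))
  have hconv : ∀ N, Convex ℝ (C N) := fun N => (convex_convexHull ℝ _).closure
  have hx : ∀ N, x N ∈ C N := fun N =>
    subset_closure (subset_convexHull ℝ _ ⟨N, Set.self_mem_Ici, rfl⟩)
  have hmin : ∀ N, ∃ v ∈ C N, ∀ w ∈ C N, ‖v‖ ≤ ‖w‖ := by
    intro N
    obtain ⟨v, hv, h⟩ := exists_norm_eq_iInf_of_complete_convex ⟨x N, hx N⟩
      (isClosed_closure (s := convexHull ℝ (x '' Set.Ici N))).isComplete (hconv N) 0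
    refine ⟨v, hv, fun w hw => ?_⟩
    have h1 : ‖(0 : W) - v‖ ≤ ‖(0 : W) - w‖ := by
      rw [h]
      exact ciInf_le (f := fun w : C N => ‖(0 : W) - w‖)
        ⟨0, by rintro _ ⟨y, rfl⟩; exact norm_nonneg _⟩ ⟨w, hw⟩
    simpa using h1
  choose c hcmem hcmin using hmin
  have hmono : Monotone fun N => ‖c N‖ ^ 2 := fun N N' h => by
    have := hcmin N (c N') (hanti h (hcmem N'))
    dsimp only
    gcongr
  have hbdd : BddAbove (Set.range fun N => ‖c N‖ ^ 2) := by
    refine ⟨R ^ 2, ?_⟩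
    rintro _ ⟨N, rfl⟩
    have := (hcmin N (x N) (hx N)).trans (hR N)
    dsimp only
    gcongr
  have hlim := tendsto_atTop_ciSup hmono hbdd
  set L := ⨆ N, ‖c N‖ ^ 2
  have hle : ∀ N, ‖c N‖ ^ 2 ≤ L := fun N => le_ciSup hbdd N
  have hcauchy : CauchySeq c := by
    refine Metric.cauchySeq_iff'.2 fun ε hε => ?_
    -- By the parallelogram law and minimality of `c N`, the squared distance of `c n` and `c N` is
    -- at most 2(‖c n‖² - ‖c N‖²) ≤ 2(L - ‖c N‖²), so the margin ε²/4 is more than enough.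
    have hev := hlim.eventually (lt_mem_nhds (show L - ε ^ 2 / 4 < L by
      have : 0 < ε ^ 2 := by positivity
      linarith))
    obtain ⟨N, hN⟩ := hev.exists
    refine ⟨N, fun n hn => ?_⟩
    have hmid : (1 / 2 : ℝ) • c n + (1 / 2 : ℝ) • c N ∈ C N :=
      hconv N (hanti hn (hcmem n)) (hcmem N) (by norm_num) (by norm_num) (by norm_num)
    have h1 := hcmin N _ hmid
    rw [← smul_add, norm_smul] at h1
    have h2 : 2 * ‖c N‖ ≤ ‖c n + c N‖ := by
      rw [show ‖(1 / 2 : ℝ)‖ = 1 / 2 by norm_num] at h1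
      linarith
    have h3 := parallelogram_law_with_norm ℝ (c n) (c N)
    have h4 : (2 * ‖c N‖) ^ 2 ≤ ‖c n + c N‖ ^ 2 := by gcongr
    have h5 := hle n
    have h6 : ‖c n - c N‖ ^ 2 < ε ^ 2 := by nlinarith
    rw [dist_eq_norm]
    exact lt_of_pow_lt_pow_left₀ 2 hε.le h6
  obtain ⟨c', hc'⟩ := cauchySeq_tendsto_of_complete hcauchy
  refine ⟨c', fun N => isClosed_closure.mem_of_tendsto hc' ?_⟩
  filter_upwards [eventually_ge_atTop N] with n hn using hanti hn (hcmem n)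

variable {H : Type*} [NormedAddCommGroup H] [NormedSpace ℝ H]

/-- If `x n` is bounded and `T (x n)` converges, some point over the limit lies in the closed
convex hulls of all tails. -/
theorem exists_preimage_mem_closedConvexHull_tails (T : W →L[ℝ] H) {x : ℕ → W} {R : ℝ}
    (hR : ∀ n, ‖x n‖ ≤ R) {v : H} (hv : Tendsto (fun n => T (x n)) atTop (𝓝 v)) :
    ∃ c, T c = v ∧ ∀ N, c ∈ closure (convexHull ℝ (x '' Set.Ici N)) := by
  obtain ⟨c, hc⟩ := exists_mem_closedConvexHull_tails hR
  refine ⟨c, ?_, hc⟩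
  refine eq_of_forall_dist_le fun ε hε => ?_
  obtain ⟨N, hN⟩ := Metric.tendsto_atTop.1 hv ε hε
  -- The preimage of a closed ball is closed and convex, so it absorbs the whole closed hull of a
  -- tail as soon as it contains the tail.
  have hsub : closure (convexHull ℝ (x '' Set.Ici N)) ⊆ T ⁻¹' Metric.closedBall v ε := by
    refine closure_minimal (convexHull_min ?_ ?_) (Metric.isClosed_closedBall.preimage T.continuous)
    · rintro _ ⟨n, hn, rfl⟩
      exact (hN n hn).le
    · exact (convex_closedBall v ε).linear_preimage (T : W →ₗ[ℝ] H)
  exact hsub (hc N)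

/-- Lower semicontinuity of the norm along sequences whose images converge. -/
theorem exists_preimage_norm_sq_le (T : W →L[ℝ] H) {x : ℕ → W} {v : H} {c : ℕ → ℝ} {c₀ : ℝ}
    (hx : ∀ n, ‖x n‖ ^ 2 ≤ c n) (hc : Tendsto c atTop (𝓝 c₀))
    (hv : Tendsto (fun n => T (x n)) atTop (𝓝 v)) :
    ∃ y, T y = v ∧ ‖y‖ ^ 2 ≤ c₀ := by
  obtain ⟨R, hR⟩ := hc.bddAbove_range
  have hR' : ∀ n, ‖x n‖ ≤ Real.sqrt R := fun n =>
    Real.le_sqrt_of_sq_le ((hx n).trans (hR ⟨n, rfl⟩))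
  obtain ⟨y, hy, hmem⟩ := exists_preimage_mem_closedConvexHull_tails T hR' hv
  refine ⟨y, hy, le_of_forall_pos_le_add fun ε hε => ?_⟩
  have hc0 : 0 ≤ c₀ := ge_of_tendsto' hc fun n => (sq_nonneg _).trans (hx n)
  obtain ⟨N, hN⟩ := (eventually_atTop.1 (hc.eventually (ge_mem_nhds (by linarith : c₀ < c₀ + ε))))
  have hsub : closure (convexHull ℝ (x '' Set.Ici N)) ⊆
      Metric.closedBall 0 (Real.sqrt (c₀ + ε)) := by
    refine closure_minimal (convexHull_min ?_ (convex_closedBall _ _)) Metric.isClosed_closedBall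
    rintro _ ⟨n, hn, rfl⟩
    rw [mem_closedBall_zero_iff]
    exact Real.le_sqrt_of_sq_le ((hx n).trans (hN n hn))
  have h := hsub (hmem N)
  rw [mem_closedBall_zero_iff] at h
  calc ‖y‖ ^ 2 ≤ Real.sqrt (c₀ + ε) ^ 2 := by gcongr
    _ = c₀ + ε := Real.sq_sqrt (by linarith)

/-- Bounded sequences whose images under an injective operator converge are weakly convergent. -/
theorem tendsto_inner_of_tendsto_image (T : W →L[ℝ] H) (hT : Function.Injective T) {x : ℕ → W}
    {R : ℝ} (hR : ∀ n, ‖x n‖ ≤ R) {y : W} (hv : Tendsto (fun n => T (x n)) atTop (𝓝 (T y)))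
    (z : W) : Tendsto (fun n => inner ℝ (x n) z) atTop (𝓝 (inner ℝ y z)) := by
  have key : ∀ z : W, ∀ a, a < inner ℝ y z → ∀ᶠ n in atTop, a < inner ℝ (x n) z := by
    intro z a ha
    by_contra hcon
    rw [not_eventually] at hcon
    -- A failing subsequence lies in a closed half-space, which then contains the common point of
    -- its tail hulls. Injectivity of `T` forces this point to be `y`.
    obtain ⟨φ, hφ, hle⟩ := extraction_of_frequently_atTop hcon
    obtain ⟨c, hcv, hmem⟩ := exists_preimage_mem_closedConvexHull_tails T
      (x := x ∘ φ) (fun n => hR _) (hv.comp hφ.tendsto_atTop)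
    have hcy : c = y := hT hcv
    have hsub : closure (convexHull ℝ ((x ∘ φ) '' Set.Ici 0)) ⊆ {w | inner ℝ w z ≤ a} := by
      refine closure_minimal (convexHull_min ?_ ?_) ?_
      · rintro _ ⟨n, -, rfl⟩
        exact not_lt.1 (hle n)
      · intro u hu v hv s t hs ht hst
        change inner ℝ (s • u + t • v) z ≤ a
        change inner ℝ u z ≤ a at hu
        change inner ℝ v z ≤ a at hv
        rw [inner_add_left, real_inner_smul_left, real_inner_smul_left]
        calc s * inner ℝ u z + t * inner ℝ v z ≤ s * a + t * a := by gcongr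
          _ = a := by rw [← add_mul, hst, one_mul]
      · exact isClosed_le (by fun_prop) continuous_const
    exact absurd (hsub (hmem 0)) (by simpa [hcy] using ha)
  refine tendsto_order.2 ⟨fun a ha => key z a ha, fun a ha => ?_⟩
  have := key (-z) (-a) (by simpa using ha)
  filter_upwards [this] with n hn
  simpa using hn

end Mazur

/-! ### Existence of the closure of a closable form -/

section Closure

universe v

variable {X : Type*} [MeasurableSpace X] {m : Measure X}

/-- A Hilbert space `W` identified with the domain of `F`, whose inner product is `ℰ₁`. -/
structure L2Form.IsModel {F : L2Form m} {W : Type*} [NormedAddCommGroup W]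
    [InnerProductSpace ℝ W] (e : W ≃ₗ[ℝ] F.domain) : Prop where
  form₁_eq : ∀ a b, F.form₁ (e a) (e b) = inner ℝ a b
  norm_le : ∀ a, ‖(e a : Lp ℝ 2 m)‖ ≤ ‖a‖

section Extension

variable {V : Type*} [SeminormedAddCommGroup V] [InnerProductSpace ℝ V]
  (J : V →L[ℝ] Lp ℝ 2 m)

/-- The extension of an operator to the completion. -/
def extendCompletion : UniformSpace.Completion V →L[ℝ] Lp ℝ 2 m :=
  J.extend (UniformSpace.Completion.toComplL (𝕜 := ℝ) (E := V))

theorem extendCompletion_coe (v : V) : extendCompletion J (v : UniformSpace.Completion V) = J v :=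
  ContinuousLinearMap.extend_eq (e := UniformSpace.Completion.toComplL (𝕜 := ℝ) (E := V)) J
    UniformSpace.Completion.denseRange_coe
    (UniformSpace.Completion.isUniformInducing_coe V) v

theorem cauchySeq_completion_coe_iff {V : Type*} [UniformSpace V] {s : ℕ → V} :
    CauchySeq (fun n => (s n : UniformSpace.Completion V)) ↔ CauchySeq s := by
  have h := (UniformSpace.Completion.isUniformInducing_coe V).cauchy_map_iff (F := map s atTop)
  rwa [map_map] at h

theorem exists_seq_tendsto_completion {V : Type*} [SeminormedAddCommGroup V]
    (a : UniformSpace.Completion V) :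
    ∃ s : ℕ → V, Tendsto (fun n => (s n : UniformSpace.Completion V)) atTop (𝓝 a) := by
  have ha : a ∈ closure (Set.range ((↑) : V → UniformSpace.Completion V)) :=
    UniformSpace.Completion.denseRange_coe a
  obtain ⟨t, ht, hta⟩ := mem_closure_iff_seq_limit.1 ha
  choose s hs using ht
  exact ⟨s, by simpa only [hs] using hta⟩

/-- Closability is exactly this injectivity: a Cauchy sequence whose image tends to zero represents
an element of the kernel, and it must be null. -/
theorem extendCompletion_injective
    (hcl : ∀ s : ℕ → V, CauchySeq s → Tendsto (fun n => J (s n)) atTop (𝓝 0) →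
      Tendsto (fun n => ‖s n‖) atTop (𝓝 0)) : Function.Injective (extendCompletion J) := by
  refine (injective_iff_map_eq_zero _).2 fun a ha => ?_
  obtain ⟨s, hs⟩ := exists_seq_tendsto_completion a
  have h1 : CauchySeq s := by
    exact cauchySeq_completion_coe_iff.1 hs.cauchySeq
  have h2 : Tendsto (fun n => J (s n)) atTop (𝓝 0) := by
    have := ((extendCompletion J).continuous.tendsto a).comp hs
    simpa only [Function.comp_def, extendCompletion_coe, ha] using this
  have h3 := hcl s h1 h2
  have h4 : Tendsto (fun n => ‖(s n : UniformSpace.Completion V)‖) atTop (𝓝 ‖a‖) := hs.norm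
  simp only [UniformSpace.Completion.norm_coe] at h4
  exact norm_eq_zero.1 (tendsto_nhds_unique h4 h3)

/-- The form on the range of an injective operator `T` with `ℰ₁` the inner product of the
source. -/
def rangeForm {W : Type*} [NormedAddCommGroup W] [InnerProductSpace ℝ W]
    (T : W →L[ℝ] Lp ℝ 2 m) (hT : Function.Injective T) : L2Form m where
  domain := LinearMap.range (T : W →ₗ[ℝ] Lp ℝ 2 m)
  form := LinearMap.mk₂ ℝ
    (fun u v => inner ℝ ((LinearEquiv.ofInjective (T : W →ₗ[ℝ] Lp ℝ 2 m) hT).symm u)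
      ((LinearEquiv.ofInjective (T : W →ₗ[ℝ] Lp ℝ 2 m) hT).symm v)
        - inner ℝ (u : Lp ℝ 2 m) (v : Lp ℝ 2 m))
    (fun u u' v => by simp only [map_add, inner_add_left, Submodule.coe_add]; ring)
    (fun c u v => by
      simp only [map_smul, real_inner_smul_left, Submodule.coe_smul, smul_eq_mul]; ring)
    (fun u v v' => by simp only [map_add, inner_add_right, Submodule.coe_add]; ring)
    (fun c u v => by
      simp only [map_smul, real_inner_smul_right, Submodule.coe_smul, smul_eq_mul]; ring)

end Extension

theorem tendsto_eLpNorm_val_sub_iff {f : ℕ → X → ℝ} {g : ℕ → Lp ℝ 2 m}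
    (hfg : ∀ n, f n =ᵐ[m] g n) (u : Lp ℝ 2 m) :
    Tendsto (fun n => eLpNorm (f n - (u : X → ℝ)) 2 m) atTop (𝓝 0) ↔
      Tendsto g atTop (𝓝 u) := by
  rw [Lp.tendsto_Lp_iff_tendsto_eLpNorm']
  refine iff_of_eq (congrArg (fun φ => Tendsto φ atTop (𝓝 0)) (funext fun n => ?_))
  exact eLpNorm_congr_ae ((hfg n).sub (EventuallyEq.refl _ _))

/-- The closure is realised on the completion of `V`, where the inner product plays the role of ℰ₁
and `J` of the passage to L²-classes. The domain is the range of the extended `J`. The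
parametrisation `i` lets `V` carry the ℰ₁ structure while the class stays in `α`. -/
theorem exists_closure_of_norm {α : Type*} {V : Type v} [AddCommGroup α] [SeminormedAddCommGroup V]
    [InnerProductSpace ℝ V] (P : PreForm α X) (i : V →+ α) (hi : Set.range i = P.dom)
    (J : V →L[ℝ] Lp ℝ 2 m) (hJ : ∀ v, P.val (i v) =ᵐ[m] J v)
    (hform : ∀ v w, P.form (i v) (i w) = inner ℝ v w - inner ℝ (J v) (J w))
    (hJn : ∀ v, ‖J v‖ ≤ ‖v‖) (hcl : P.IsClosable m) :
    ∃ (W : Type v) (_ : NormedAddCommGroup W) (_ : InnerProductSpace ℝ W) (_ : CompleteSpace W)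
      (F : L2Form m) (e : W ≃ₗ[ℝ] F.domain) (ι : V →ₗ[ℝ] W),
      P.IsClosure F ∧ L2Form.IsModel e ∧ DenseRange ι ∧ ∀ v, (e (ι v) : Lp ℝ 2 m) = J v := by
  have hself : ∀ v, P.form (i v) (i v) = ‖v‖ ^ 2 - ‖J v‖ ^ 2 := fun v => by
    rw [hform, real_inner_self_eq_norm_sq, real_inner_self_eq_norm_sq]
  -- Cauchy sequences in the class
  have hcauchy : ∀ s : ℕ → V, CauchySeq (fun n => J (s n)) →
      (P.IsCauchySeq (fun n => i (s n)) ↔ CauchySeq s) := by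
    intro s hs
    have hs' : Tendsto (fun p : ℕ × ℕ => ‖J (s p.1 - s p.2)‖ ^ 2) atTop (𝓝 0) := by
      have := (cauchySeq_iff_tendsto_dist_atTop_0.1 hs).pow 2
      simpa [dist_eq_norm, map_sub] using this
    have hiff : P.IsCauchySeq (fun n => i (s n)) ↔
        Tendsto (fun p : ℕ × ℕ => ‖s p.1 - s p.2‖ ^ 2 - ‖J (s p.1 - s p.2)‖ ^ 2) atTop (𝓝 0) := by
      refine ⟨fun h => ?_, fun h => ⟨fun n => hi ▸ ⟨s n, rfl⟩, ?_⟩⟩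
      · simpa only [← map_sub, hself] using h.2
      · simpa only [← map_sub, hself] using h
    rw [hiff, cauchySeq_iff_tendsto_dist_atTop_0]
    constructor
    · intro h
      have h1 := h.add hs'
      simp only [sub_add_cancel, add_zero] at h1
      have h2 := h1.sqrt
      simpa [Real.sqrt_sq, dist_eq_norm] using h2
    · intro h
      have h1 := (h.pow 2).sub hs'
      simpa [dist_eq_norm] using h1
  -- This is the only use of closability; without it distinct limits in the completion could share
  -- an L²-class.
  have hinj : Function.Injective (extendCompletion J) := by
    refine extendCompletion_injective J fun s hs hJs => ?_
    have h1 := hcl (fun n => i (s n)) ((hcauchy s hJs.cauchySeq).2 hs) (by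
      have := (tendsto_eLpNorm_val_sub_iff (fun n => hJ (s n)) 0).2 hJs
      refine this.congr fun n => eLpNorm_congr_ae ?_
      filter_upwards [Lp.coeFn_zero ℝ 2 m] with x hx
      rw [Pi.sub_apply, hx, Pi.zero_apply, sub_zero])
    simp only [hself] at h1
    have h2 : Tendsto (fun n => ‖J (s n)‖ ^ 2) atTop (𝓝 0) := by simpa using hJs.norm.pow 2
    have h3 := (h1.add h2).sqrt
    simpa [Real.sqrt_sq] using h3
  set T := extendCompletion J with hT
  let F := rangeForm T hinj
  let e : UniformSpace.Completion V ≃ₗ[ℝ] F.domain :=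
    LinearEquiv.ofInjective (T : UniformSpace.Completion V →ₗ[ℝ] Lp ℝ 2 m) hinj
  have he : ∀ a, (e a : Lp ℝ 2 m) = T a := fun a => rfl
  have hFform : ∀ a b, F.form (e a) (e b) = inner ℝ a b - inner ℝ (T a) (T b) := by
    intro a b
    change inner ℝ (e.symm (e a)) (e.symm (e b)) - inner ℝ (e a : Lp ℝ 2 m) (e b : Lp ℝ 2 m) = _
    rw [e.symm_apply_apply, e.symm_apply_apply, he, he]
  have hlimit : ∀ (s : ℕ → α) (u : Lp ℝ 2 m), P.Approximates m s u →
      ∃ (s' : ℕ → V) (a : UniformSpace.Completion V), (∀ n, i (s' n) = s n) ∧ T a = u ∧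
        Tendsto (fun n => (s' n : UniformSpace.Completion V)) atTop (𝓝 a) := by
    intro s u h
    have hs : ∀ n, ∃ v, i v = s n := fun n => by
      have := h.1.1 n
      rwa [← hi] at this
    choose s' hs' using hs
    have hJs : Tendsto (fun n => J (s' n)) atTop (𝓝 u) :=
      (tendsto_eLpNorm_val_sub_iff (f := fun n => P.val (s n))
        (fun n => by rw [← hs']; exact hJ (s' n)) u).1 h.2
    have hc : CauchySeq s' := (hcauchy s' hJs.cauchySeq).1 (by simpa only [hs'] using h.1)
    obtain ⟨a, ha⟩ := cauchySeq_tendsto_of_complete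
      (cauchySeq_completion_coe_iff.2 hc)
    refine ⟨s', a, hs', ?_, ha⟩
    have h1 := (T.continuous.tendsto a).comp ha
    simp only [Function.comp_def, hT, extendCompletion_coe] at h1
    exact tendsto_nhds_unique h1 hJs
  refine ⟨UniformSpace.Completion V, inferInstance, inferInstance, inferInstance, F, e,
    (UniformSpace.Completion.toComplL (𝕜 := ℝ) (E := V)).toLinearMap, ⟨?_, ?_⟩, ⟨?_, ?_⟩,
    UniformSpace.Completion.denseRange_coe, fun v => extendCompletion_coe J v⟩
  · intro u
    constructor
    · rintro ⟨a, rfl⟩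
      obtain ⟨s, hs⟩ := exists_seq_tendsto_completion a
      have hJs : Tendsto (fun n => J (s n)) atTop (𝓝 (T a)) := by
        have h1 := (T.continuous.tendsto a).comp hs
        simpa only [Function.comp_def, hT, extendCompletion_coe] using h1
      exact ⟨fun n => i (s n), (hcauchy s hJs.cauchySeq).2
        (cauchySeq_completion_coe_iff.1 hs.cauchySeq),
        (tendsto_eLpNorm_val_sub_iff (fun n => hJ (s n)) _).2 hJs⟩
    · rintro ⟨s, hs⟩
      obtain ⟨s', a, -, ha, -⟩ := hlimit s u hs
      exact ⟨a, ha⟩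
  · intro u v s t hs ht
    obtain ⟨s', a, hs', ha, hsa⟩ := hlimit s u hs
    obtain ⟨t', b, ht', hb, htb⟩ := hlimit t v ht
    have hu : u = e a := Subtype.ext ha.symm
    have hv : v = e b := Subtype.ext hb.symm
    rw [hu, hv, hFform]
    have hlim : Tendsto (fun n => inner ℝ (s' n : UniformSpace.Completion V)
        (t' n : UniformSpace.Completion V) -
        inner ℝ (T (s' n : UniformSpace.Completion V)) (T (t' n : UniformSpace.Completion V)))
        atTop (𝓝 (inner ℝ a b - inner ℝ (T a) (T b))) :=
      (hsa.inner htb).sub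
        (((T.continuous.tendsto a).comp hsa).inner ((T.continuous.tendsto b).comp htb))
    refine hlim.congr fun n => ?_
    rw [← hs', ← ht', hform, UniformSpace.Completion.inner_coe, hT, extendCompletion_coe,
      extendCompletion_coe]
  · intro a b
    rw [L2Form.form₁, hFform, he, he]
    ring
  · intro a
    rw [he]
    refine UniformSpace.Completion.induction_on a ?_ fun v => ?_
    · exact isClosed_le (by fun_prop) (by fun_prop)
    · rw [hT, extendCompletion_coe, UniformSpace.Completion.norm_coe]
      exact hJn v

/-- A closable symmetric positive form on a linear class has a closure, whose domain is a Hilbert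
space for `ℰ₁` in which the class is dense. -/
theorem exists_closure_model {α : Type v} [AddCommGroup α] [Module ℝ α] (P : PreForm α X)
    (D : Submodule ℝ α) (hD : P.dom = D) (B : D →ₗ[ℝ] D →ₗ[ℝ] ℝ)
    (hB : ∀ u v : D, P.form u v = B u v) (hsymm : ∀ u v, B u v = B v u)
    (hnonneg : ∀ u, 0 ≤ B u u) (J : D →ₗ[ℝ] Lp ℝ 2 m) (hJ : ∀ u : D, P.val u =ᵐ[m] J u)
    (hcl : P.IsClosable m) :
    ∃ (W : Type v) (_ : NormedAddCommGroup W) (_ : InnerProductSpace ℝ W) (_ : CompleteSpace W)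
      (F : L2Form m) (e : W ≃ₗ[ℝ] F.domain) (ι : D →ₗ[ℝ] W),
      P.IsClosure F ∧ L2Form.IsModel e ∧ DenseRange ι ∧ ∀ v, (e (ι v) : Lp ℝ 2 m) = J v := by
  -- In general ℰ₁ is only semidefinite on the class, since a nonzero function may vanish almost
  -- everywhere. The completion later performs the separation.
  let core : PreInnerProductSpace.Core ℝ D :=
    { inner := fun u v => B u v + inner ℝ (J u) (J v)
      conj_inner_symm := fun u v => by
        change B v u + inner ℝ (J v) (J u) = B u v + inner ℝ (J u) (J v)
        rw [hsymm, real_inner_comm]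
      re_inner_nonneg := fun u => add_nonneg (hnonneg u) real_inner_self_nonneg
      add_left := fun u v w => by
        change B (u + v) w + inner ℝ (J (u + v)) (J w) = (B u w + _) + (B v w + _)
        rw [map_add, map_add, LinearMap.add_apply, inner_add_left]
        ring
      smul_left := fun u v r => by
        change B (r • u) v + inner ℝ (J (r • u)) (J v) = r * (B u v + _)
        rw [map_smul, map_smul, LinearMap.smul_apply, real_inner_smul_left, smul_eq_mul]
        ring }
  let _ : SeminormedAddCommGroup D :=
    @InnerProductSpace.Core.toSeminormedAddCommGroup ℝ D _ _ _ core
  let _ : InnerProductSpace ℝ D := InnerProductSpace.ofCore core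
  have hinner : ∀ u v : D, inner ℝ u v = B u v + inner ℝ (J u) (J v) := fun u v => rfl
  have hJn : ∀ v : D, ‖J v‖ ≤ ‖v‖ := fun v => by
    refine le_of_sq_le_sq ?_ (norm_nonneg v)
    rw [← real_inner_self_eq_norm_sq v, hinner, real_inner_self_eq_norm_sq]
    linarith [hnonneg v]
  let J' : D →L[ℝ] Lp ℝ 2 m := J.mkContinuous 1 fun v => by simpa using hJn v
  exact exists_closure_of_norm P D.subtype.toAddMonoidHom (by
      rw [hD]; ext x; simp) J' hJ
    (fun v w => by
      change P.form v w = inner ℝ v w - inner ℝ (J v) (J w)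
      rw [hB, hinner]; ring) hJn hcl

end Closure

universe v

/-! ### Forms with a carré du champ satisfying the chain rule -/

section L2Convergence

variable {X : Type*} [MeasurableSpace X] {m : Measure X} [IsFiniteMeasure m]

/-- Finiteness of `m` puts the constants into L², so the pointwise bound becomes ‖g n - v‖ ≤ |δ n|
‖1‖ + ‖s n - u‖. -/
theorem tendsto_Lp_of_ae_abs_sub_le {g s : ℕ → Lp ℝ 2 m} {v u : Lp ℝ 2 m} {δ : ℕ → ℝ}
    (hδ : Tendsto δ atTop (𝓝 0)) (hs : Tendsto s atTop (𝓝 u))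
    (h : ∀ n, ∀ᵐ x ∂m, |g n x - v x| ≤ δ n + |s n x - u x|) : Tendsto g atTop (𝓝 v) := by
  rw [tendsto_iff_norm_sub_tendsto_zero] at hs ⊢
  have hlim : Tendsto (fun n => ‖δ n • Lp.const 2 m (1 : ℝ)‖ + ‖s n - u‖) atTop (𝓝 0) := by
    have h1 : Tendsto (fun n => ‖δ n • Lp.const 2 m (1 : ℝ)‖) atTop (𝓝 0) := by
      simpa using (hδ.smul_const (Lp.const 2 m (1 : ℝ))).norm
    simpa using h1.add hs
  refine squeeze_zero (fun n => norm_nonneg _) (fun n => ?_) hlim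
  have hle : ‖g n - v‖ ≤ ‖δ n • Lp.const 2 m (1 : ℝ) + |s n - u|‖ := by
    refine Lp.norm_le_norm_of_ae_le ?_
    filter_upwards [h n, Lp.coeFn_sub (g n) v, Lp.coeFn_sub (s n) u,
      Lp.coeFn_add (δ n • Lp.const 2 m (1 : ℝ)) |s n - u|,
      Lp.coeFn_smul (δ n) (Lp.const 2 m (1 : ℝ)), Lp.coeFn_abs (s n - u),
      Lp.coeFn_const (p := 2) (μ := m) (1 : ℝ)] with x h0 h1 h2 h3 h4 h5 h6
    rw [h1, h3, Pi.add_apply, h4, h5, Pi.smul_apply, h6, h2, Pi.sub_apply, Pi.sub_apply]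
    simp only [Function.const_apply, smul_eq_mul, mul_one, Real.norm_eq_abs]
    exact h0.trans (le_abs_self _)
  refine hle.trans ((norm_add_le _ _).trans ?_)
  rw [norm_abs_eq_norm]

end L2Convergence

/-! ### Smooth contractions of the real line. -/

section Contractions

theorem abs_sub_le_of_abs_deriv_le_one {φ : ℝ → ℝ} (hφ : ContDiff ℝ 1 φ)
    (h1 : ∀ s, |deriv φ s| ≤ 1) (s t : ℝ) : |φ s - φ t| ≤ |s - t| := by
  have h := (lipschitzWith_of_nnnorm_deriv_le (C := 1) (hφ.differentiable (by norm_num))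
    (fun s => by rw [← NNReal.coe_le_coe]; simpa using h1 s)).dist_le_mul s t
  simpa [Real.dist_eq] using h

/-- A smooth approximation of the absolute value. -/
def smoothAbs (δ s : ℝ) : ℝ := Real.sqrt (s ^ 2 + δ ^ 2)

theorem contDiff_smoothAbs {δ : ℝ} (hδ : 0 < δ) : ContDiff ℝ 1 (smoothAbs δ) := by
  unfold smoothAbs
  exact ContDiff.sqrt (by fun_prop) fun s => by positivity

theorem hasDerivAt_smoothAbs {δ : ℝ} (hδ : 0 < δ) (s : ℝ) :
    HasDerivAt (smoothAbs δ) (s / smoothAbs δ s) s := by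
  have h : HasDerivAt (fun s : ℝ => s ^ 2 + δ ^ 2) (2 * s) s := by
    simpa using (hasDerivAt_pow 2 s).add_const (δ ^ 2)
  have h2 := h.sqrt (by positivity)
  refine h2.congr_deriv ?_
  rw [smoothAbs, mul_div_mul_left _ _ two_ne_zero]

theorem abs_le_smoothAbs (δ s : ℝ) : |s| ≤ smoothAbs δ s := by
  rw [smoothAbs]
  exact Real.abs_le_sqrt (by nlinarith [sq_nonneg δ])

theorem smoothAbs_le {δ : ℝ} (hδ : 0 < δ) (s : ℝ) : smoothAbs δ s ≤ |s| + δ := by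
  rw [smoothAbs]
  refine Real.sqrt_le_iff.2 ⟨by positivity, ?_⟩
  nlinarith [abs_nonneg s, sq_abs s]

theorem abs_deriv_smoothAbs_le {δ : ℝ} (hδ : 0 < δ) (s : ℝ) : |deriv (smoothAbs δ) s| ≤ 1 := by
  rw [(hasDerivAt_smoothAbs hδ s).deriv, abs_div]
  have h := abs_le_smoothAbs δ s
  exact div_le_one_of_le₀ (h.trans (le_abs_self _)) (abs_nonneg _)

/-- A smooth approximation of the unit contraction `s ↦ (s ∨ 0) ∧ 1`. -/
def smoothClamp (δ s : ℝ) : ℝ := (1 + smoothAbs δ s - smoothAbs δ (s - 1)) / 2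

theorem contDiff_smoothClamp {δ : ℝ} (hδ : 0 < δ) : ContDiff ℝ 1 (smoothClamp δ) := by
  unfold smoothClamp
  have h := contDiff_smoothAbs hδ
  exact ((contDiff_const.add h).sub (h.comp (contDiff_id.sub contDiff_const))).div_const 2

theorem abs_deriv_smoothClamp_le {δ : ℝ} (hδ : 0 < δ) (s : ℝ) :
    |deriv (smoothClamp δ) s| ≤ 1 := by
  have h1 := hasDerivAt_smoothAbs hδ s
  have h2 := (hasDerivAt_smoothAbs hδ (s - 1)).comp_sub_const s 1
  have h3 : HasDerivAt (smoothClamp δ)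
      ((s / smoothAbs δ s - (s - 1) / smoothAbs δ (s - 1)) / 2) s :=
    ((h1.const_add 1).sub h2).div_const 2
  have b1 := abs_deriv_smoothAbs_le hδ s
  have b2 := abs_deriv_smoothAbs_le hδ (s - 1)
  rw [(hasDerivAt_smoothAbs hδ _).deriv, abs_le] at b1 b2
  rw [h3.deriv, abs_le]
  constructor <;> linarith [b1.1, b1.2, b2.1, b2.2]

theorem abs_smoothClamp_sub_le {δ : ℝ} (hδ : 0 < δ) (s : ℝ) :
    |smoothClamp δ s - min (max s 0) 1| ≤ δ := by
  have h1 := abs_le_smoothAbs δ s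
  have h2 := smoothAbs_le hδ s
  have h3 := abs_le_smoothAbs δ (s - 1)
  have h4 := smoothAbs_le hδ (s - 1)
  -- This expression of the unit contraction through absolute values is the source of `smoothClamp`,
  -- and it makes the error at most `δ`.
  have h5 : min (max s 0) 1 = (1 + |s| - |s - 1|) / 2 := by
    rcases le_total s 0 with hs | hs
    · rw [max_eq_right hs, abs_of_nonpos hs, abs_of_nonpos (by linarith), min_eq_left zero_le_one]
      ring
    · rw [max_eq_left hs, abs_of_nonneg hs]
      rcases le_total s 1 with hs1 | hs1
      · rw [min_eq_left hs1, abs_of_nonpos (by linarith)]; ring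
      · rw [min_eq_right hs1, abs_of_nonneg (by linarith)]; ring
  rw [h5, smoothClamp, abs_le]
  constructor <;> linarith

theorem abs_clamp_sub_clamp_le (s t : ℝ) : |min (max s 0) 1 - min (max t 0) 1| ≤ |s - t| :=
  (abs_min_sub_min_le_max _ _ _ _).trans (by
    simp only [sub_self, abs_zero]
    refine max_le ((abs_max_sub_max_le_max _ _ _ _).trans ?_) (abs_nonneg _)
    simp)

/-- A smooth contraction close to the identity with a critical point at `0`. -/
def flatten (ε s : ℝ) : ℝ := s - ε * Real.arctan (s / ε)

theorem hasDerivAt_flatten {ε : ℝ} (hε : 0 < ε) (s : ℝ) :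
    HasDerivAt (flatten ε) (s ^ 2 / (s ^ 2 + ε ^ 2)) s := by
  have h1 : HasDerivAt (fun s : ℝ => s / ε) (1 / ε) s := (hasDerivAt_id s).div_const ε
  have h2 := (hasDerivAt_id s).sub ((h1.arctan).const_mul ε)
  refine h2.congr_deriv ?_
  field_simp
  ring

theorem contDiff_flatten (ε : ℝ) : ContDiff ℝ 1 (flatten ε) := by
  unfold flatten
  exact contDiff_id.sub (contDiff_const.mul (Real.contDiff_arctan.comp (contDiff_id.div_const ε)))

theorem abs_deriv_flatten_le {ε : ℝ} (hε : 0 < ε) (s : ℝ) : |deriv (flatten ε) s| ≤ 1 := by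
  rw [(hasDerivAt_flatten hε s).deriv, abs_of_nonneg (by positivity)]
  exact div_le_one_of_le₀ (by nlinarith [sq_nonneg ε]) (by positivity)

theorem abs_flatten_sub_le {ε : ℝ} (hε : 0 < ε) (s : ℝ) : |flatten ε s - s| ≤ 2 * ε := by
  have h1 := Real.arctan_lt_pi_div_two (s / ε)
  have h2 := Real.neg_pi_div_two_lt_arctan (s / ε)
  have h3 := Real.pi_le_four
  have h4 : |Real.arctan (s / ε)| ≤ 2 := abs_le.2 ⟨by linarith, by linarith⟩
  rw [flatten, show s - ε * Real.arctan (s / ε) - s = -(ε * Real.arctan (s / ε)) by ring, abs_neg,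
    abs_mul, abs_of_pos hε]
  nlinarith

end Contractions

/-- Second countability makes the complement of the support a null set for |u| m. -/
theorem ae_eq_zero_of_notMem_supp {X : Type*} [TopologicalSpace X] [MeasurableSpace X]
    [SecondCountableTopology X] {m : Measure X} (u : Lp ℝ 2 m) :
    ∀ᵐ x ∂m, x ∉ L2Form.supp u → u x = 0 := by
  have h := Measure.measure_compl_support (μ := m.withDensity fun z => ‖u z‖ₑ)
  have hmeas : AEMeasurable (fun z => ‖u z‖ₑ) m := (Lp.aestronglyMeasurable u).enorm
  rw [← mem_ae_iff] at h
  have h' : ∀ᵐ x ∂(m.withDensity fun z => ‖u z‖ₑ), x ∈ L2Form.supp u := h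
  rw [ae_withDensity_iff' hmeas] at h'
  filter_upwards [h'] with x hx hxs
  by_contra hne
  exact hxs (hx (by simpa using hne))

/-! ### Forms with a carré du champ: Cauchy–Schwarz, Markov property and locality. -/

section Core

variable {α X : Type*} [AddCommGroup α] [Module ℝ α] [TopologicalSpace X] [MeasurableSpace X]

/-- A form `∫ Γ(u, v) dm` on a linear class of bounded continuous functions, with a positive
bilinear `Γ` satisfying the chain rule. -/
structure DiffusionCore (m : Measure X) (P : PreForm α X) (Γ : α → α → X → ℝ) : Prop where
  zero_mem : (0 : α) ∈ P.dom
  add_mem : ∀ {u v}, u ∈ P.dom → v ∈ P.dom → u + v ∈ P.dom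
  smul_mem : ∀ (c : ℝ) {u}, u ∈ P.dom → c • u ∈ P.dom
  val_add : ∀ u v, P.val (u + v) = P.val u + P.val v
  val_smul : ∀ (c : ℝ) u, P.val (c • u) = c • P.val u
  continuous_val : ∀ {u}, u ∈ P.dom → Continuous (P.val u)
  bounded_val : ∀ {u}, u ∈ P.dom → ∃ C, ∀ x, |P.val u x| ≤ C
  form_eq : ∀ {u v}, u ∈ P.dom → v ∈ P.dom → P.form u v = ∫ x, Γ u v x ∂m
  integrable : ∀ {u v}, u ∈ P.dom → v ∈ P.dom → Integrable (Γ u v) m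
  add_left : ∀ {u v w}, u ∈ P.dom → v ∈ P.dom → w ∈ P.dom → ∀ x,
    Γ (u + v) w x = Γ u w x + Γ v w x
  smul_left : ∀ (c : ℝ) {u w}, u ∈ P.dom → w ∈ P.dom → ∀ x, Γ (c • u) w x = c * Γ u w x
  symm : ∀ {u v}, u ∈ P.dom → v ∈ P.dom → ∀ x, Γ u v x = Γ v u x
  nonneg : ∀ {u}, u ∈ P.dom → ∀ x, 0 ≤ Γ u u x
  chain : ∀ {φ : ℝ → ℝ} {u}, ContDiff ℝ 1 φ → u ∈ P.dom → ∃ z ∈ P.dom,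
    (∀ x, P.val z x = φ (P.val u x)) ∧ ∀ v ∈ P.dom, ∀ x, Γ z v x = deriv φ (P.val u x) * Γ u v x

namespace DiffusionCore

variable {m : Measure X} {P : PreForm α X} {Γ : α → α → X → ℝ}

/-- The class as a linear subspace. -/
def core (hP : DiffusionCore m P Γ) : Submodule ℝ α where
  carrier := P.dom
  zero_mem' := hP.zero_mem
  add_mem' := hP.add_mem
  smul_mem' c _ := hP.smul_mem c

theorem add_right (hP : DiffusionCore m P Γ) (u v w : hP.core) (x : X) :
    Γ w (↑(u + v) : α) x = Γ w u x + Γ w v x := by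
  rw [hP.symm w.2 (u + v).2, Submodule.coe_add, hP.add_left u.2 v.2 w.2, hP.symm u.2 w.2,
    hP.symm v.2 w.2]

theorem smul_right (hP : DiffusionCore m P Γ) (c : ℝ) (u w : hP.core) (x : X) :
    Γ w (↑(c • u) : α) x = c * Γ w u x := by
  rw [hP.symm w.2 (c • u).2, Submodule.coe_smul, hP.smul_left c u.2 w.2, hP.symm u.2 w.2]

theorem sub_left (hP : DiffusionCore m P Γ) (u v w : hP.core) (x : X) :
    Γ (↑(u - v) : α) w x = Γ u w x - Γ v w x := by
  rw [show u - v = u + (-1 : ℝ) • v by rw [neg_one_smul, sub_eq_add_neg], Submodule.coe_add,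
    hP.add_left u.2 ((-1 : ℝ) • v).2 w.2, Submodule.coe_smul, hP.smul_left _ v.2 w.2]
  ring

theorem sub_right (hP : DiffusionCore m P Γ) (u v w : hP.core) (x : X) :
    Γ w (↑(u - v) : α) x = Γ w u x - Γ w v x := by
  rw [hP.symm w.2 (u - v).2, hP.sub_left, hP.symm u.2 w.2, hP.symm v.2 w.2]

theorem val_sub (hP : DiffusionCore m P Γ) (u v : hP.core) (x : X) :
    P.val (↑(u - v) : α) x = P.val u x - P.val v x := by
  rw [show u - v = u + (-1 : ℝ) • v by rw [neg_one_smul, sub_eq_add_neg], Submodule.coe_add,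
    hP.val_add, Submodule.coe_smul, hP.val_smul]
  simp [sub_eq_add_neg]

/-- The right-hand side is Γ(tu + v, tu + v) expanded. -/
theorem quadratic_nonneg (hP : DiffusionCore m P Γ) (u v : hP.core) (t : ℝ) (x : X) :
    0 ≤ t * t * Γ u u x + 2 * t * Γ u v x + Γ v v x := by
  have h := hP.nonneg (t • u + v).2 x
  rw [hP.add_right, hP.smul_right, Submodule.coe_add, hP.add_left (t • u).2 v.2 u.2,
    hP.add_left (t • u).2 v.2 v.2, Submodule.coe_smul, hP.smul_left t u.2 u.2,
    hP.smul_left t u.2 v.2, hP.symm v.2 u.2] at h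
  linarith

/-- Cauchy–Schwarz for the total energy. -/
theorem integral_abs_sq_le (hP : DiffusionCore m P Γ) (u v : hP.core) :
    (∫ x, |Γ u v x| ∂m) ^ 2 ≤ (∫ x, Γ u u x ∂m) * ∫ x, Γ v v x ∂m := by
  have hquad : ∀ t : ℝ, 0 ≤ (∫ x, Γ u u x ∂m) * (t * t) + (-2 * ∫ x, |Γ u v x| ∂m) * t
      + ∫ x, Γ v v x ∂m := by
    -- Pointwise positivity at t and at -t covers both signs of Γ(u,v), which produces its absolute
    -- value for t ≥ 0. For negative t the linear term is nonnegative, and the discriminant applies.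
    have hpos : ∀ t : ℝ, 0 ≤ t → 0 ≤ (∫ x, Γ u u x ∂m) * (t * t)
        + (-2 * ∫ x, |Γ u v x| ∂m) * t + ∫ x, Γ v v x ∂m := by
      intro t ht
      have h : 0 ≤ ∫ x, (t * t * Γ u u x + (-2 * t) * |Γ u v x| + Γ v v x) ∂m := by
        refine integral_nonneg fun x => ?_
        have h1 := hP.quadratic_nonneg u v t x
        have h2 := hP.quadratic_nonneg u v (-t) x
        change 0 ≤ t * t * Γ u u x + (-2 * t) * |Γ u v x| + Γ v v x
        rcases abs_choice (Γ u v x) with h3 | h3 <;> rw [h3] <;> linarith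
      have i1 := (hP.integrable u.2 u.2).const_mul (t * t)
      have i2 := (hP.integrable u.2 v.2).abs.const_mul (-2 * t)
      have hsum := integral_add (i1.add i2) (hP.integrable v.2 v.2)
      simp only [Pi.add_apply] at hsum
      rw [hsum, integral_add i1 i2, integral_const_mul, integral_const_mul] at h
      linarith
    intro t
    rcases le_total 0 t with ht | ht
    · exact hpos t ht
    · have h1 := hpos (-t) (by linarith)
      have h2 : 0 ≤ ∫ x, |Γ u v x| ∂m := integral_nonneg fun x => abs_nonneg _
      nlinarith
  have h := discrim_le_zero hquad
  rw [discrim] at h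
  nlinarith

theorem form_nonneg (hP : DiffusionCore m P Γ) (u : hP.core) : 0 ≤ P.form u u := by
  rw [hP.form_eq u.2 u.2]
  exact integral_nonneg fun x => hP.nonneg u.2 x

/-- Two applications of the chain rule give Γ(z,z) = φ'(u)² Γ(u,u). -/
theorem form_comp_le (hP : DiffusionCore m P Γ) {φ : ℝ → ℝ}
    (h1 : ∀ s, |deriv φ s| ≤ 1) {u z : hP.core}
    (hΓ : ∀ v ∈ P.dom, ∀ x, Γ z v x = deriv φ (P.val u x) * Γ u v x) :
    P.form z z ≤ P.form u u := by
  rw [hP.form_eq z.2 z.2, hP.form_eq u.2 u.2]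
  refine integral_mono (hP.integrable z.2 z.2) (hP.integrable u.2 u.2) fun x => ?_
  change Γ z z x ≤ Γ u u x
  rw [hΓ z z.2, hP.symm u.2 z.2, hΓ u u.2, ← mul_assoc]
  have h2 := abs_le.1 (h1 (P.val u x))
  have h3 : deriv φ (P.val u x) * deriv φ (P.val u x) ≤ 1 := by nlinarith [h2.1, h2.2]
  have h4 := hP.nonneg u.2 x
  nlinarith

/-- The energy form on the class. -/
def bilin (hP : DiffusionCore m P Γ) : hP.core →ₗ[ℝ] hP.core →ₗ[ℝ] ℝ :=
  LinearMap.mk₂ ℝ (fun u v => P.form u v)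
    (fun u v w => by
      change P.form (↑(u + v) : α) w = P.form u w + P.form v w
      rw [hP.form_eq (u + v).2 w.2, hP.form_eq u.2 w.2, hP.form_eq v.2 w.2,
        ← integral_add (hP.integrable u.2 w.2) (hP.integrable v.2 w.2)]
      exact integral_congr_ae (Eventually.of_forall fun x => hP.add_left u.2 v.2 w.2 x))
    (fun c u w => by
      change P.form (↑(c • u) : α) w = c * P.form u w
      rw [hP.form_eq (c • u).2 w.2, hP.form_eq u.2 w.2, ← integral_const_mul]
      exact integral_congr_ae (Eventually.of_forall fun x => hP.smul_left c u.2 w.2 x))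
    (fun u v w => by
      change P.form u (↑(v + w) : α) = P.form u v + P.form u w
      rw [hP.form_eq u.2 (v + w).2, hP.form_eq u.2 v.2, hP.form_eq u.2 w.2,
        ← integral_add (hP.integrable u.2 v.2) (hP.integrable u.2 w.2)]
      exact integral_congr_ae (Eventually.of_forall fun x => hP.add_right v w u x))
    (fun c u w => by
      change P.form u (↑(c • w) : α) = c * P.form u w
      rw [hP.form_eq u.2 (c • w).2, hP.form_eq u.2 w.2, ← integral_const_mul]
      exact integral_congr_ae (Eventually.of_forall fun x => hP.smul_right c w u x))

variable [BorelSpace X] [IsFiniteMeasure m]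

theorem memLp_val (hP : DiffusionCore m P Γ) (u : hP.core) : MemLp (P.val u) 2 m := by
  obtain ⟨C, hC⟩ := hP.bounded_val u.2
  exact MemLp.of_bound (hP.continuous_val u.2).measurable.aestronglyMeasurable C
    (Eventually.of_forall hC)

/-- The classes in `L²(m)` of the elements of the class. -/
def toLp (hP : DiffusionCore m P Γ) : hP.core →ₗ[ℝ] Lp ℝ 2 m where
  toFun u := (hP.memLp_val u).toLp _
  map_add' u v := by
    rw [← MemLp.toLp_add]
    congr 1
    exact hP.val_add u v
  map_smul' c u := by
    rw [RingHom.id_apply, ← MemLp.toLp_const_smul]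
    congr 1
    exact hP.val_smul c u

theorem coeFn_toLp (hP : DiffusionCore m P Γ) (u : hP.core) : hP.toLp u =ᵐ[m] P.val u :=
  (hP.memLp_val u).coeFn_toLp

end DiffusionCore

/-- A Hilbert space model of the closure of a form, in which the original class is dense. -/
structure ClosureModel {m : Measure X} {P : PreForm α X} {Γ : α → α → X → ℝ}
    [BorelSpace X] [IsFiniteMeasure m] (hP : DiffusionCore m P Γ) {F : L2Form m} {W : Type*}
    [NormedAddCommGroup W] [InnerProductSpace ℝ W] (e : W ≃ₗ[ℝ] F.domain)
    (ι : hP.core →ₗ[ℝ] W) : Prop where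
  isClosure : P.IsClosure F
  isModel : L2Form.IsModel e
  denseRange : DenseRange ι
  coe_eq : ∀ u, (e (ι u) : Lp ℝ 2 m) = hP.toLp u

namespace ClosureModel

variable {m : Measure X} {P : PreForm α X} {Γ : α → α → X → ℝ} [BorelSpace X]
  [IsFiniteMeasure m] {hP : DiffusionCore m P Γ} {F : L2Form m} {W : Type*}
  [NormedAddCommGroup W] [InnerProductSpace ℝ W] {e : W ≃ₗ[ℝ] F.domain} {ι : hP.core →ₗ[ℝ] W}

theorem exists_of_isClosable {α : Type v} [AddCommGroup α] [Module ℝ α] {P : PreForm α X}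
    {Γ : α → α → X → ℝ} (hP : DiffusionCore m P Γ) (hcl : P.IsClosable m) :
    ∃ (W : Type v) (_ : NormedAddCommGroup W) (_ : InnerProductSpace ℝ W) (_ : CompleteSpace W)
      (F : L2Form m) (e : W ≃ₗ[ℝ] F.domain) (ι : hP.core →ₗ[ℝ] W), ClosureModel hP e ι := by
  obtain ⟨W, i1, i2, i3, F, e, ι, h1, h2, h3, h4⟩ := exists_closure_model P hP.core rfl hP.bilin
    (fun u v => rfl) (fun u v => by
      change P.form u v = P.form v u
      rw [hP.form_eq u.2 v.2, hP.form_eq v.2 u.2]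
      exact integral_congr_ae (Eventually.of_forall fun x => hP.symm u.2 v.2 x))
    (fun u => hP.form_nonneg u) hP.toLp (fun u => (hP.coeFn_toLp u).symm) hcl
  exact ⟨W, i1, i2, i3, F, e, ι, h1, h2, h3, h4⟩

/-- The embedding of the model into `L²(m)`. -/
def embed (hM : ClosureModel hP e ι) : W →L[ℝ] Lp ℝ 2 m :=
  (F.domain.subtype ∘ₗ e.toLinearMap).mkContinuous 1 fun a => by
    simpa using hM.isModel.norm_le a

theorem embed_apply (hM : ClosureModel hP e ι) (a : W) : hM.embed a = e a := rfl

theorem embed_injective (hM : ClosureModel hP e ι) : Function.Injective hM.embed := fun _ _ h =>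
  e.injective (Subtype.ext h)

theorem embed_core (hM : ClosureModel hP e ι) (u : hP.core) : hM.embed (ι u) = hP.toLp u :=
  hM.coe_eq u

theorem embed_core_ae (hM : ClosureModel hP e ι) (u : hP.core) : hM.embed (ι u) =ᵐ[m] P.val u := by
  rw [hM.embed_core]
  exact hP.coeFn_toLp u

theorem form_eq (hM : ClosureModel hP e ι) (a b : W) :
    F.form (e a) (e b) = inner ℝ a b - inner ℝ (hM.embed a) (hM.embed b) := by
  rw [← hM.isModel.form₁_eq, L2Form.form₁]
  simp [embed_apply]

/-- The constant sequence approximates the class of `u`, so the closure must return the original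
value. -/
theorem form_core (hM : ClosureModel hP e ι) (u v : hP.core) :
    F.form (e (ι u)) (e (ι v)) = P.form u v := by
  have happ : ∀ u : hP.core, P.Approximates m (fun _ => (u : α)) (e (ι u)) := by
    intro u
    refine ⟨⟨fun _ => u.2, ?_⟩, ?_⟩
    · have h0 : P.form ((u : α) - u) ((u : α) - u) = 0 := by
        have h1 : hP.bilin (u - u) (u - u) = 0 := by simp
        exact h1
      simp only [h0]
      exact tendsto_const_nhds
    · have h0 : eLpNorm (P.val u - ((e (ι u) : Lp ℝ 2 m) : X → ℝ)) 2 m = 0 := by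
        rw [eLpNorm_congr_ae (g := 0), eLpNorm_zero]
        filter_upwards [hM.embed_core_ae u] with x hx
        rw [Pi.sub_apply, ← hx, hM.embed_apply, sub_self, Pi.zero_apply]
      simp only [h0]
      exact tendsto_const_nhds
  exact (tendsto_nhds_unique (hM.isClosure.tendsto_form _ _ _ _ (happ u) (happ v))
    tendsto_const_nhds)

theorem inner_core (hM : ClosureModel hP e ι) (u v : hP.core) :
    inner ℝ (ι u) (ι v) = P.form u v + inner ℝ (hP.toLp u) (hP.toLp v) := by
  have := hM.form_eq (ι u) (ι v)
  rw [hM.form_core, hM.embed_core, hM.embed_core] at this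
  linarith

theorem norm_sq_core (hM : ClosureModel hP e ι) (u : hP.core) :
    ‖ι u‖ ^ 2 = P.form u u + ‖hP.toLp u‖ ^ 2 := by
  rw [← real_inner_self_eq_norm_sq, hM.inner_core, real_inner_self_eq_norm_sq]

theorem form_self (hM : ClosureModel hP e ι) (a : W) :
    F.form (e a) (e a) = ‖a‖ ^ 2 - ‖hM.embed a‖ ^ 2 := by
  rw [hM.form_eq, real_inner_self_eq_norm_sq, real_inner_self_eq_norm_sq]

theorem form₁_self (hM : ClosureModel hP e ι) (a : W) : F.form₁ (e a) (e a) = ‖a‖ ^ 2 := by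
  rw [hM.isModel.form₁_eq, real_inner_self_eq_norm_sq]

theorem integral_abs_le (hM : ClosureModel hP e ι) (u v : hP.core) :
    ∫ x, |Γ u v x| ∂m ≤ ‖ι u‖ * ‖ι v‖ := by
  have h := hP.integral_abs_sq_le u v
  rw [← hP.form_eq u.2 u.2, ← hP.form_eq v.2 v.2] at h
  refine le_of_sq_le_sq (h.trans ?_) (by positivity)
  rw [mul_pow, hM.norm_sq_core, hM.norm_sq_core]
  have := hP.form_nonneg u
  have := hP.form_nonneg v
  gcongr <;> linarith [sq_nonneg ‖hP.toLp u‖, sq_nonneg ‖hP.toLp v‖]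

/-- Elements of the model are limits of elements of the class, also almost everywhere. -/
theorem exists_seq (hM : ClosureModel hP e ι) (a : W) :
    ∃ s : ℕ → hP.core, Tendsto (fun n => ι (s n)) atTop (𝓝 a) ∧
    ∀ᵐ x ∂m, Tendsto (fun n => P.val (s n) x) atTop (𝓝 (hM.embed a x)) := by
  obtain ⟨t, ht, hta⟩ := mem_closure_iff_seq_limit.1 (hM.denseRange a)
  choose s hs using ht
  have h1 : Tendsto (fun n => ι (s n)) atTop (𝓝 a) := by simpa only [hs] using hta
  have h2 : Tendsto (fun n => hM.embed (ι (s n))) atTop (𝓝 (hM.embed a)) :=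
    (hM.embed.continuous.tendsto a).comp h1
  obtain ⟨ns, hns, hae⟩ := (tendstoInMeasure_of_tendsto_Lp h2).exists_seq_tendsto_ae
  refine ⟨fun n => s (ns n), h1.comp hns.tendsto_atTop, ?_⟩
  filter_upwards [hae, ae_all_iff.2 fun n => hM.embed_core_ae (s (ns n))] with x hx hx'
  simpa only [hx'] using hx

theorem tendsto_embed_flatten (hM : ClosureModel hP e ι) {a : W} {y : ℕ → W}
    (hy : ∀ n, ∀ᵐ x ∂m, hM.embed (y n) x = flatten (1 / ((n : ℝ) + 1)) (hM.embed a x)) :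
    Tendsto (fun n => hM.embed (y n)) atTop (𝓝 (hM.embed a)) := by
  refine tendsto_Lp_of_ae_abs_sub_le (δ := fun n : ℕ => 2 * (1 / ((n : ℝ) + 1))) ?_
    (tendsto_const_nhds (x := hM.embed a)) fun n => ?_
  · simpa using tendsto_one_div_add_atTop_nhds_zero_nat.const_mul (2 : ℝ)
  · filter_upwards [hy n] with x hx
    rw [hx, sub_self, abs_zero, add_zero]
    exact abs_flatten_sub_le (by positivity) _

variable [CompleteSpace W]

/-- Lower semicontinuity of the energy: on the class ‖ι u‖² is the energy plus the squared L² norm,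
and the latter converges, so a bound on the limit norm becomes a bound on the limit energy. -/
theorem exists_form_le (hM : ClosureModel hP e ι) {u : ℕ → hP.core} {c : ℕ → ℝ} {c₀ : ℝ}
    {v : Lp ℝ 2 m}
    (hu : ∀ n, P.form (u n) (u n) ≤ c n) (hc : Tendsto c atTop (𝓝 c₀))
    (hv : Tendsto (fun n => hP.toLp (u n)) atTop (𝓝 v)) :
    ∃ y, hM.embed y = v ∧ F.form (e y) (e y) ≤ c₀ := by
  obtain ⟨y, hy, hle⟩ := exists_preimage_norm_sq_le hM.embed (x := fun n => ι (u n))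
    (c := fun n => c n + ‖hP.toLp (u n)‖ ^ 2)
    (fun n => by rw [hM.norm_sq_core]; linarith [hu n]) (hc.add (hv.norm.pow 2))
    (by simpa only [hM.embed_core] using hv)
  refine ⟨y, hy, ?_⟩
  rw [hM.form_self, hy]
  linarith

/-- The smooth clamps do not vanish at 0, so `exists_comp` is not available. Their uniform distance
to the true clamp still tends to zero, which is enough in L² of a finite measure, and the energy
passes to the limit by lower semicontinuity. -/
theorem exists_clamp (hM : ClosureModel hP e ι) (a : W) :
    ∃ y, (∀ᵐ x ∂m, hM.embed y x = min (max (hM.embed a x) 0) 1) ∧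
    F.form (e y) (e y) ≤ F.form (e a) (e a) := by
  obtain ⟨s, hs, -⟩ := hM.exists_seq a
  have hδ : ∀ n : ℕ, 0 < 1 / ((n : ℝ) + 1) := fun n => by positivity
  choose z hz hval hΓ using fun n => hP.chain (contDiff_smoothClamp (hδ n)) (s n).2
  have hmem : MemLp (fun x => min (max (hM.embed a x) 0) 1) 2 m := by
    have hmeas : AEStronglyMeasurable (hM.embed a) m := Lp.aestronglyMeasurable _
    refine MemLp.of_bound (C := 1) ?_ (Eventually.of_forall fun x => ?_)
    · exact (hmeas.sup aestronglyMeasurable_const).inf aestronglyMeasurable_const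
    · rw [Real.norm_eq_abs, abs_of_nonneg (le_min (le_max_right _ _) zero_le_one)]
      exact min_le_right _ _
  have hembed : Tendsto (fun n => hP.toLp (s n)) atTop (𝓝 (hM.embed a)) := by
    have h := (hM.embed.continuous.tendsto a).comp hs
    simpa only [Function.comp_def, hM.embed_core] using h
  obtain ⟨y, hy, hle⟩ := hM.exists_form_le (u := fun n => ⟨z n, hz n⟩)
    (c := fun n => P.form (s n) (s n)) (c₀ := F.form (e a) (e a)) (v := hmem.toLp _)
    (fun n => hP.form_comp_le (u := s n) (z := ⟨z n, hz n⟩)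
      (abs_deriv_smoothClamp_le (hδ n)) (hΓ n))
    (by
      have h := (hs.norm.pow 2).sub (hembed.norm.pow 2)
      rw [hM.form_self]
      refine h.congr fun n => ?_
      rw [hM.norm_sq_core]; ring)
    (by
      refine tendsto_Lp_of_ae_abs_sub_le (δ := fun n : ℕ => 1 / ((n : ℝ) + 1))
        tendsto_one_div_add_atTop_nhds_zero_nat hembed fun n => ?_
      filter_upwards [hP.coeFn_toLp ⟨z n, hz n⟩, hP.coeFn_toLp (s n), hmem.coeFn_toLp]
        with x h1 h2 h3
      rw [h1, h2, h3, hval]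
      exact (abs_sub_le _ (min (max (P.val (s n) x) 0) 1) _).trans
        (add_le_add (abs_smoothClamp_sub_le (hδ n) _) (abs_clamp_sub_clamp_le _ _)))
  refine ⟨y, ?_, hle⟩
  rw [hy]
  exact hmem.coeFn_toLp

/-- The closure is a Dirichlet form if the class is dense in `L²(m)`. -/
theorem isDirichlet (hM : ClosureModel hP e ι) (hdense : DenseRange hP.toLp) : F.IsDirichlet where
  dense := by
    refine hdense.mono ?_
    rintro _ ⟨u, rfl⟩
    rw [← hM.embed_core]
    exact (e (ι u)).2
  symm u v := by
    obtain ⟨a, rfl⟩ := e.surjective u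
    obtain ⟨b, rfl⟩ := e.surjective v
    rw [hM.form_eq, hM.form_eq, real_inner_comm, real_inner_comm (hM.embed a)]
  nonneg u := by
    obtain ⟨a, rfl⟩ := e.surjective u
    rw [hM.form_self, sub_nonneg]
    have := hM.isModel.norm_le a
    rw [hM.embed_apply]
    gcongr
  coercive := by
    refine ⟨1, one_pos, fun u v => ?_⟩
    obtain ⟨a, rfl⟩ := e.surjective u
    obtain ⟨b, rfl⟩ := e.surjective v
    rw [hM.form₁_self, hM.form₁_self, hM.isModel.form₁_eq, one_mul, ← mul_pow,
      Real.sqrt_sq (by positivity)]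
    exact abs_real_inner_le_norm a b
  closed s hs := by
    have h1 : CauchySeq fun n => e.symm (s n) := by
      rw [cauchySeq_iff_tendsto_dist_atTop_0]
      have h2 := hs.sqrt
      simp only [Real.sqrt_zero] at h2
      refine h2.congr fun p => ?_
      rw [← e.apply_symm_apply (s p.1 - s p.2), hM.form₁_self, Real.sqrt_sq (norm_nonneg _),
        dist_eq_norm, map_sub]
    obtain ⟨a, ha⟩ := cauchySeq_tendsto_of_complete h1
    refine ⟨e a, ?_⟩
    have h3 := (tendsto_iff_norm_sub_tendsto_zero.1 ha).pow 2
    simp only [zero_pow two_ne_zero] at h3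
    refine h3.congr fun n => ?_
    rw [← hM.form₁_self, map_sub, e.apply_symm_apply]
  markov u := by
    obtain ⟨a, rfl⟩ := e.surjective u
    obtain ⟨y, hy, hle⟩ := hM.exists_clamp a
    have hcomm : F.form (e a) (e y) = F.form (e y) (e a) := by
      rw [hM.form_eq, hM.form_eq, real_inner_comm, real_inner_comm (hM.embed a)]
    refine ⟨e y, hy, ?_, ?_⟩ <;>
    · simp only [map_add, map_sub, LinearMap.add_apply, LinearMap.sub_apply]
      linarith

/-- Contractions operate on the model. -/
theorem exists_comp (hM : ClosureModel hP e ι) {φ : ℝ → ℝ} (hφ : ContDiff ℝ 1 φ) (h0 : φ 0 = 0)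
    (h1 : ∀ s, |deriv φ s| ≤ 1) (a : W) :
    ∃ y, (∀ᵐ x ∂m, hM.embed y x = φ (hM.embed a x)) ∧ ‖y‖ ≤ ‖a‖ ∧
      ∀ s : ℕ → hP.core, Tendsto (fun n => ι (s n)) atTop (𝓝 a) → ∀ z : ℕ → hP.core,
        (∀ n x, P.val (z n) x = φ (P.val (s n) x)) → (∀ n, ∀ v ∈ P.dom, ∀ x,
          Γ (z n) v x = deriv φ (P.val (s n) x) * Γ (s n) v x) → ∀ b : W,
          Tendsto (fun n => F.form (e (ι (z n))) (e b)) atTop (𝓝 (F.form (e y) (e b))) := by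
  have hlip := abs_sub_le_of_abs_deriv_le_one hφ h1
  have hmeas : AEStronglyMeasurable (hM.embed a) m := Lp.aestronglyMeasurable _
  have hmem : MemLp (fun x => φ (hM.embed a x)) 2 m := by
    refine MemLp.mono (Lp.memLp (hM.embed a))
      (hφ.continuous.comp_aestronglyMeasurable hmeas) (Eventually.of_forall fun x => ?_)
    have := hlip (hM.embed a x) 0
    simpa [h0] using this
  have hnorm : ∀ s z : hP.core, (∀ x, P.val z x = φ (P.val s x)) → (∀ v ∈ P.dom, ∀ x,
      Γ z v x = deriv φ (P.val s x) * Γ s v x) → ‖ι z‖ ^ 2 ≤ ‖ι s‖ ^ 2 := by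
    intro s z hval hΓ
    rw [hM.norm_sq_core, hM.norm_sq_core]
    have hle : ‖hP.toLp z‖ ≤ ‖hP.toLp s‖ := by
      refine Lp.norm_le_norm_of_ae_le ?_
      filter_upwards [hP.coeFn_toLp z, hP.coeFn_toLp s] with x hx hx'
      rw [hx, hx', hval]
      have := hlip (P.val s x) 0
      simpa [h0] using this
    have := hP.form_comp_le h1 hΓ
    gcongr
  have hconv : ∀ s : ℕ → hP.core, Tendsto (fun n => ι (s n)) atTop (𝓝 a) → ∀ z : ℕ → hP.core,
      (∀ n x, P.val (z n) x = φ (P.val (s n) x)) →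
      Tendsto (fun n => hM.embed (ι (z n))) atTop (𝓝 (hmem.toLp _)) := by
    intro s hs z hval
    refine tendsto_Lp_of_ae_abs_sub_le (δ := fun _ : ℕ => 0) tendsto_const_nhds
      ((hM.embed.continuous.tendsto a).comp hs) fun n => ?_
    filter_upwards [hM.embed_core_ae (z n), hM.embed_core_ae (s n), hmem.coeFn_toLp]
      with x h2 h3 h4
    rw [h2, Function.comp_apply, h3, h4, hval, zero_add]
    exact hlip _ _
  obtain ⟨s, hs, -⟩ := hM.exists_seq a
  choose z hz hval hΓ using fun n => hP.chain hφ (s n).2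
  obtain ⟨y, hy, hle⟩ := exists_preimage_norm_sq_le hM.embed
    (fun n => hnorm (s n) ⟨z n, hz n⟩ (hval n) (hΓ n)) (hs.norm.pow 2)
    (hconv s hs (fun n => ⟨z n, hz n⟩) hval)
  refine ⟨y, by rw [hy]; exact hmem.coeFn_toLp, le_of_sq_le_sq hle (norm_nonneg _), ?_⟩
  intro s hs z hval hΓ b
  have hc := hconv s hs z hval
  rw [← hy] at hc
  obtain ⟨R, hR⟩ := (hs.norm.pow 2).bddAbove_range
  have hbd : ∀ n, ‖ι (z n)‖ ≤ Real.sqrt R := fun n =>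
    Real.le_sqrt_of_sq_le ((hnorm (s n) (z n) (hval n) (hΓ n)).trans (hR ⟨n, rfl⟩))
  -- The limit `y` came from one particular approximating sequence. Any other one stays bounded in
  -- the model and has the same L² limit, hence converges weakly to the same `y`.
  have hw := tendsto_inner_of_tendsto_image hM.embed hM.embed_injective hbd hc b
  have := hw.sub (hc.inner (tendsto_const_nhds (x := hM.embed b)))
  simpa only [hM.form_eq] using this

/-- On the class, Γ(φ(s), ψ(t)) = φ'(s) ψ'(t) Γ(s,t), and in the limit φ'(a) ψ'(b) vanishes almost
everywhere because one of a, b is 0 there. Since Γ(s_n, t_l) need not converge pointwise, it is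
compared with Γ(s_k, t_k) for a frozen k, at a cost controlled by the form norm. Convergence of the
compositions is only weak, so n, l and k tend to infinity one after the other. -/
theorem form_comp_eq_zero (hM : ClosureModel hP e ι) {φ ψ : ℝ → ℝ} (hφ : ContDiff ℝ 1 φ)
    (hφ0 : φ 0 = 0)
    (hφ1 : ∀ s, |deriv φ s| ≤ 1) (hψ : ContDiff ℝ 1 ψ) (hψ0 : ψ 0 = 0)
    (hψ1 : ∀ s, |deriv ψ s| ≤ 1) (hφ' : deriv φ 0 = 0) (hψ' : deriv ψ 0 = 0) {a b : W}
    (hab : ∀ᵐ x ∂m, hM.embed a x = 0 ∨ hM.embed b x = 0) {y y' : W}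
    (hy : ∀ᵐ x ∂m, hM.embed y x = φ (hM.embed a x))
    (hy' : ∀ᵐ x ∂m, hM.embed y' x = ψ (hM.embed b x)) : F.form (e y) (e y') = 0 := by
  obtain ⟨y₁, hy₁, -, hlim⟩ := hM.exists_comp hφ hφ0 hφ1 a
  obtain ⟨y₂, hy₂, -, hlim'⟩ := hM.exists_comp hψ hψ0 hψ1 b
  obtain rfl : y = y₁ := hM.embed_injective (Lp.ext (by
    filter_upwards [hy, hy₁] with x h h'; rw [h, h']))
  obtain rfl : y' = y₂ := hM.embed_injective (Lp.ext (by
    filter_upwards [hy', hy₂] with x h h'; rw [h, h']))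
  have hcomm : ∀ c d : W, F.form (e c) (e d) = F.form (e d) (e c) := fun c d => by
    rw [hM.form_eq, hM.form_eq, real_inner_comm, real_inner_comm (hM.embed d)]
  obtain ⟨s, hs, hsae⟩ := hM.exists_seq a
  obtain ⟨t, ht, htae⟩ := hM.exists_seq b
  choose z hz hval hΓ using fun n => hP.chain hφ (s n).2
  choose w hw hval' hΓ' using fun n => hP.chain hψ (t n).2
  have hlim := hlim s hs (fun n => ⟨z n, hz n⟩) hval hΓ
  have hlim' := hlim' t ht (fun n => ⟨w n, hw n⟩) hval' hΓ'
  have hφc : Continuous (deriv φ) := hφ.continuous_deriv le_rfl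
  have hψc : Continuous (deriv ψ) := hψ.continuous_deriv le_rfl
  -- The first two terms bound the energy of replacing `s n` by `s k` and `t l` by `t k`; the
  -- factors φ' and ψ' are at most 1. Only the last term keeps these factors.
  have hbound : ∀ k n l, |P.form (z n) (w l)| ≤
      ‖ι (s n) - ι (s k)‖ * ‖ι (t l)‖ + ‖ι (s k)‖ * ‖ι (t l) - ι (t k)‖ +
        ∫ x, |deriv φ (P.val (s n) x)| * |deriv ψ (P.val (t l) x)| * |Γ (s k) (t k) x| ∂m := by
    intro k n l
    have i1 := (hP.integrable (s n - s k).2 (t l).2).abs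
    have i2 := (hP.integrable (s k).2 (t l - t k).2).abs
    have i3 : Integrable (fun x => |deriv φ (P.val (s n) x)| * |deriv ψ (P.val (t l) x)| *
        |Γ (s k) (t k) x|) m := by
      refine Integrable.bdd_mul (c := 1) (hP.integrable (s k).2 (t k).2).abs ?_
        (Eventually.of_forall fun x => ?_)
      · exact (((hφc.comp (hP.continuous_val (s n).2)).abs.mul
          (hψc.comp (hP.continuous_val (t l).2)).abs)).measurable.aestronglyMeasurable
      · rw [Real.norm_eq_abs, abs_mul, abs_abs, abs_abs]
        exact mul_le_one₀ (hφ1 _) (abs_nonneg _) (hψ1 _)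
    calc |P.form (z n) (w l)| = |∫ x, Γ (z n) (w l) x ∂m| := by rw [hP.form_eq (hz n) (hw l)]
      _ ≤ ∫ x, |Γ (z n) (w l) x| ∂m := abs_integral_le_integral_abs
      _ ≤ ∫ x, (|Γ (↑(s n - s k) : α) (t l) x| + |Γ (s k) (↑(t l - t k) : α) x| +
          |deriv φ (P.val (s n) x)| * |deriv ψ (P.val (t l) x)| * |Γ (s k) (t k) x|) ∂m := by
        refine integral_mono (hP.integrable (hz n) (hw l)).abs ((i1.add i2).add i3) fun x => ?_
        change |Γ (z n) (w l) x| ≤ |Γ (↑(s n - s k) : α) (t l) x| +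
          |Γ (s k) (↑(t l - t k) : α) x| +
          |deriv φ (P.val (s n) x)| * |deriv ψ (P.val (t l) x)| * |Γ (s k) (t k) x|
        rw [hΓ n _ (hw l), hP.symm (s n).2 (hw l), hΓ' l _ (s n).2, hP.symm (t l).2 (s n).2,
          abs_mul, abs_mul, ← mul_assoc, hP.sub_left, hP.sub_right]
        set A := |deriv φ (P.val (s n) x)| * |deriv ψ (P.val (t l) x)|
        have hA0 : 0 ≤ A := by positivity
        have hA1 : A ≤ 1 := mul_le_one₀ (hφ1 _) (abs_nonneg _) (hψ1 _)
        have h1 : |Γ (s n) (t l) x| ≤ |Γ (s n) (t l) x - Γ (s k) (t l) x| +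
            |Γ (s k) (t l) x - Γ (s k) (t k) x| + |Γ (s k) (t k) x| := by
          calc |Γ (s n) (t l) x| = |(Γ (s n) (t l) x - Γ (s k) (t l) x) +
              (Γ (s k) (t l) x - Γ (s k) (t k) x) + Γ (s k) (t k) x| := by ring_nf
            _ ≤ _ := abs_add_three _ _ _
        have h2 := mul_le_mul_of_nonneg_left h1 hA0
        have h3 : A * (|Γ (s n) (t l) x - Γ (s k) (t l) x| +
            |Γ (s k) (t l) x - Γ (s k) (t k) x|) ≤ |Γ (s n) (t l) x - Γ (s k) (t l) x| +
            |Γ (s k) (t l) x - Γ (s k) (t k) x| := mul_le_of_le_one_left (by positivity) hA1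
        linarith
      _ ≤ _ := by
        have hsum := integral_add (i1.add i2) i3
        simp only [Pi.add_apply] at hsum
        rw [hsum, integral_add i1 i2]
        have h1 := hM.integral_abs_le (s n - s k) (t l)
        have h2 := hM.integral_abs_le (s k) (t l - t k)
        rw [map_sub] at h1 h2
        gcongr
  -- With k frozen, |Γ(s_k, t_k)| is an integrable majorant. Both limits use this statement, each
  -- time with one of the two sequences held constant.
  have hdom : ∀ k (f g : ℕ → X → ℝ) (f' g' : X → ℝ), (∀ n, AEStronglyMeasurable (f n) m) →
      (∀ n, AEStronglyMeasurable (g n) m) →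
      (∀ᵐ x ∂m, Tendsto (fun n => f n x) atTop (𝓝 (f' x))) →
      (∀ᵐ x ∂m, Tendsto (fun n => g n x) atTop (𝓝 (g' x))) →
      Tendsto (fun n => ∫ x, |deriv φ (f n x)| * |deriv ψ (g n x)| * |Γ (s k) (t k) x| ∂m) atTop
        (𝓝 (∫ x, |deriv φ (f' x)| * |deriv ψ (g' x)| * |Γ (s k) (t k) x| ∂m)) := by
    intro k f g f' g' hf hg hff' hgg'
    refine tendsto_integral_of_dominated_convergence (fun x => |Γ (s k) (t k) x|)
      (fun n => ?_) (hP.integrable (s k).2 (t k).2).abs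
      (fun n => Eventually.of_forall fun x => ?_) ?_
    · exact (((hφc.abs.comp_aestronglyMeasurable (hf n)).mul
        (hψc.abs.comp_aestronglyMeasurable (hg n))).mul
        (hP.integrable (s k).2 (t k).2).abs.aestronglyMeasurable)
    · rw [Real.norm_eq_abs, abs_mul, abs_mul, abs_abs, abs_abs, abs_abs]
      exact mul_le_of_le_one_left (abs_nonneg _) (mul_le_one₀ (hφ1 _) (abs_nonneg _) (hψ1 _))
    · filter_upwards [hff', hgg'] with x h1 h2
      exact ((((hφc.tendsto _).comp h1).abs.mul ((hψc.tendsto _).comp h2).abs).mul_const _)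
  have hvalm : ∀ u : hP.core, AEStronglyMeasurable (P.val u) m := fun u =>
    (hP.continuous_val u.2).measurable.aestronglyMeasurable
  have hstep : ∀ k l, |F.form (e y) (e (ι ⟨w l, hw l⟩))| ≤
      ‖a - ι (s k)‖ * ‖ι (t l)‖ + ‖ι (s k)‖ * ‖ι (t l) - ι (t k)‖ +
        ∫ x, |deriv φ (hM.embed a x)| * |deriv ψ (P.val (t l) x)| * |Γ (s k) (t k) x| ∂m := by
    intro k l
    refine le_of_tendsto_of_tendsto' (hlim _).abs
      ((((hs.sub_const _).norm.mul_const _).add_const _).add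
        (hdom k (fun n => P.val (s n)) (fun _ => P.val (t l)) _ _ (fun n => hvalm _)
          (fun _ => hvalm _) hsae (Eventually.of_forall fun x => tendsto_const_nhds))) fun n => ?_
    have := hM.form_core ⟨z n, hz n⟩ ⟨w l, hw l⟩
    rw [this]
    exact hbound k n l
  have hstep2 : ∀ k, |F.form (e y) (e y')| ≤
      ‖a - ι (s k)‖ * ‖b‖ + ‖ι (s k)‖ * ‖b - ι (t k)‖ := by
    intro k
    have h0 : ∫ x, |deriv φ (hM.embed a x)| * |deriv ψ (hM.embed b x)| * |Γ (s k) (t k) x| ∂m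
        = 0 := by
      rw [integral_congr_ae (g := fun _ => (0 : ℝ)), integral_zero]
      filter_upwards [hab] with x hx
      rcases hx with hx | hx <;> simp [hx, hφ', hψ']
    have h1 := (((ht.norm.const_mul ‖a - ι (s k)‖).add
      ((ht.sub_const (ι (t k))).norm.const_mul ‖ι (s k)‖)).add
      (hdom k (fun _ => hM.embed a) (fun l => P.val (t l)) _ _
        (fun n => Lp.aestronglyMeasurable _) (fun _ => hvalm _)
        (Eventually.of_forall fun x => tendsto_const_nhds) htae))
    rw [h0, add_zero] at h1
    rw [hcomm]
    refine le_of_tendsto_of_tendsto' (hlim' y).abs h1 fun l => ?_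
    rw [hcomm]
    exact hstep k l
  have hfin : Tendsto (fun k => ‖a - ι (s k)‖ * ‖b‖ + ‖ι (s k)‖ * ‖b - ι (t k)‖) atTop (𝓝 0) := by
    have h1 := ((hs.const_sub a).norm.mul_const ‖b‖).add (hs.norm.mul (ht.const_sub b).norm)
    simpa using h1
  exact abs_nonpos_iff.1 (ge_of_tendsto' hfin hstep2)

/-- `flatten` is the identity up to 2ε and has vanishing derivative at 0, so the previous lemma
applies to flattened functions. Their norms stay bounded, and weak convergence removes the
flattening in one argument at a time. -/
theorem form_eq_zero_of_mul_eq_zero (hM : ClosureModel hP e ι) {a b : W}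
    (hab : ∀ᵐ x ∂m, hM.embed a x = 0 ∨ hM.embed b x = 0) : F.form (e a) (e b) = 0 := by
  have hδ : ∀ n : ℕ, 0 < 1 / ((n : ℝ) + 1) := fun n => by positivity
  have hd0 : ∀ n : ℕ, deriv (flatten (1 / ((n : ℝ) + 1))) 0 = 0 := fun n => by
    rw [(hasDerivAt_flatten (hδ n) 0).deriv]; simp
  have h00 : ∀ n : ℕ, flatten (1 / ((n : ℝ) + 1)) 0 = 0 := fun n => by simp [flatten]
  choose y hy hyn _ using fun n : ℕ => hM.exists_comp
    (contDiff_flatten (1 / ((n : ℝ) + 1))) (h00 n) (abs_deriv_flatten_le (hδ n)) a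
  choose z hz hzn _ using fun n : ℕ => hM.exists_comp
    (contDiff_flatten (1 / ((n : ℝ) + 1))) (h00 n) (abs_deriv_flatten_le (hδ n)) b
  have h0 : ∀ n k, F.form (e (y n)) (e (z k)) = 0 := fun n k =>
    hM.form_comp_eq_zero (contDiff_flatten _) (h00 n) (abs_deriv_flatten_le (hδ n))
      (contDiff_flatten _) (h00 k) (abs_deriv_flatten_le (hδ k)) (hd0 n) (hd0 k) hab (hy n) (hz k)
  have hweak : ∀ (c : W) (x : ℕ → W) (d : W), (∀ n, ‖x n‖ ≤ ‖c‖) →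
      Tendsto (fun n => hM.embed (x n)) atTop (𝓝 (hM.embed c)) →
      Tendsto (fun n => F.form (e (x n)) (e d)) atTop (𝓝 (F.form (e c) (e d))) := by
    intro c x d hx hc
    have := (tendsto_inner_of_tendsto_image hM.embed hM.embed_injective hx hc d).sub
      (hc.inner (tendsto_const_nhds (x := hM.embed d)))
    simpa only [hM.form_eq] using this
  have hcomm : ∀ c d : W, F.form (e c) (e d) = F.form (e d) (e c) := fun c d => by
    rw [hM.form_eq, hM.form_eq, real_inner_comm, real_inner_comm (hM.embed d)]
  have h1 : ∀ k, F.form (e a) (e (z k)) = 0 := fun k =>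
    tendsto_nhds_unique (hweak a y (z k) hyn (hM.tendsto_embed_flatten hy))
      (by simp only [h0]; exact tendsto_const_nhds)
  rw [hcomm]
  refine tendsto_nhds_unique (hweak b z a hzn (hM.tendsto_embed_flatten hz)) ?_
  simp only [hcomm _ a, h1]
  exact tendsto_const_nhds

theorem isLocal (hM : ClosureModel hP e ι) [SecondCountableTopology X] : F.IsLocal := by
  intro u v huv
  obtain ⟨a, rfl⟩ := e.surjective u
  obtain ⟨b, rfl⟩ := e.surjective v
  refine hM.form_eq_zero_of_mul_eq_zero ?_
  filter_upwards [ae_eq_zero_of_notMem_supp (hM.embed a), ae_eq_zero_of_notMem_supp (hM.embed b)]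
    with x ha hb
  by_cases hx : x ∈ L2Form.supp (hM.embed a)
  · exact Or.inr (hb (Set.disjoint_left.1 huv hx))
  · exact Or.inl (ha hx)

end ClosureModel

end Core

/-! ### Density and quasi-regularity -/

section Convergence

variable {X : Type*} [MeasurableSpace X] {m : Measure X}

theorem L2_norm_sq_eq_integral (f : Lp ℝ 2 m) : ‖f‖ ^ 2 = ∫ x, f x ^ 2 ∂m := by
  rw [← real_inner_self_eq_norm_sq, L2.inner_def]
  refine integral_congr_ae (Eventually.of_forall fun x => ?_)
  simp [pow_two]

theorem tendsto_L2_of_tendsto_ae [IsFiniteMeasure m] {f : ℕ → Lp ℝ 2 m} {g : X → ℝ} {C : ℝ}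
    (hC : ∀ n, ∀ᵐ x ∂m, |f n x| ≤ C)
    (hg : ∀ᵐ x ∂m, Tendsto (fun n => f n x) atTop (𝓝 (g x))) :
    ∃ G : Lp ℝ 2 m, G =ᵐ[m] g ∧ Tendsto f atTop (𝓝 G) := by
  have hmeas : AEStronglyMeasurable g m :=
    aestronglyMeasurable_of_tendsto_ae atTop (fun n => Lp.aestronglyMeasurable (f n)) hg
  have hgC : ∀ᵐ x ∂m, |g x| ≤ C := by
    filter_upwards [hg, ae_all_iff.2 hC] with x h1 h2
    exact le_of_tendsto' h1.abs h2
  have hmem : MemLp g 2 m := MemLp.of_bound hmeas C hgC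
  refine ⟨hmem.toLp g, hmem.coeFn_toLp, ?_⟩
  rw [tendsto_iff_norm_sub_tendsto_zero]
  have hsq : Tendsto (fun n => ‖f n - hmem.toLp g‖ ^ 2) atTop (𝓝 0) := by
    simp only [L2_norm_sq_eq_integral]
    have h0 : (0 : ℝ) = ∫ _, (0 : ℝ) ∂m := by simp
    rw [h0]
    refine tendsto_integral_of_dominated_convergence (fun _ => (2 * C) ^ 2)
      (fun n => (Lp.aestronglyMeasurable _).pow 2) (integrable_const _) (fun n => ?_) ?_
    · filter_upwards [hC n, hgC, Lp.coeFn_sub (f n) (hmem.toLp g), hmem.coeFn_toLp]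
        with x h1 h2 h3 h4
      rw [h3, Pi.sub_apply, h4, Real.norm_eq_abs, abs_pow]
      have h5 : |f n x - g x| ≤ 2 * C := (abs_sub _ _).trans (by linarith)
      gcongr
    · filter_upwards [hg, ae_all_iff.2 fun n => Lp.coeFn_sub (f n) (hmem.toLp g),
        hmem.coeFn_toLp] with x h1 h2 h3
      have h4 := (h1.sub_const (g x)).pow 2
      simp only [sub_self, zero_pow two_ne_zero] at h4
      refine h4.congr fun n => ?_
      rw [h2, Pi.sub_apply, h3]
  have := hsq.sqrt
  simpa [Real.sqrt_sq] using this

end Convergence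

theorem L2Form.cap_empty {X : Type*} [TopologicalSpace X] [MeasurableSpace X] {m : Measure X}
    (F : L2Form m) : F.cap ∅ = 0 := by
  refine le_antisymm ?_ bot_le
  calc F.cap ∅ ≤ F.capOpen ∅ :=
        iInf_le_of_le ∅ (iInf_le_of_le isOpen_empty (iInf_le _ subset_rfl))
    _ ≤ ENNReal.ofReal (F.form₁ 0 0) := iInf_le_of_le 0 (iInf_le _ (by simp))
    _ = 0 := by simp [L2Form.form₁]

theorem L2Form.quasiContinuous_of_continuous {X : Type*} [TopologicalSpace X] [MeasurableSpace X]
    [BorelSpace X] {m : Measure X} (F : L2Form m) {u : X → ℝ} (hu : Continuous u) :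
    F.QuasiContinuous u :=
  ⟨hu.measurable, fun _ => Set.univ, ⟨fun _ => isClosed_univ, by
    simp only [Set.compl_univ, L2Form.cap_empty]; exact tendsto_const_nhds⟩,
    fun _ => hu.continuousOn⟩

/-! ### Generation of the Borel σ-algebra and density in L². -/

section Barrier

variable {α X : Type*} [TopologicalSpace X] [MeasurableSpace X]

/-- A double sequence of functions in the class, of uniformly bounded energy, whose joint sublevel
sets form arbitrarily small neighbourhoods and yield compact sets. -/
structure Barrier (m : Measure X) (P : PreForm α X) (Γ : α → α → X → ℝ) (g : X → ℝ)
    (w : ℕ → ℕ → α) : Prop where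
  integrable : Integrable g m
  mem : ∀ k j, w k j ∈ P.dom
  nonneg : ∀ k j x, 0 ≤ P.val (w k j) x
  le_one : ∀ k j x, P.val (w k j) x ≤ 1
  energy : ∀ k j x, Γ (w k j) (w k j) x ≤ g x
  nhds : ∀ (x : X) (O : Set X), IsOpen O → x ∈ O → ∀ i₀ : ℕ, ∃ k i : ℕ, i₀ ≤ i ∧
    (∀ j, P.val (w k j) x ≤ 1 / ((i : ℝ) + 1)) ∧
      ∀ y, (∀ j, P.val (w k j) y ≤ 1 / ((i : ℝ) + 1)) → y ∈ O
  compact : ∀ n : ℕ → ℕ,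
    IsCompact {x | ∀ i : ℕ, ∃ k ≤ n i, ∀ j, P.val (w k j) x ≤ 1 / ((i : ℝ) + 1)}

namespace Barrier

variable {m : Measure X} {P : PreForm α X} {Γ : α → α → X → ℝ} {g : X → ℝ} {w : ℕ → ℕ → α}
  [AddCommGroup α] [Module ℝ α]

/-- Polarisation: uv = ((u+v)² - (u-v)²)/4, and squares are available through the chain rule. This
makes the class an algebra of functions. -/
theorem exists_mul (hP : DiffusionCore m P Γ) {u v : α} (hu : u ∈ P.dom) (hv : v ∈ P.dom) :
    ∃ z ∈ P.dom, ∀ x, P.val z x = P.val u x * P.val v x := by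
  have hsq : ContDiff ℝ 1 fun s : ℝ => s ^ 2 := by fun_prop
  obtain ⟨z₁, hz₁, h₁, -⟩ := hP.chain hsq (hP.add_mem hu hv)
  obtain ⟨z₂, hz₂, h₂, -⟩ := hP.chain hsq (hP.add_mem hu (hP.smul_mem (-1) hv))
  refine ⟨(1 / 4 : ℝ) • (z₁ + (-1 : ℝ) • z₂),
    hP.smul_mem _ (hP.add_mem hz₁ (hP.smul_mem _ hz₂)), fun x => ?_⟩
  rw [hP.val_smul, hP.val_add, hP.val_smul, Pi.smul_apply, Pi.add_apply, Pi.smul_apply, h₁, h₂,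
    hP.val_add, hP.val_add, hP.val_smul, Pi.add_apply, Pi.add_apply, Pi.smul_apply]
  simp only [smul_eq_mul]
  ring

theorem isPiSystem (hP : DiffusionCore m P Γ) :
    IsPiSystem {s | ∃ u ∈ P.dom, s = {x | P.val u x ≠ 0}} := by
  rintro _ ⟨u, hu, rfl⟩ _ ⟨v, hv, rfl⟩ -
  obtain ⟨z, hz, hval⟩ := exists_mul hP hu hv
  refine ⟨z, hz, ?_⟩
  ext x
  change P.val u x ≠ 0 ∧ P.val v x ≠ 0 ↔ P.val z x ≠ 0
  rw [hval, mul_ne_zero_iff]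

variable [BorelSpace X]

/-- Every open set is a countable union of joint sublevel sets of barrier functions, because there
are only countably many pairs (k, i). -/
theorem measurableSpace_eq (hP : DiffusionCore m P Γ) (hw : Barrier m P Γ g w) :
    ‹MeasurableSpace X› = MeasurableSpace.generateFrom
      {s | ∃ u ∈ P.dom, s = {x | P.val u x ≠ 0}} := by
  refine le_antisymm ?_ (MeasurableSpace.generateFrom_le ?_)
  · rw [BorelSpace.measurable_eq (α := X)]
    refine MeasurableSpace.generateFrom_le fun O hO => ?_
    have hB : ∀ (k : ℕ) (i : ℕ), MeasurableSet[MeasurableSpace.generateFrom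
        {s | ∃ u ∈ P.dom, s = {x | P.val u x ≠ 0}}]
        {x | ∀ j, P.val (w k j) x ≤ 1 / ((i : ℝ) + 1)} := by
      intro k i
      rw [show {x | ∀ j, P.val (w k j) x ≤ 1 / ((i : ℝ) + 1)} =
        ⋂ j, {x | P.val (w k j) x ≤ 1 / ((i : ℝ) + 1)} by ext; simp]
      refine MeasurableSet.iInter fun j => ?_
      -- This smooth function vanishes exactly on (-∞, 1/(i+1)], so its composition turns a sublevel
      -- set into a zero set of an element of the class.
      have hφ : ContDiff ℝ 1 fun s : ℝ => expNegInvGlue (s - 1 / ((i : ℝ) + 1)) :=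
        expNegInvGlue.contDiff.comp (contDiff_id.sub contDiff_const)
      obtain ⟨z, hz, hval, -⟩ := hP.chain hφ (hw.mem k j)
      refine MeasurableSet.of_compl (MeasurableSpace.measurableSet_generateFrom ⟨z, hz, ?_⟩)
      ext x
      change ¬ (P.val (w k j) x ≤ 1 / ((i : ℝ) + 1)) ↔ P.val z x ≠ 0
      rw [hval, Ne, expNegInvGlue.zero_iff_nonpos, sub_nonpos]
    have hO' : O = ⋃ (p : ℕ × ℕ) (_ : {x | ∀ j, P.val (w p.1 j) x ≤ 1 / ((p.2 : ℝ) + 1)} ⊆ O),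
        {x | ∀ j, P.val (w p.1 j) x ≤ 1 / ((p.2 : ℝ) + 1)} := by
      ext x
      simp only [Set.mem_iUnion]
      constructor
      · intro hx
        obtain ⟨k, i, -, h1, h2⟩ := hw.nhds x O hO hx 0
        exact ⟨(k, i), h2, h1⟩
      · rintro ⟨p, hp, hx⟩
        exact hp hx
    rw [hO']
    exact MeasurableSet.iUnion fun p => MeasurableSet.iUnion fun _ => hB p.1 p.2
  · rintro _ ⟨u, hu, rfl⟩
    exact ((hP.continuous_val hu).measurable (measurableSet_singleton 0)).compl

variable [IsFiniteMeasure m]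

/-- The class is dense in `L²(m)`. -/
theorem denseRange_toLp (hP : DiffusionCore m P Γ) (hw : Barrier m P Γ g w) :
    DenseRange hP.toLp := by
  set D := (LinearMap.range hP.toLp).topologicalClosure with hD
  have hcoreD : ∀ u : hP.core, hP.toLp u ∈ D := fun u =>
    Submodule.le_topologicalClosure _ ⟨u, rfl⟩
  have hclosed : IsClosed (D : Set (Lp ℝ 2 m)) := Submodule.isClosed_topologicalClosure _
  -- The constant 1 belongs to the class: compose the zero function with a constant.
  obtain ⟨o, ho, hoval, -⟩ := hP.chain (φ := fun _ => (1 : ℝ)) contDiff_const hP.zero_mem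
  have hind : ∀ s : Set X, MeasurableSet s →
      ∃ f ∈ D, f =ᵐ[m] s.indicator fun _ => (1 : ℝ) := by
    intro s hs
    refine MeasurableSpace.induction_on_inter
      (C := fun s _ => ∃ f ∈ D, f =ᵐ[m] s.indicator fun _ => (1 : ℝ))
      (hw.measurableSpace_eq hP) (isPiSystem hP) ?_ ?_ ?_ ?_ s hs
    · refine ⟨0, D.zero_mem, ?_⟩
      rw [Set.indicator_empty]
      exact Lp.coeFn_zero ℝ 2 m
    · rintro _ ⟨u, hu, rfl⟩
      -- These functions of `u` increase to the indicator of {u ≠ 0} and are bounded by 1.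
      have hφ : ∀ n : ℕ, ContDiff ℝ 1 fun s : ℝ => s ^ 2 / (s ^ 2 + 1 / ((n : ℝ) + 1)) := fun n =>
        ContDiff.div (by fun_prop) (by fun_prop) fun s => by positivity
      choose z hz hval _ using fun n => hP.chain (hφ n) hu
      obtain ⟨G, hG, hlim⟩ := tendsto_L2_of_tendsto_ae
        (f := fun n => hP.toLp ⟨z n, hz n⟩) (C := 1)
        (g := {x | P.val u x ≠ 0}.indicator fun _ => (1 : ℝ)) (fun n => by
          filter_upwards [hP.coeFn_toLp ⟨z n, hz n⟩] with x hx
          rw [hx, hval, abs_of_nonneg (by positivity)]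
          refine div_le_one_of_le₀ ?_ (by positivity)
          have : 0 < 1 / ((n : ℝ) + 1) := by positivity
          linarith)
        (by
          filter_upwards [ae_all_iff.2 fun n => hP.coeFn_toLp ⟨z n, hz n⟩] with x hx
          simp only [hx, hval]
          by_cases h0 : P.val u x = 0
          · simp [h0]
          · rw [Set.indicator_of_mem (show x ∈ {x | P.val u x ≠ 0} from h0)]
            have h1 : Tendsto (fun n : ℕ => P.val u x ^ 2 / (P.val u x ^ 2 + 1 / ((n : ℝ) + 1)))
                atTop (𝓝 (P.val u x ^ 2 / (P.val u x ^ 2 + 0))) :=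
              Tendsto.div tendsto_const_nhds
                (tendsto_const_nhds.add tendsto_one_div_add_atTop_nhds_zero_nat) (by simpa using h0)
            rwa [add_zero, div_self (pow_ne_zero 2 h0)] at h1)
      exact ⟨G, hclosed.mem_of_tendsto hlim (Eventually.of_forall fun n => hcoreD _), hG⟩
    · rintro t - ⟨f, hf, hft⟩
      refine ⟨hP.toLp ⟨o, ho⟩ - f, D.sub_mem (hcoreD _) hf, ?_⟩
      filter_upwards [Lp.coeFn_sub (hP.toLp ⟨o, ho⟩) f, hP.coeFn_toLp ⟨o, ho⟩, hft]
        with x h1 h2 h3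
      rw [h1, Pi.sub_apply, h2, h3, hoval]
      by_cases hx : x ∈ t <;> simp [hx]
    · intro t hdisj htm ht
      choose f hf hft using ht
      have hsum : ∀ n, (↑(∑ i ∈ Finset.range n, f i) : X → ℝ) =ᵐ[m]
          fun x => ∑ i ∈ Finset.range n, (t i).indicator (fun _ => (1 : ℝ)) x := by
        intro n
        induction n with
        | zero =>
          simp only [Finset.range_zero, Finset.sum_empty]
          exact Lp.coeFn_zero ℝ 2 m
        | succ n ih =>
          rw [Finset.sum_range_succ]
          filter_upwards [ih, hft n, Lp.coeFn_add (∑ i ∈ Finset.range n, f i) (f n)]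
            with x h1 h2 h3
          rw [h3, Pi.add_apply, h1, h2, Finset.sum_range_succ]
      have hsumind : ∀ n x, ∑ i ∈ Finset.range n, (t i).indicator (fun _ => (1 : ℝ)) x =
          (⋃ i ∈ Finset.range n, t i).indicator (fun _ => (1 : ℝ)) x := by
        intro n x
        rw [Finset.indicator_biUnion_apply]
        exact fun i _ j _ hij => hdisj hij
      obtain ⟨G, hG, hlim⟩ := tendsto_L2_of_tendsto_ae
        (f := fun n => ∑ i ∈ Finset.range n, f i) (C := 1)
        (g := (⋃ i, t i).indicator fun _ => (1 : ℝ)) (fun n => by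
          filter_upwards [hsum n] with x hx
          rw [hx, hsumind]
          by_cases h : x ∈ ⋃ i ∈ Finset.range n, t i
          · rw [Set.indicator_of_mem h]; simp
          · rw [Set.indicator_of_notMem h]; simp)
        (by
          filter_upwards [ae_all_iff.2 hsum] with x hx
          simp only [hx, hsumind]
          by_cases h : x ∈ ⋃ i, t i
          · rw [Set.indicator_of_mem h]
            obtain ⟨i, hi⟩ := Set.mem_iUnion.1 h
            refine tendsto_const_nhds.congr' ?_
            filter_upwards [eventually_gt_atTop i] with n hn
            rw [Set.indicator_of_mem]
            exact Set.mem_biUnion (by simpa using hn) hi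
          · rw [Set.indicator_of_notMem h]
            refine tendsto_const_nhds.congr fun n => ?_
            rw [Set.indicator_of_notMem]
            simp only [Set.mem_iUnion, not_exists] at h ⊢
            exact fun i _ => h i)
      exact ⟨G, hclosed.mem_of_tendsto hlim
        (Eventually.of_forall fun n => D.sum_mem fun i _ => hf i), hG⟩
  have hall : ∀ f : Lp ℝ 2 m, f ∈ D := by
    intro f
    induction f using Lp.induction with
    | hp_ne_top => simp
    | @indicatorConst c s hs hμs =>
      obtain ⟨f, hf, hfs⟩ := hind s hs
      have : (Lp.simpleFunc.indicatorConst 2 hs hμs.ne c : Lp ℝ 2 m) = c • f := by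
        refine Lp.ext ?_
        rw [Lp.simpleFunc.coe_indicatorConst]
        filter_upwards [indicatorConstLp_coeFn (p := 2) (hs := hs) (hμs := hμs.ne) (c := c),
          Lp.coeFn_smul c f, hfs] with x h1 h2 h3
        rw [h1, h2, Pi.smul_apply, h3]
        by_cases hx : x ∈ s <;> simp [hx]
      rw [this]
      exact D.smul_mem c hf
    | add hf hg _ ihf ihg => exact D.add_mem ihf ihg
    | isClosed => exact hclosed
  intro f
  have := hall f
  rwa [hD, ← SetLike.mem_coe, Submodule.topologicalClosure_coe] at this

end Barrier

/-! #### Uniform limits of functions of bounded energy density -/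

/-- Uniform limits of functions of the class with energy density at most `g`. -/
def UniformEnergyLimit {α X : Type*} (P : PreForm α X) (Γ : α → α → X → ℝ) (g f : X → ℝ) :
    Prop :=
  ∀ ε > 0, ∃ u ∈ P.dom, (∀ x, Γ u u x ≤ g x) ∧ ∀ x, |P.val u x - f x| ≤ ε

namespace UniformEnergyLimit

variable {m : Measure X} {P : PreForm α X} {Γ : α → α → X → ℝ} {g f f' : X → ℝ}
  [AddCommGroup α] [Module ℝ α]

theorem of_mem {α X : Type*} {P : PreForm α X} {Γ : α → α → X → ℝ} {g : X → ℝ} {u : α}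
    (hu : u ∈ P.dom) (hg : ∀ x, Γ u u x ≤ g x) :
    UniformEnergyLimit P Γ g (P.val u) :=
  fun ε hε => ⟨u, hu, hg, fun x => by simpa using hε.le⟩

theorem neg (hP : DiffusionCore m P Γ) (hf : UniformEnergyLimit P Γ g f) :
    UniformEnergyLimit P Γ g fun x => -f x := by
  intro ε hε
  obtain ⟨u, hu, h1, h2⟩ := hf ε hε
  refine ⟨(-1 : ℝ) • u, hP.smul_mem _ hu, fun x => ?_, fun x => ?_⟩
  · rw [hP.smul_left _ hu (hP.smul_mem _ hu), hP.symm hu (hP.smul_mem _ hu), hP.smul_left _ hu hu]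
    simpa using h1 x
  · rw [hP.val_smul, Pi.smul_apply, neg_one_smul, ← neg_sub', abs_neg]
    exact h2 x

/-- With r the derivative of the smoothed absolute value at u - v, the function (u + v + |u - v|)/2
has derivative (1+r)/2 · Du + (1-r)/2 · Dv, a convex combination. The bound `g` on the energy
density is therefore preserved and does not grow under repeated maxima. -/
theorem max (hP : DiffusionCore m P Γ) (hf : UniformEnergyLimit P Γ g f)
    (hf' : UniformEnergyLimit P Γ g f') :
    UniformEnergyLimit P Γ g fun x => max (f x) (f' x) := by
  intro ε hε
  obtain ⟨u, hu, hu1, hu2⟩ := hf (ε / 2) (by positivity)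
  obtain ⟨v, hv, hv1, hv2⟩ := hf' (ε / 2) (by positivity)
  have hε2 : 0 < ε / 2 := by positivity
  let d : hP.core := ⟨u, hu⟩ - ⟨v, hv⟩
  obtain ⟨z, hz, hzval, hzΓ⟩ := hP.chain (contDiff_smoothAbs hε2) d.2
  let y : hP.core := (1 / 2 : ℝ) • (((⟨u, hu⟩ : hP.core) + ⟨v, hv⟩) + ⟨z, hz⟩)
  have hyΓ : ∀ (c : hP.core) x, Γ y c x =
      (1 + deriv (smoothAbs (ε / 2)) (P.val d x)) / 2 * Γ u c x +
      (1 - deriv (smoothAbs (ε / 2)) (P.val d x)) / 2 * Γ v c x := by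
    intro c x
    have h1 : Γ y c x = 1 / 2 * ((Γ u c x + Γ v c x) + Γ z c x) := by
      change Γ ((1 / 2 : ℝ) • ((u + v) + z)) c x = _
      rw [hP.smul_left _ (hP.add_mem (hP.add_mem hu hv) hz) c.2,
        hP.add_left (hP.add_mem hu hv) hz c.2, hP.add_left hu hv c.2]
    rw [h1, hzΓ c c.2, hP.sub_left ⟨u, hu⟩ ⟨v, hv⟩]
    ring
  refine ⟨y, y.2, fun x => ?_, fun x => ?_⟩
  · have hb := abs_le.1 (abs_deriv_smoothAbs_le hε2 (P.val d x))
    rw [hyΓ y, hP.symm hu y.2, hP.symm hv y.2, hyΓ ⟨u, hu⟩, hyΓ ⟨v, hv⟩]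
    set r := deriv (smoothAbs (ε / 2)) (P.val d x)
    -- Positivity of Γ(u - v, u - v) yields 2 Γ(u,v) ≤ Γ(u,u) + Γ(v,v) ≤ 2g, which bounds the mixed
    -- term.
    have hq := hP.quadratic_nonneg ⟨u, hu⟩ ⟨v, hv⟩ (-1) x
    have hsym := hP.symm hu hv x
    have h1 := hu1 x
    have h2 := hv1 x
    dsimp only at hq ⊢
    rw [← hsym]
    have h3 : Γ u v x ≤ g x := by linarith
    have ha : 0 ≤ (1 + r) / 2 := by linarith
    have hb' : 0 ≤ (1 - r) / 2 := by linarith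
    calc (1 + r) / 2 * ((1 + r) / 2 * Γ u u x + (1 - r) / 2 * Γ u v x) +
        (1 - r) / 2 * ((1 + r) / 2 * Γ u v x + (1 - r) / 2 * Γ v v x) ≤
        (1 + r) / 2 * ((1 + r) / 2 * g x + (1 - r) / 2 * g x) +
        (1 - r) / 2 * ((1 + r) / 2 * g x + (1 - r) / 2 * g x) := by gcongr
      _ = g x := by ring
  · have hval : P.val y x =
        (P.val u x + P.val v x + smoothAbs (ε / 2) (P.val u x - P.val v x)) / 2 := by
      change P.val ((1 / 2 : ℝ) • ((u + v) + z)) x = _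
      rw [hP.val_smul, hP.val_add, hP.val_add, Pi.smul_apply, Pi.add_apply, Pi.add_apply, hzval,
        hP.val_sub, smul_eq_mul]
      ring
    have h1 := abs_le_smoothAbs (ε / 2) (P.val u x - P.val v x)
    have h2 := smoothAbs_le hε2 (P.val u x - P.val v x)
    have h3 : |P.val y x - Max.max (P.val u x) (P.val v x)| ≤ ε / 2 := by
      have h5 : Max.max (P.val u x) (P.val v x) =
          (P.val u x + P.val v x + |P.val u x - P.val v x|) / 2 := by
        rcases le_total (P.val u x) (P.val v x) with h | h
        · rw [max_eq_right h, abs_of_nonpos (by linarith)]; ring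
        · rw [max_eq_left h, abs_of_nonneg (by linarith)]; ring
      rw [hval, h5, abs_le]
      constructor <;> linarith
    have h4 : |Max.max (P.val u x) (P.val v x) - Max.max (f x) (f' x)| ≤ ε / 2 :=
      (abs_max_sub_max_le_max _ _ _ _).trans (max_le (hu2 x) (hv2 x))
    calc |P.val y x - Max.max (f x) (f' x)| ≤ _ := abs_sub_le _ (Max.max (P.val u x) (P.val v x)) _
      _ ≤ ε := by linarith

theorem min (hP : DiffusionCore m P Γ) (hf : UniformEnergyLimit P Γ g f)
    (hf' : UniformEnergyLimit P Γ g f') :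
    UniformEnergyLimit P Γ g fun x => min (f x) (f' x) := by
  have := ((hf.neg hP).max hP (hf'.neg hP)).neg hP
  simpa [max_neg_neg] using this

variable [BorelSpace X] [IsFiniteMeasure m] {hP : DiffusionCore m P Γ} {F : L2Form m} {W : Type*}
  [NormedAddCommGroup W] [InnerProductSpace ℝ W] [CompleteSpace W] {e : W ≃ₗ[ℝ] F.domain}
  {ι : hP.core →ₗ[ℝ] W}

/-- Approximants have energy at most ∫ g and converge uniformly, hence in L²; lower semicontinuity
places the limit in the domain. -/
theorem exists_mem (hM : ClosureModel hP e ι) (hg : Integrable g m)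
    (hf : UniformEnergyLimit P Γ g f) {C : ℝ} (hC : ∀ x, |f x| ≤ C) :
    ∃ y, hM.embed y =ᵐ[m] f ∧ F.form (e y) (e y) ≤ ∫ x, g x ∂m := by
  have hδ : ∀ n : ℕ, 0 < 1 / ((n : ℝ) + 1) := fun n => by positivity
  choose u hu hΓ hval using fun n : ℕ => hf (1 / ((n : ℝ) + 1)) (hδ n)
  obtain ⟨G, hG, hlim⟩ := tendsto_L2_of_tendsto_ae (m := m) (g := f)
    (f := fun n => hP.toLp ⟨u n, hu n⟩) (C := C + 1)
    (fun n => by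
      filter_upwards [hP.coeFn_toLp ⟨u n, hu n⟩] with x hx
      rw [hx]
      have h1 : |P.val (u n) x| ≤ |P.val (u n) x - f x| + |f x| := by
        simpa using abs_sub_abs_le_abs_sub (P.val (u n) x) (f x)
      have h2 : 1 / ((n : ℝ) + 1) ≤ 1 := by
        rw [div_le_one (by positivity)]
        have : (0 : ℝ) ≤ n := by positivity
        linarith
      have h3 := hval n x
      have h4 := hC x
      linarith)
    (by
      filter_upwards [ae_all_iff.2 fun n => hP.coeFn_toLp ⟨u n, hu n⟩] with x hx
      simp only [hx]
      rw [tendsto_iff_dist_tendsto_zero]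
      exact squeeze_zero (fun n => dist_nonneg) (fun n => hval n x)
        tendsto_one_div_add_atTop_nhds_zero_nat)
  obtain ⟨y, hy, hle⟩ := hM.exists_form_le (u := fun n => ⟨u n, hu n⟩)
    (c := fun _ => ∫ x, g x ∂m) (fun n => by
      rw [hP.form_eq (hu n) (hu n)]
      exact integral_mono (hP.integrable (hu n) (hu n)) hg (hΓ n)) tendsto_const_nhds hlim
  exact ⟨y, hy ▸ hG, hle⟩

end UniformEnergyLimit

/-! #### Capacities -/

/-- `min (s 0 x) … (s n x)`. -/
def runningMin {X : Type*} (s : ℕ → X → ℝ) : ℕ → X → ℝ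
  | 0 => s 0
  | n + 1 => fun x => min (runningMin s n x) (s (n + 1) x)

theorem runningMin_le_iff {X : Type*} (s : ℕ → X → ℝ) (n : ℕ) (x : X) (c : ℝ) :
    runningMin s n x ≤ c ↔ ∃ k ≤ n, s k x ≤ c := by
  induction n with
  | zero => simp [runningMin]
  | succ n ih =>
    rw [runningMin, min_le_iff, ih]
    constructor
    · rintro (⟨k, hk, h⟩ | h)
      · exact ⟨k, by omega, h⟩
      · exact ⟨n + 1, le_rfl, h⟩
    · rintro ⟨k, hk, h⟩
      rcases Nat.lt_or_ge k (n + 1) with h1 | h1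
      · exact Or.inl ⟨k, by omega, h⟩
      · obtain rfl : k = n + 1 := by omega
        exact Or.inr h

theorem runningMin_antitone {X : Type*} (s : ℕ → X → ℝ) (x : X) :
    Antitone fun n => runningMin s n x :=
  antitone_nat_of_succ_le fun _ => min_le_left _ _

theorem runningMin_nonneg {X : Type*} {s : ℕ → X → ℝ} (hs : ∀ k x, 0 ≤ s k x) (n : ℕ) (x : X) :
    0 ≤ runningMin s n x := by
  induction n with
  | zero => exact hs 0 x
  | succ n ih => exact le_min ih (hs _ x)

theorem runningMin_le_one {X : Type*} {s : ℕ → X → ℝ} (hs : ∀ k x, s k x ≤ 1) (n : ℕ) (x : X) :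
    runningMin s n x ≤ 1 :=
  (runningMin_le_iff s n x 1).2 ⟨0, Nat.zero_le _, hs 0 x⟩

theorem tendsto_runningMin {X : Type*} {s : ℕ → ℕ → X → ℝ} {s' : ℕ → X → ℝ}
    (h : ∀ k x, Tendsto (fun J => s J k x) atTop (𝓝 (s' k x))) (n : ℕ) (x : X) :
    Tendsto (fun J => runningMin (s J) n x) atTop (𝓝 (runningMin s' n x)) := by
  induction n with
  | zero => exact h 0 x
  | succ n ih => exact ih.min (h _ x)

namespace Barrier

variable {m : Measure X} {P : PreForm α X} {Γ : α → α → X → ℝ} {g : X → ℝ} {w : ℕ → ℕ → α}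

/-- The supremum over `j` of the barrier functions. -/
def level (P : PreForm α X) (w : ℕ → ℕ → α) (k : ℕ) (x : X) : ℝ := ⨆ j, P.val (w k j) x

theorem bddAbove (hw : Barrier m P Γ g w) (k : ℕ) (x : X) :
    BddAbove (Set.range fun j => P.val (w k j) x) :=
  ⟨1, by rintro _ ⟨j, rfl⟩; exact hw.le_one k j x⟩

theorem level_le_iff (hw : Barrier m P Γ g w) (k : ℕ) (x : X) (c : ℝ) :
    level P w k x ≤ c ↔ ∀ j, P.val (w k j) x ≤ c :=
  ciSup_le_iff (hw.bddAbove k x)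

theorem level_nonneg (hw : Barrier m P Γ g w) (k : ℕ) (x : X) : 0 ≤ level P w k x :=
  (hw.nonneg k 0 x).trans (le_ciSup (hw.bddAbove k x) 0)

theorem level_le_one (hw : Barrier m P Γ g w) (k : ℕ) (x : X) : level P w k x ≤ 1 :=
  (hw.level_le_iff k x 1).2 fun j => hw.le_one k j x

/-- Each point lies in joint sublevel sets of arbitrarily small height, and one centre k suffices
for each height. -/
theorem tendsto_runningMin_level (hw : Barrier m P Γ g w) (x : X) :
    Tendsto (fun n => runningMin (level P w) n x) atTop (𝓝 0) := by
  refine tendsto_order.2 ⟨fun a ha => Eventually.of_forall fun n =>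
    ha.trans_le (runningMin_nonneg hw.level_nonneg n x), fun a ha => ?_⟩
  obtain ⟨i₀, hi₀⟩ := exists_nat_one_div_lt ha
  obtain ⟨k, i, hi, h1, -⟩ := hw.nhds x Set.univ isOpen_univ trivial i₀
  filter_upwards [eventually_ge_atTop k] with n hn
  refine lt_of_le_of_lt ((runningMin_le_iff _ n x (1 / ((i₀ : ℝ) + 1))).2 ⟨k, hn, ?_⟩) hi₀
  rw [hw.level_le_iff]
  refine fun j => (h1 j).trans ?_
  have : (i₀ : ℝ) ≤ i := by exact_mod_cast hi
  gcongr

variable [AddCommGroup α] [Module ℝ α] [BorelSpace X] [IsFiniteMeasure m]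
  {hP : DiffusionCore m P Γ} {F : L2Form m} {W : Type*}
  [NormedAddCommGroup W] [InnerProductSpace ℝ W] [CompleteSpace W] {e : W ≃ₗ[ℝ] F.domain}
  {ι : hP.core →ₗ[ℝ] W}

/-- Suprema over infinitely many j are limits of finite partial suprema, which keep the energy bound
∫ g. The resulting bound is uniform in `n`, the point needed for the weak limit in
`exists_small_above`. -/
theorem exists_runningMin_mem (hw : Barrier m P Γ g w) (hM : ClosureModel hP e ι) (n : ℕ) :
    ∃ y, hM.embed y =ᵐ[m] runningMin (level P w) n ∧
      ‖y‖ ^ 2 ≤ (∫ x, g x ∂m) + ‖Lp.const 2 m (1 : ℝ)‖ ^ 2 := by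
  have hS : ∀ J k, UniformEnergyLimit P Γ g
      fun x => partialSups (fun j => P.val (w k j) x) J := by
    intro J k
    induction J with
    | zero =>
      simp only [partialSups_zero]
      exact UniformEnergyLimit.of_mem (hw.mem k 0) (hw.energy k 0)
    | succ J ih =>
      simp only [partialSups_add_one]
      exact ih.max hP (UniformEnergyLimit.of_mem (hw.mem k (J + 1)) (hw.energy k (J + 1)))
  set S : ℕ → ℕ → X → ℝ := fun J k x => partialSups (fun j => P.val (w k j) x) J with hSdef
  have hS0 : ∀ J k x, 0 ≤ S J k x := fun J k x =>
    (hw.nonneg k 0 x).trans (le_partialSups_of_le (fun j => P.val (w k j) x) (Nat.zero_le J))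
  have hS1 : ∀ J k x, S J k x ≤ 1 := fun J k x =>
    partialSups_le _ _ _ fun j _ => hw.le_one k j x
  have hSlim : ∀ k x, Tendsto (fun J => S J k x) atTop (𝓝 (level P w k x)) := by
    intro k x
    have hbdd : BddAbove (Set.range fun J => S J k x) :=
      ⟨1, by rintro _ ⟨J, rfl⟩; exact hS1 J k x⟩
    have := tendsto_atTop_ciSup (partialSups_monotone fun j => P.val (w k j) x) hbdd
    rwa [ciSup_partialSups_eq (hw.bddAbove k x)] at this
  have hR : ∀ J, UniformEnergyLimit P Γ g (runningMin (S J) n) := by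
    intro J
    induction n with
    | zero => exact hS J 0
    | succ n ih => exact ih.min hP (hS J (n + 1))
  have habs : ∀ J x, |runningMin (S J) n x| ≤ 1 := fun J x =>
    abs_le.2 ⟨by linarith [runningMin_nonneg (hS0 J) n x], runningMin_le_one (hS1 J) n x⟩
  choose y hy hle using fun J => (hR J).exists_mem hM hw.integrable (habs J)
  have hnorm : ∀ J, ‖y J‖ ^ 2 ≤ (∫ x, g x ∂m) + ‖Lp.const 2 m (1 : ℝ)‖ ^ 2 := by
    intro J
    have h1 := hM.form_self (y J)
    have h2 : ‖hM.embed (y J)‖ ≤ ‖Lp.const 2 m (1 : ℝ)‖ := by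
      refine Lp.norm_le_norm_of_ae_le ?_
      filter_upwards [hy J, Lp.coeFn_const (p := 2) (μ := m) (1 : ℝ)] with x h3 h4
      rw [h3, h4]
      simpa using habs J x
    have h5 : ‖hM.embed (y J)‖ ^ 2 ≤ ‖Lp.const 2 m (1 : ℝ)‖ ^ 2 := by gcongr
    linarith [hle J]
  obtain ⟨G, hG, hlim⟩ := tendsto_L2_of_tendsto_ae (m := m) (f := fun J => hM.embed (y J))
    (g := runningMin (level P w) n) (C := 1)
    (fun J => by filter_upwards [hy J] with x hx; rw [hx]; exact habs J x)
    (by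
      filter_upwards [ae_all_iff.2 hy] with x hx
      simp only [hx]
      exact tendsto_runningMin hSlim n x)
  obtain ⟨z, hz, hzle⟩ := exists_preimage_norm_sq_le hM.embed hnorm tendsto_const_nhds hlim
  exact ⟨z, hz ▸ hG, hzle⟩

/-- The running minima are bounded in the model and tend to 0 in L², so 0 is in the closed convex
hull of the sequence. A convex combination of running minima still dominates a later one, by
monotonicity in n. -/
theorem exists_small_above (hw : Barrier m P Γ g w) (hM : ClosureModel hP e ι) {ε : ℝ}
    (hε : 0 < ε) : ∃ (n : ℕ) (y : W), ‖y‖ ≤ ε ∧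
      ∀ᵐ x ∂m, runningMin (level P w) n x ≤ hM.embed y x := by
  choose y hy hle using hw.exists_runningMin_mem hM
  have hbd : ∀ n, ‖y n‖ ≤ Real.sqrt ((∫ x, g x ∂m) + ‖Lp.const 2 m (1 : ℝ)‖ ^ 2) := fun n =>
    Real.le_sqrt_of_sq_le (hle n)
  obtain ⟨G, hG, hlim⟩ := tendsto_L2_of_tendsto_ae (m := m) (f := fun n => hM.embed (y n))
    (g := fun _ => 0) (C := 1)
    (fun n => by
      filter_upwards [hy n] with x hx
      rw [hx, abs_of_nonneg (runningMin_nonneg hw.level_nonneg n x)]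
      exact runningMin_le_one hw.level_le_one n x)
    (by
      filter_upwards [ae_all_iff.2 hy] with x hx
      simp only [hx]
      exact hw.tendsto_runningMin_level x)
  have hG0 : G = 0 := Lp.ext (hG.trans (Lp.coeFn_zero ℝ 2 m).symm)
  rw [hG0] at hlim
  obtain ⟨c, hc, hmem⟩ := exists_preimage_mem_closedConvexHull_tails hM.embed hbd hlim
  have hc0 : c = 0 := hM.embed_injective (by rw [hc, map_zero])
  rw [hc0] at hmem
  obtain ⟨z, hz, hzε⟩ := Metric.mem_closure_iff.1 (hmem 0) ε hε
  -- Convexity of this set uses that the running minimum of index max(n, k) lies below both others.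
  have hconv : Convex ℝ {z : W | ∃ n, ∀ᵐ x ∂m, runningMin (level P w) n x ≤ hM.embed z x} := by
    rintro a ⟨n, hn⟩ b ⟨k, hk⟩ s t hs ht hst
    refine ⟨Max.max n k, ?_⟩
    rw [map_add, map_smul, map_smul]
    filter_upwards [hn, hk, Lp.coeFn_add (s • hM.embed a) (t • hM.embed b),
      Lp.coeFn_smul s (hM.embed a), Lp.coeFn_smul t (hM.embed b)] with x h1 h2 h3 h4 h5
    rw [h3, Pi.add_apply, h4, h5, Pi.smul_apply, Pi.smul_apply, smul_eq_mul, smul_eq_mul]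
    have h6 := (runningMin_antitone (level P w) x (le_max_left n k)).trans h1
    have h7 := (runningMin_antitone (level P w) x (le_max_right n k)).trans h2
    calc runningMin (level P w) (Max.max n k) x
        = s * runningMin (level P w) (Max.max n k) x
          + t * runningMin (level P w) (Max.max n k) x := by rw [← add_mul, hst, one_mul]
      _ ≤ _ := by gcongr
  have hsub := convexHull_min (s := y '' Set.Ici 0) (by
    rintro _ ⟨n, -, rfl⟩
    exact ⟨n, (hy n).symm.le⟩) hconv
  obtain ⟨n, hn⟩ := hsub hz
  refine ⟨n, z, ?_, hn⟩
  rw [dist_zero_left] at hzε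
  exact hzε.le

/-- Off the compact set some running minimum exceeds 1/(i+1). Multiplying its small majorant by i+1
produces a function at least 1 there, and the sum over i is an admissible function for the capacity.
-/
theorem exists_compact_cap_le [T2Space X] (hw : Barrier m P Γ g w) (hM : ClosureModel hP e ι)
    {ε : ℝ} (hε : 0 < ε) : ∃ K, IsCompact K ∧ F.cap Kᶜ ≤ ENNReal.ofReal (ε ^ 2) := by
  -- The denominator i+1 anticipates the rescaling by i+1; the rest is a geometric series with sum
  -- ε.
  have hpos : ∀ i : ℕ, 0 < ε / 2 / 2 ^ i / ((i : ℝ) + 1) := fun i => by positivity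
  choose n y hyn hy using fun i => hw.exists_small_above hM (hpos i)
  set K : Set X := {x | ∀ i : ℕ, ∃ k ≤ n i, ∀ j, P.val (w k j) x ≤ 1 / ((i : ℝ) + 1)} with hK
  have hKc : IsCompact K := hw.compact n
  refine ⟨K, hKc, ?_⟩
  set a : ℕ → W := fun i => ((i : ℝ) + 1) • y i with ha
  have hna : ∀ i, ‖a i‖ ≤ ε / 2 / 2 ^ i := by
    intro i
    rw [ha, norm_smul, Real.norm_eq_abs, abs_of_nonneg (by positivity)]
    calc ((i : ℝ) + 1) * ‖y i‖ ≤ ((i : ℝ) + 1) * (ε / 2 / 2 ^ i / ((i : ℝ) + 1)) := by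
          gcongr; exact hyn i
      _ = ε / 2 / 2 ^ i := by field_simp
  have hgeo : HasSum (fun i : ℕ => ε / 2 / 2 ^ i) ε := hasSum_geometric_two' ε
  have hsum : Summable a := Summable.of_norm_bounded hgeo.summable hna
  set G := ∑' i, a i with hG
  have hGn : ‖G‖ ≤ ε := tsum_of_norm_bounded hgeo hna
  have hembed : HasSum (fun i => hM.embed (a i)) (hM.embed G) := hM.embed.hasSum hsum.hasSum
  have hnonneg : ∀ i, 0 ≤ hM.embed (a i) := by
    intro i
    rw [← Lp.coeFn_nonneg, ha, map_smul]
    filter_upwards [hy i, Lp.coeFn_smul ((i : ℝ) + 1) (hM.embed (y i))] with x h1 h2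
    rw [h2, Pi.smul_apply, smul_eq_mul, Pi.zero_apply]
    have := (runningMin_nonneg hw.level_nonneg (n i) x).trans h1
    positivity
  -- Nonnegative summands lie below their sum in the order of L².
  have hge : ∀ i, hM.embed (a i) ≤ hM.embed G := fun i =>
    le_hasSum hembed i fun j _ => hnonneg j
  have hone : ∀ᵐ x ∂m, x ∈ Kᶜ → 1 ≤ hM.embed G x := by
    filter_upwards [ae_all_iff.2 hy, ae_all_iff.2 fun i => (Lp.coeFn_le _ _).2 (hge i),
      ae_all_iff.2 fun i : ℕ => Lp.coeFn_smul ((i : ℝ) + 1) (hM.embed (y i))] with x h1 h2 h3 hx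
    have hx' : ∃ i, ¬ (runningMin (level P w) (n i) x ≤ 1 / ((i : ℝ) + 1)) := by
      by_contra hcon
      push Not at hcon
      refine hx fun i => ?_
      obtain ⟨k, hk, h⟩ := (runningMin_le_iff _ _ _ _).1 (hcon i)
      exact ⟨k, hk, (hw.level_le_iff k x _).1 h⟩
    obtain ⟨i, hi⟩ := hx'
    refine le_trans ?_ (h2 i)
    rw [ha, map_smul, h3, Pi.smul_apply, smul_eq_mul]
    have h4 := (not_le.1 hi).le.trans (h1 i)
    calc (1 : ℝ) = ((i : ℝ) + 1) * (1 / ((i : ℝ) + 1)) := by field_simp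
      _ ≤ _ := by gcongr
  calc F.cap Kᶜ ≤ F.capOpen Kᶜ :=
        iInf_le_of_le Kᶜ (iInf_le_of_le hKc.isClosed.isOpen_compl (iInf_le _ subset_rfl))
    _ ≤ ENNReal.ofReal (F.form₁ (e G) (e G)) := iInf_le_of_le (e G) (iInf_le _ hone)
    _ ≤ ENNReal.ofReal (ε ^ 2) := by
      rw [hM.form₁_self]
      gcongr

theorem isQuasiRegular [T2Space X] (hw : Barrier m P Γ g w) (hM : ClosureModel hP e ι) :
    F.IsQuasiRegular where
  compact_nest := by
    choose K hK hcap using fun n : ℕ =>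
      hw.exists_compact_cap_le hM (ε := 1 / ((n : ℝ) + 1)) (by positivity)
    refine ⟨K, ⟨fun n => (hK n).isClosed, ?_⟩, hK⟩
    have h1 : Tendsto (fun n : ℕ => ENNReal.ofReal ((1 / ((n : ℝ) + 1)) ^ 2)) atTop (𝓝 0) := by
      have := ENNReal.tendsto_ofReal (tendsto_one_div_add_atTop_nhds_zero_nat (𝕜 := ℝ) |>.pow 2)
      simpa using this
    exact tendsto_of_tendsto_of_tendsto_of_le_of_le tendsto_const_nhds h1
      (fun n => bot_le) hcap
  dense_quasiContinuous := by
    refine ⟨LinearMap.range (e.toLinearMap ∘ₗ ι), ?_, ?_⟩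
    · rintro _ ⟨u, rfl⟩
      exact ⟨P.val u, F.quasiContinuous_of_continuous (hP.continuous_val u.2), hM.embed_core_ae u⟩
    · intro u ε hε
      obtain ⟨a, rfl⟩ := e.surjective u
      obtain ⟨_, ⟨c, rfl⟩, hc⟩ := Metric.mem_closure_iff.1 (hM.denseRange a) (Real.sqrt ε)
        (Real.sqrt_pos.2 hε)
      refine ⟨e (ι c), ⟨c, rfl⟩, ?_⟩
      rw [← map_sub, hM.form₁_self]
      rw [dist_eq_norm] at hc
      calc ‖a - ι c‖ ^ 2 < Real.sqrt ε ^ 2 := by gcongr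
        _ = ε := Real.sq_sqrt hε.le
  separating := by
    -- No exceptional set is needed: the barrier functions are continuous and separate all points,
    -- by applying `nhds` to the complement of the second point.
    refine ⟨∅, fun n => P.val (w n.unpair.1 n.unpair.2), F.cap_empty, fun n => ?_, ?_⟩
    · exact ⟨F.quasiContinuous_of_continuous (hP.continuous_val (hw.mem _ _)),
        e (ι ⟨_, hw.mem _ _⟩), hM.embed_core_ae ⟨_, hw.mem _ _⟩⟩
    · intro z₁ _ z₂ _ hne
      obtain ⟨k, i, -, h1, h2⟩ := hw.nhds z₁ {z₂}ᶜ isOpen_compl_singleton hne 0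
      by_contra! hcon
      have h3 := h2 z₂ fun j => by
        have := hcon (Nat.pair k j)
        simp only [Nat.unpair_pair] at this
        rw [← this]
        exact h1 j
      exact h3 rfl

/-- A closable form of this kind with a barrier has as closure a local quasi-regular Dirichlet
form. -/
theorem exists_closure [T2Space X] [SecondCountableTopology X] (hP : DiffusionCore m P Γ)
    (hw : Barrier m P Γ g w) (hcl : P.IsClosable m) :
    ∃ F : L2Form m, P.IsClosure F ∧ F.IsDirichlet ∧ F.IsLocal ∧ F.IsQuasiRegular := by
  obtain ⟨W, _, _, _, F, e, ι, hM⟩ := ClosureModel.exists_of_isClosable hP hcl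
  exact ⟨F, hM.isClosure, hM.isDirichlet (hw.denseRange_toLp hP), hM.isLocal,
    hw.isQuasiRegular hM⟩

end Barrier

end Barrier

/-! ### The spaces of absolutely continuous measures -/

section Spaces

variable {M : Type*} [MeasurableSpace M] {lam : Measure M} [SigmaFinite lam]

theorem AcMeasure.ext_meas {lam : Measure M} {μ ν : AcMeasure lam} (h : μ.meas = ν.meas) :
    μ = ν := by
  have hm : μ.toFinite = ν.toFinite := Subtype.ext h
  cases μ; cases ν; cases hm; rfl

theorem AcMeasure.dist_eq (μ ν : AcMeasure lam) :
    dist μ ν = ∫ x, |(μ.meas.rnDeriv lam x).toReal - (ν.meas.rnDeriv lam x).toReal| ∂lam := by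
  change dist (density lam μ.meas) (density lam ν.meas) = _
  rw [L1.dist_eq_integral_dist]
  refine integral_congr_ae ?_
  filter_upwards [MemLp.coeFn_toLp (memLp_one_iff_integrable.2
      (Measure.integrable_toReal_rnDeriv (μ := μ.meas) (ν := lam))),
    MemLp.coeFn_toLp (memLp_one_iff_integrable.2
      (Measure.integrable_toReal_rnDeriv (μ := ν.meas) (ν := lam)))] with x h1 h2
  rw [density, density, h1, h2, Real.dist_eq]

theorem AcMeasure.isometry_density : Isometry fun μ : AcMeasure lam => density lam μ.meas :=
  Isometry.of_dist_eq fun _ _ => rfl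

/-- Total variation controls the integrals of bounded functions. -/
theorem AcMeasure.abs_integral_sub_le (μ ν : AcMeasure lam) {f : M → ℝ} (hf : Measurable f)
    {C : ℝ} (hC : ∀ x, |f x| ≤ C) :
    |∫ x, f x ∂μ.meas - ∫ x, f x ∂ν.meas| ≤ C * dist μ ν := by
  have key : ∀ κ : AcMeasure lam, Integrable (fun x => (κ.meas.rnDeriv lam x).toReal * f x) lam :=
    fun κ => Measure.integrable_toReal_rnDeriv.mul_bdd (c := C) hf.aestronglyMeasurable
      (Eventually.of_forall hC)
  rw [← integral_rnDeriv_smul μ.ac, ← integral_rnDeriv_smul ν.ac]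
  simp only [smul_eq_mul]
  rw [← integral_sub (key μ) (key ν), AcMeasure.dist_eq, ← integral_const_mul]
  refine abs_integral_le_integral_abs.trans (integral_mono ((key μ).sub (key ν)).abs ?_ fun x => ?_)
  · exact ((Measure.integrable_toReal_rnDeriv.sub Measure.integrable_toReal_rnDeriv).abs.const_mul
      C)
  · dsimp only
    rw [← sub_mul, abs_mul, mul_comm]
    exact mul_le_mul_of_nonneg_right (hC x) (abs_nonneg _)

theorem AcMeasure.abs_real_sub_le (μ ν : AcMeasure lam) {s : Set M} (hs : MeasurableSet s) :
    |μ.meas.real s - ν.meas.real s| ≤ dist μ ν := by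
  have h := μ.abs_integral_sub_le ν (f := s.indicator 1) (measurable_one.indicator hs) (C := 1)
    fun x => by by_cases hx : x ∈ s <;> simp [hx]
  rwa [integral_indicator_one hs, integral_indicator_one hs, one_mul] at h

/-- Absolutely continuous probability measures among the finite ones. -/
def AcProb.toAcMeasure {lam : Measure M} (μ : AcProb lam) : AcMeasure lam :=
  ⟨μ.toProb.toFiniteMeasure, μ.ac⟩

theorem AcProb.isometry_toAcMeasure : Isometry (AcProb.toAcMeasure (lam := lam)) :=
  Isometry.of_dist_eq fun _ _ => rfl

theorem AcMeasure.measurable_meas : Measurable fun μ : AcMeasure lam => μ.meas := by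
  refine Measure.measurable_of_measurable_coe _ fun s hs => ?_
  have hc : Continuous fun μ : AcMeasure lam => μ.meas.real s :=
    (LipschitzWith.of_dist_le_mul (K := 1) fun μ ν => by
      simpa [Real.dist_eq] using μ.abs_real_sub_le ν hs).continuous
  have : (fun μ : AcMeasure lam => μ.meas s) = fun μ => ENNReal.ofReal (μ.meas.real s) := by
    funext μ
    rw [ofReal_measureReal]
  rw [this]
  exact hc.measurable.ennreal_ofReal

theorem AcProb.measurable_meas : Measurable fun μ : AcProb lam => μ.meas :=
  AcMeasure.measurable_meas.comp AcProb.isometry_toAcMeasure.continuous.measurable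

/-- An L¹ limit of densities is nonnegative almost everywhere, hence again a density. -/
instance : CompleteSpace (AcMeasure lam) := by
  refine Metric.complete_of_cauchySeq_tendsto fun μ hμ => ?_
  have hc : CauchySeq fun n => density lam (μ n).meas :=
    hμ.map AcMeasure.isometry_density.uniformContinuous
  obtain ⟨p, hp⟩ := cauchySeq_tendsto_of_complete hc
  have hnonneg : 0 ≤ p := by
    refine ge_of_tendsto' hp fun n => ?_
    rw [← Lp.coeFn_nonneg]
    filter_upwards [MemLp.coeFn_toLp (memLp_one_iff_integrable.2
      (Measure.integrable_toReal_rnDeriv (μ := (μ n).meas) (ν := lam)))] with x hx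
    rw [density, hx]
    exact ENNReal.toReal_nonneg
  rw [← Lp.coeFn_nonneg] at hnonneg
  have hpi : Integrable p lam := L1.integrable_coeFn p
  have hfin : IsFiniteMeasure (lam.withDensity fun x => ENNReal.ofReal (p x)) :=
    isFiniteMeasure_withDensity_ofReal hpi.2
  let ν : AcMeasure lam := ⟨⟨lam.withDensity fun x => ENNReal.ofReal (p x), hfin⟩,
    withDensity_absolutelyContinuous _ _⟩
  refine ⟨ν, ?_⟩
  rw [AcMeasure.isometry_density.isEmbedding.tendsto_nhds_iff]
  have hν : density lam ν.meas = p := by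
    refine Lp.ext ?_
    filter_upwards [MemLp.coeFn_toLp (memLp_one_iff_integrable.2
      (Measure.integrable_toReal_rnDeriv (μ := ν.meas) (ν := lam))), hnonneg,
      Measure.rnDeriv_withDensity₀ lam
        (Lp.aestronglyMeasurable p).aemeasurable.ennreal_ofReal] with x h1 h2 h3
    rw [density, h1]
    change ((lam.withDensity fun x => ENNReal.ofReal (p x)).rnDeriv lam x).toReal = p x
    rw [h3, ENNReal.toReal_ofReal h2]
  rw [hν]
  exact hp

/-- The range is the level set of total mass 1, and the mass is Lipschitz for total variation.
Compactness can thus be pulled back to probability measures. -/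
theorem AcProb.isClosedEmbedding_toAcMeasure :
    IsClosedEmbedding (AcProb.toAcMeasure (lam := lam)) := by
  refine ⟨AcProb.isometry_toAcMeasure.isEmbedding, ?_⟩
  have hr : Set.range (AcProb.toAcMeasure (lam := lam)) =
      (fun μ : AcMeasure lam => μ.meas.real Set.univ) ⁻¹' {1} := by
    ext μ
    constructor
    · rintro ⟨ν, rfl⟩
      change (ν.toProb : Measure M).real Set.univ = 1
      simp
    · intro h
      have h1 : μ.meas.real Set.univ = 1 := h
      have h2 : IsProbabilityMeasure μ.meas := ⟨by
        rw [← ofReal_measureReal, h1, ENNReal.ofReal_one]⟩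
      exact ⟨⟨⟨μ.meas, h2⟩, μ.ac⟩, AcMeasure.ext_meas rfl⟩
  rw [hr]
  refine isClosed_singleton.preimage ?_
  exact (LipschitzWith.of_dist_le_mul (K := 1) fun μ ν => by
    simpa [Real.dist_eq] using μ.abs_real_sub_le ν MeasurableSet.univ).continuous

section Kernel

/-- Parameter integrals against a measurable family of finite measures. -/
theorem measurable_integral_family {X : Type*} [MeasurableSpace X] {κ : X → Measure M}
    (hκ : Measurable κ) (hfin : ∀ x, IsFiniteMeasure (κ x)) {f : X × M → ℝ} (hf : Measurable f) :
    Measurable fun x => ∫ y, f (x, y) ∂κ x := by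
  have hmass : Measurable fun x => κ x Set.univ :=
    Measure.measurable_coe MeasurableSet.univ |>.comp hκ
  have hne : ∀ x, 1 + κ x Set.univ ≠ ∞ := fun x =>
    ENNReal.add_ne_top.2 ⟨ENNReal.one_ne_top, measure_ne_top _ _⟩
  -- The masses need not be bounded, so the family is divided by 1 plus its mass to obtain a finite
  -- kernel; the factor is restored afterwards.
  let K : ProbabilityTheory.Kernel X M :=
    ⟨fun x => (1 + κ x Set.univ)⁻¹ • κ x, by
      refine Measure.measurable_of_measurable_coe _ fun s hs => ?_
      simp only [Measure.smul_apply, smul_eq_mul]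
      exact (measurable_const.add hmass).inv.mul ((Measure.measurable_coe hs).comp hκ)⟩
  have hK : ProbabilityTheory.IsFiniteKernel K := ⟨1, ENNReal.one_lt_top, fun x => by
    change (1 + κ x Set.univ)⁻¹ * κ x Set.univ ≤ 1
    rw [mul_comm, ← div_eq_mul_inv]
    exact ENNReal.div_le_of_le_mul (by rw [one_mul]; exact le_add_self)⟩
  have h1 : Measurable fun x => ∫ y, f (x, y) ∂K x :=
    (StronglyMeasurable.integral_kernel_prod_right' (κ := K) hf.stronglyMeasurable).measurable
  have h2 : (fun x => ∫ y, f (x, y) ∂κ x) =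
      fun x => (1 + κ x Set.univ).toReal * ∫ y, f (x, y) ∂K x := by
    funext x
    change _ = _ * ∫ y, f (x, y) ∂((1 + κ x Set.univ)⁻¹ • κ x)
    rw [integral_smul_measure, smul_eq_mul, ENNReal.toReal_inv, ← mul_assoc, mul_inv_cancel₀,
      one_mul]
    exact (ENNReal.toReal_pos (by simp) (hne x)).ne'
  rw [h2]
  exact (measurable_const.add hmass).ennreal_toReal.mul h1

end Kernel

variable [TopologicalSpace M] [BorelSpace M]

theorem AcMeasure.continuous_toFinite :
    Continuous fun μ : AcMeasure lam => μ.toFinite := by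
  refine continuous_iff_continuousAt.2 fun μ => ?_
  rw [ContinuousAt, FiniteMeasure.tendsto_iff_forall_integral_tendsto]
  intro f
  rw [tendsto_iff_dist_tendsto_zero]
  have h : Tendsto (fun ν : AcMeasure lam => ‖f‖ * dist ν μ) (𝓝 μ) (𝓝 0) := by
    have := (tendsto_iff_dist_tendsto_zero.1 (tendsto_id (x := 𝓝 μ))).const_mul ‖f‖
    simpa using this
  refine squeeze_zero (fun _ => dist_nonneg) (fun ν => ?_) h
  rw [Real.dist_eq]
  exact ν.abs_integral_sub_le μ f.continuous.measurable fun x => f.norm_coe_le_norm x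

theorem AcProb.continuous_toProb : Continuous fun μ : AcProb lam => μ.toProb := by
  rw [(ProbabilityMeasure.toFiniteMeasure_isEmbedding M).continuous_iff]
  exact AcMeasure.continuous_toFinite.comp AcProb.isometry_toAcMeasure.continuous

variable [PolishSpace M]

instance : SecondCountableTopology (AcMeasure lam) := by
  have : Fact ((1 : ℝ≥0∞) ≠ ⊤) := ⟨ENNReal.one_ne_top⟩
  exact AcMeasure.isometry_density.isEmbedding.isInducing.secondCountableTopology

instance : SecondCountableTopology (AcProb lam) :=
  AcProb.isometry_toAcMeasure.isEmbedding.isInducing.secondCountableTopology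

end Spaces

/-! ### Continuity of the maps from `L²(lam)` -/

section Maps

variable {M : Type*} [MeasurableSpace M] {lam : Measure M}

theorem sqMeasure_real_univ (h : Lp ℝ 2 lam) : (sqMeasure h).real Set.univ = ‖h‖ ^ 2 := by
  rw [Measure.real, sqMeasure_univ, ENNReal.toReal_ofReal (by positivity)]

theorem measurable_ofReal_sq (h : Lp ℝ 2 lam) :
    AEMeasurable (fun x => ENNReal.ofReal (h x ^ 2)) lam :=
  ((Lp.aestronglyMeasurable h).aemeasurable.pow_const 2).ennreal_ofReal

theorem integral_sqMeasure (h : Lp ℝ 2 lam) (f : M → ℝ) :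
    ∫ x, f x ∂sqMeasure h = ∫ x, h x ^ 2 * f x ∂lam := by
  rw [sqMeasure, integral_withDensity_eq_integral_toReal_smul₀ (measurable_ofReal_sq h)
    (Eventually.of_forall fun x => ENNReal.ofReal_lt_top)]
  refine integral_congr_ae (Eventually.of_forall fun x => ?_)
  simp only [smul_eq_mul]
  rw [ENNReal.toReal_ofReal (sq_nonneg _)]

theorem sqMeasure_smul (c : ℝ) (h : Lp ℝ 2 lam) :
    sqMeasure (c • h) = ENNReal.ofReal (c ^ 2) • sqMeasure h := by
  rw [sqMeasure, sqMeasure, ← withDensity_smul' _ _ ENNReal.ofReal_ne_top]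
  refine withDensity_congr_ae ?_
  filter_upwards [Lp.coeFn_smul c h] with x hx
  rw [hx, Pi.smul_apply, Pi.smul_apply, smul_eq_mul, smul_eq_mul, mul_pow,
    ENNReal.ofReal_mul (sq_nonneg c)]

/-- `psiP` is `psiM` after normalisation of h, so its continuity is inherited. -/
theorem toAcMeasure_psiP (h : {h : Lp ℝ 2 lam // h ≠ 0}) :
    (psiP h).toAcMeasure = psiM (‖h.1‖⁻¹ • h.1) := by
  refine AcMeasure.ext_meas ?_
  change (sqMeasure h.1 Set.univ)⁻¹ • sqMeasure h.1 = sqMeasure (‖h.1‖⁻¹ • h.1)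
  have h0 : 0 < ‖h.1‖ := norm_pos_iff.2 h.2
  rw [sqMeasure_smul, sqMeasure_univ, inv_pow, ENNReal.ofReal_inv_of_pos (by positivity)]

theorem map_restrictNonzero [MeasurableSpace (Lp ℝ 2 lam)] [BorelSpace (Lp ℝ 2 lam)]
    (L0 : Measure (Lp ℝ 2 lam)) (hL0 : L0 {0} = 0) :
    (restrictNonzero L0).map Subtype.val = L0 := by
  have hs : MeasurableSet {h : Lp ℝ 2 lam | h ≠ 0} := (measurableSet_singleton 0).compl
  rw [restrictNonzero, show (Subtype.val : {h : Lp ℝ 2 lam // h ≠ 0} → Lp ℝ 2 lam) =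
    ((↑) : {h : Lp ℝ 2 lam | h ≠ 0} → Lp ℝ 2 lam) from rfl, map_comap_subtype_coe hs]
  refine Measure.restrict_eq_self_of_ae_mem ?_
  rw [ae_iff]
  simpa using hL0

theorem isProbabilityMeasure_restrictNonzero [MeasurableSpace (Lp ℝ 2 lam)]
    [BorelSpace (Lp ℝ 2 lam)] (L0 : Measure (Lp ℝ 2 lam)) [IsProbabilityMeasure L0]
    (hL0 : L0 {0} = 0) :
    IsProbabilityMeasure (restrictNonzero L0) := by
  refine ⟨?_⟩
  have h := congrArg (fun μ => μ Set.univ) (map_restrictNonzero L0 hL0)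
  rw [Measure.map_apply measurable_subtype_coe MeasurableSet.univ] at h
  simpa using h

variable [SigmaFinite lam]

theorem rnDeriv_psiM (h : Lp ℝ 2 lam) :
    ∀ᵐ x ∂lam, ((psiM h).meas.rnDeriv lam x).toReal = h x ^ 2 := by
  filter_upwards [Measure.rnDeriv_withDensity₀ lam (measurable_ofReal_sq h)] with x hx
  change ((lam.withDensity fun x => ENNReal.ofReal (h x ^ 2)).rnDeriv lam x).toReal = _
  rw [hx, ENNReal.toReal_ofReal (sq_nonneg _)]

/-- |h² - k²| = |h+k| |h-k|, followed by Cauchy–Schwarz. -/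
theorem dist_psiM_le (h k : Lp ℝ 2 lam) : dist (psiM h) (psiM k) ≤ ‖h + k‖ * ‖h - k‖ := by
  rw [AcMeasure.dist_eq]
  have h1 : ∫ x, |((psiM h).meas.rnDeriv lam x).toReal - ((psiM k).meas.rnDeriv lam x).toReal| ∂lam
      = inner ℝ |h + k| |h - k| := by
    rw [L2.inner_def]
    refine integral_congr_ae ?_
    filter_upwards [rnDeriv_psiM h, rnDeriv_psiM k, Lp.coeFn_abs (h + k), Lp.coeFn_abs (h - k),
      Lp.coeFn_add h k, Lp.coeFn_sub h k] with x h1 h2 h3 h4 h5 h6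
    rw [h1, h2, h3, h4, h5, h6, Pi.add_apply, Pi.sub_apply, sq_sub_sq, abs_mul]
    simp [mul_comm]
  rw [h1]
  refine (real_inner_le_norm _ _).trans ?_
  rw [norm_abs_eq_norm, norm_abs_eq_norm]

theorem continuous_psiM : Continuous (psiM (lam := lam)) := by
  refine continuous_iff_continuousAt.2 fun h => ?_
  rw [ContinuousAt, tendsto_iff_dist_tendsto_zero]
  refine squeeze_zero (fun _ => dist_nonneg) (fun k => dist_psiM_le k h) ?_
  have : Continuous fun k : Lp ℝ 2 lam => ‖k + h‖ * ‖k - h‖ := by fun_prop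
  simpa using this.tendsto h

theorem continuous_psiP : Continuous (psiP (lam := lam)) := by
  rw [AcProb.isometry_toAcMeasure.isEmbedding.continuous_iff]
  have : AcProb.toAcMeasure ∘ psiP = fun h : {h : Lp ℝ 2 lam // h ≠ 0} =>
      psiM (‖h.1‖⁻¹ • h.1) := funext toAcMeasure_psiP
  rw [this]
  have h1 : Continuous fun h : {h : Lp ℝ 2 lam // h ≠ 0} => ‖h.1‖⁻¹ :=
    continuous_subtype_val.norm.inv₀ fun h => norm_ne_zero_iff.2 h.2
  exact continuous_psiM.comp (h1.smul continuous_subtype_val)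

variable [MeasurableSpace (Lp ℝ 2 lam)] [BorelSpace (Lp ℝ 2 lam)] (L0 : Measure (Lp ℝ 2 lam))

instance [IsProbabilityMeasure L0] : IsProbabilityMeasure (lawM L0) :=
  Measure.isProbabilityMeasure_map continuous_psiM.measurable.aemeasurable

theorem isProbabilityMeasure_lawP [IsProbabilityMeasure L0] (hL0 : L0 {0} = 0) :
    IsProbabilityMeasure (lawP L0) := by
  have := isProbabilityMeasure_restrictNonzero L0 hL0
  exact Measure.isProbabilityMeasure_map continuous_psiP.measurable.aemeasurable

end Maps

/-! ### Countably many test functions for the total variation distance -/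

section TestFunctions

variable {M : Type*} [TopologicalSpace M] [PolishSpace M] [MeasurableSpace M] [BorelSpace M]

/-- Countably many continuous functions with values in `[0, 1]` approximate all indicator
functions in `L¹` of every finite measure. -/
theorem exists_test_functions : ∃ f : ℕ → M →ᵇ ℝ, (∀ j x, 0 ≤ f j x) ∧ (∀ j x, f j x ≤ 1) ∧
    (∃ j, ∀ x, f j x = 1) ∧ ∀ (κ : Measure M) [IsFiniteMeasure κ] (s : Set M),
      MeasurableSet s → ∀ ε > 0, ∃ j, ∫ x, |f j x - s.indicator 1 x| ∂κ ≤ ε := by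
  let _ := TopologicalSpace.upgradeIsCompletelyMetrizable M
  obtain ⟨b, hbc, -, hb⟩ := TopologicalSpace.exists_countable_basis M
  have := hbc.to_subtype
  obtain ⟨enum, henum⟩ := exists_surjective_nat (Finset b × ℕ)
  have hδ : ∀ n : ℕ, 0 < 1 / ((n : ℝ) + 1) := fun n => by positivity
  -- Complements of finite unions of basic open sets form a countable family of closed sets that
  -- approximates each closed set from outside in finite measure. Thickened indicators then
  -- approximate these sets from outside.
  let C : Finset b → Set M := fun s => (⋃ U ∈ s, (U : Set M))ᶜ
  have hCclosed : ∀ s, IsClosed (C s) := fun s =>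
    (isOpen_biUnion fun U _ => hb.isOpen U.2).isClosed_compl
  let F : Finset b × ℕ → M →ᵇ ℝ≥0 := fun p => thickenedIndicator (hδ p.2) (C p.1)
  have hF1 : ∀ p x, F p x ≤ 1 := fun p x => thickenedIndicator_le_one _ _ _
  let f : ℕ → M →ᵇ ℝ := fun j => BoundedContinuousFunction.ofNormedAddCommGroup
    (fun x => (F (enum j) x : ℝ)) (NNReal.continuous_coe.comp (F (enum j)).continuous) 1
    (fun x => by rw [Real.norm_eq_abs, abs_of_nonneg (NNReal.coe_nonneg _)]; exact_mod_cast hF1 _ x)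
  have hf : ∀ p, ∃ j, ∀ x, f j x = F p x := fun p => by
    obtain ⟨j, rfl⟩ := henum p
    exact ⟨j, fun x => rfl⟩
  refine ⟨f, fun j x => NNReal.coe_nonneg _, fun j x => by exact_mod_cast hF1 _ x, ?_, ?_⟩
  -- The empty union has complement the whole space, whose thickened indicator is 1.
  · obtain ⟨j, hj⟩ := hf (∅, 0)
    refine ⟨j, fun x => ?_⟩
    rw [hj]
    have : F (∅, 0) x = 1 := thickenedIndicator_one _ _ (by simp [C])
    rw [this, NNReal.coe_one]
  · intro κ _ s hs ε hε
    have hε3 : ENNReal.ofReal (ε / 3) ≠ 0 := by simpa using hε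
    obtain ⟨K, hKs, hK, hKκ⟩ := hs.exists_isClosed_sdiff_lt (measure_ne_top κ s) hε3
    -- finitely many basic open sets in the complement of `K`
    have hKc : ∃ t : Finset b, (∀ U ∈ t, (U : Set M) ⊆ Kᶜ) ∧
        κ (C t \ K) < ENNReal.ofReal (ε / 3) := by
      obtain ⟨g, hg⟩ := exists_surjective_nat (Option b)
      classical
      let T : ℕ → Finset b := fun n =>
        ((Finset.range n).biUnion fun i => (g i).toFinset).filter fun U => (U : Set M) ⊆ Kᶜ
      have hTmono : ∀ {n k}, n ≤ k → T n ⊆ T k := fun h =>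
        Finset.filter_subset_filter _ (Finset.biUnion_subset_biUnion_of_subset_left _
          (Finset.range_mono h))
      have hanti : Antitone fun n => C (T n) \ K := fun n k h =>
        Set.sdiff_subset_sdiff_left (Set.compl_subset_compl.2
          (Set.biUnion_subset_biUnion_left fun U hU => hTmono h hU))
      have hlim := tendsto_measure_iInter_atTop (μ := κ) (s := fun n => C (T n) \ K)
        (fun n => ((hCclosed _).measurableSet.diff hK.measurableSet).nullMeasurableSet) hanti
        ⟨0, measure_ne_top _ _⟩
      have hempty : ⋂ n, C (T n) \ K = ∅ := by
        refine Set.eq_empty_of_forall_notMem fun x hx => ?_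
        rw [Set.mem_iInter] at hx
        obtain ⟨U, hU, hxU, hUK⟩ := hb.exists_subset_of_mem_open (hx 0).2 hK.isOpen_compl
        obtain ⟨i, hi⟩ := hg (some ⟨U, hU⟩)
        refine (hx (i + 1)).1 (Set.mem_biUnion (x := (⟨U, hU⟩ : b)) ?_ hxU)
        simp only [T, Finset.coe_filter, Finset.mem_biUnion, Finset.mem_range, Option.mem_toFinset]
        exact ⟨⟨i, by omega, by rw [hi]; rfl⟩, hUK⟩
      rw [hempty, measure_empty] at hlim
      obtain ⟨n, hn⟩ := (hlim.eventually (gt_mem_nhds (pos_iff_ne_zero.2 hε3))).exists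
      exact ⟨T n, fun U hU => (Finset.mem_filter.1 hU).2, hn⟩
    obtain ⟨t, htK, htκ⟩ := hKc
    have hKt : K ⊆ C t := fun x hx hxt => by
      obtain ⟨U, hU, hxU⟩ := Set.mem_iUnion₂.1 hxt
      exact htK U hU hxU hx
    have hbd : ∀ n x, ‖|(F (t, n) x : ℝ) - (C t).indicator 1 x|‖ ≤ 1 := by
      intro n x
      have h0 : (0 : ℝ) ≤ F (t, n) x := NNReal.coe_nonneg _
      have h1 : (F (t, n) x : ℝ) ≤ 1 := by exact_mod_cast hF1 _ x
      rw [Real.norm_eq_abs, abs_abs, abs_le]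
      by_cases hx : x ∈ C t
      · rw [Set.indicator_of_mem hx, Pi.one_apply]
        constructor <;> linarith
      · rw [Set.indicator_of_notMem hx]
        constructor <;> linarith
    have hmeasF : ∀ n, AEStronglyMeasurable
        (fun x => |(F (t, n) x : ℝ) - (C t).indicator 1 x|) κ := fun n =>
      ((NNReal.continuous_coe.comp (F (t, n)).continuous).measurable.sub
        (measurable_one.indicator (hCclosed t).measurableSet)).abs.aestronglyMeasurable
    have hlim : Tendsto (fun n => ∫ x, |(F (t, n) x : ℝ) - (C t).indicator 1 x| ∂κ) atTop
        (𝓝 (∫ _, (0 : ℝ) ∂κ)) := by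
      have hpt := thickenedIndicator_tendsto_indicator_closure hδ
        tendsto_one_div_add_atTop_nhds_zero_nat (C t)
      rw [tendsto_pi_nhds, (hCclosed t).closure_eq] at hpt
      refine tendsto_integral_of_dominated_convergence (fun _ => 1) (fun n => ?_)
        (integrable_const _) (fun n => Eventually.of_forall fun x => ?_)
        (Eventually.of_forall fun x => ?_)
      · exact hmeasF n
      · exact hbd n x
      · have h2 : Tendsto (fun n => (F (t, n) x : ℝ)) atTop (𝓝 ((C t).indicator 1 x)) := by
          have h3 := (NNReal.continuous_coe.tendsto _).comp (hpt x)
          have h4 : (((C t).indicator (fun _ => (1 : ℝ≥0)) x : ℝ≥0) : ℝ) =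
              (C t).indicator 1 x := by
            by_cases hx : x ∈ C t <;> simp [hx]
          rw [h4] at h3
          exact h3
        have h5 := (h2.sub_const ((C t).indicator 1 x)).abs
        simpa using h5
    rw [integral_zero] at hlim
    obtain ⟨n, hn⟩ := (hlim.eventually (gt_mem_nhds (show (0 : ℝ) < ε / 3 by positivity))).exists
    obtain ⟨j, hj⟩ := hf (t, n)
    refine ⟨j, ?_⟩
    simp only [hj]
    have hreal : ∀ {B : Set M}, κ B < ENNReal.ofReal (ε / 3) → κ.real B ≤ ε / 3 := fun {B} h => by
      rw [Measure.real]
      exact ENNReal.toReal_le_of_le_ofReal (by positivity) h.le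
    have i1 : Integrable (fun x => |(F (t, n) x : ℝ) - (C t).indicator 1 x|) κ := by
      refine Integrable.of_bound (C := 1) ?_ (Eventually.of_forall fun x => ?_)
      · exact hmeasF n
      · exact hbd n x
    have hm1 := (hCclosed t).measurableSet.diff hK.measurableSet
    have hm2 := hs.diff hK.measurableSet
    have i2 : Integrable ((C t \ K).indicator (1 : M → ℝ)) κ :=
      (integrable_const (1 : ℝ)).indicator hm1
    have i3 : Integrable ((s \ K).indicator (1 : M → ℝ)) κ :=
      (integrable_const (1 : ℝ)).indicator hm2
    -- The three errors of ε/3 are thickening of `C t`, outer approximation of `K` by `C t`, and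
    -- inner approximation of `s` by `K`.
    calc ∫ x, |(F (t, n) x : ℝ) - s.indicator 1 x| ∂κ
        ≤ ∫ x, (|(F (t, n) x : ℝ) - (C t).indicator 1 x| + (C t \ K).indicator 1 x +
            (s \ K).indicator 1 x) ∂κ := by
          refine integral_mono_of_nonneg (Eventually.of_forall fun x => abs_nonneg _)
            ((i1.add i2).add i3) (Eventually.of_forall fun x => ?_)
          have h1 : |(C t).indicator (1 : M → ℝ) x - s.indicator 1 x| ≤
              (C t \ K).indicator 1 x + (s \ K).indicator 1 x := by
            by_cases hxK : x ∈ K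
            · simp [hKt hxK, hKs hxK, hxK]
            · by_cases hxC : x ∈ C t <;> by_cases hxs : x ∈ s <;> simp [hxC, hxs, hxK]
          have h2 := abs_sub_le (F (t, n) x : ℝ) ((C t).indicator 1 x) (s.indicator 1 x)
          dsimp only
          linarith
      _ = (∫ x, |(F (t, n) x : ℝ) - (C t).indicator 1 x| ∂κ) + κ.real (C t \ K) +
            κ.real (s \ K) := by
          have hsum := integral_add (i1.add i2) i3
          simp only [Pi.add_apply] at hsum
          rw [hsum, integral_add i1 i2, integral_indicator_one hm1, integral_indicator_one hm2]
      _ ≤ ε := by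
          have := hreal htκ
          have := hreal hKκ
          linarith

/-- A fixed sequence of test functions. -/
def testFun (M : Type*) [TopologicalSpace M] [PolishSpace M] [MeasurableSpace M] [BorelSpace M] :
    ℕ → M →ᵇ ℝ := exists_test_functions.choose

theorem testFun_nonneg (j : ℕ) (x : M) : 0 ≤ testFun M j x :=
  exists_test_functions.choose_spec.1 j x

theorem testFun_le_one (j : ℕ) (x : M) : testFun M j x ≤ 1 :=
  exists_test_functions.choose_spec.2.1 j x

theorem exists_testFun_eq_one : ∃ j, ∀ x, testFun M j x = 1 :=
  exists_test_functions.choose_spec.2.2.1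

theorem exists_integral_testFun_le (κ : Measure M) [IsFiniteMeasure κ] {s : Set M}
    (hs : MeasurableSet s) {ε : ℝ} (hε : 0 < ε) :
    ∃ j, ∫ x, |testFun M j x - s.indicator 1 x| ∂κ ≤ ε :=
  exists_test_functions.choose_spec.2.2.2 κ s hs ε hε

/-- One test function is chosen close to the indicator in L¹(μ + ν), so that it serves both measures
at once. -/
theorem abs_real_sub_le_of_testFun {μ ν : Measure M} [IsFiniteMeasure μ] [IsFiniteMeasure ν]
    {r : ℝ} (h : ∀ j, |∫ x, testFun M j x ∂μ - ∫ x, testFun M j x ∂ν| ≤ r) {s : Set M}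
    (hs : MeasurableSet s) : |μ.real s - ν.real s| ≤ r := by
  refine le_of_forall_pos_le_add fun ε hε => ?_
  obtain ⟨j, hj⟩ := exists_integral_testFun_le (μ + ν) hs hε
  have i0 : ∀ κ : Measure M, IsFiniteMeasure κ → Integrable (testFun M j) κ := fun κ _ =>
    (testFun M j).integrable κ
  have i1 : ∀ κ : Measure M, IsFiniteMeasure κ → Integrable (s.indicator (1 : M → ℝ)) κ :=
    fun κ _ => (integrable_const (1 : ℝ)).indicator hs
  have i2 : ∀ κ : Measure M, IsFiniteMeasure κ →
      Integrable (fun x => |testFun M j x - s.indicator 1 x|) κ :=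
    fun κ hκ => ((i0 κ hκ).sub (i1 κ hκ)).abs
  rw [integral_add_measure (i2 μ inferInstance) (i2 ν inferInstance)] at hj
  have key : ∀ κ : Measure M, IsFiniteMeasure κ →
      |∫ x, testFun M j x ∂κ - κ.real s| ≤ ∫ x, |testFun M j x - s.indicator 1 x| ∂κ := by
    intro κ hκ
    rw [← integral_indicator_one hs, ← integral_sub (i0 κ hκ) (i1 κ hκ)]
    exact abs_integral_le_integral_abs
  have k1 := abs_le.1 (key μ inferInstance)
  have k2 := abs_le.1 (key ν inferInstance)
  have k3 := abs_le.1 (h j)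
  rw [abs_le]
  constructor <;> linarith [k1.1, k1.2, k2.1, k2.2, k3.1, k3.2]

variable {lam : Measure M} [SigmaFinite lam]

/-- Splitting the L¹ distance of the densities p, q over {q < p} and its complement gives two
differences of masses, hence the factor 2. -/
theorem AcMeasure.dist_le_of_testFun {μ ν : AcMeasure lam} {r : ℝ}
    (h : ∀ j, |∫ x, testFun M j x ∂μ.meas - ∫ x, testFun M j x ∂ν.meas| ≤ r) :
    dist μ ν ≤ 2 * r := by
  set p : M → ℝ := fun x => (μ.meas.rnDeriv lam x).toReal with hp
  set q : M → ℝ := fun x => (ν.meas.rnDeriv lam x).toReal with hq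
  have ip : Integrable p lam := Measure.integrable_toReal_rnDeriv
  have iq : Integrable q lam := Measure.integrable_toReal_rnDeriv
  have hs : MeasurableSet {x | q x < p x} :=
    measurableSet_lt (Measure.measurable_rnDeriv _ _).ennreal_toReal
      (Measure.measurable_rnDeriv _ _).ennreal_toReal
  set s := {x | q x < p x}
  have hsplit := integral_add_compl hs (ip.sub iq).abs
  simp only [Pi.sub_apply] at hsplit
  rw [AcMeasure.dist_eq]
  change ∫ x, |p x - q x| ∂lam ≤ 2 * r
  rw [← hsplit]
  have e1 : ∫ x in s, |p x - q x| ∂lam = μ.meas.real s - ν.meas.real s := by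
    rw [← Measure.setIntegral_toReal_rnDeriv μ.ac, ← Measure.setIntegral_toReal_rnDeriv ν.ac,
      ← integral_sub ip.integrableOn iq.integrableOn]
    exact setIntegral_congr_fun hs fun x (hx : q x < p x) => abs_of_pos (sub_pos.2 hx)
  have e2 : ∫ x in sᶜ, |p x - q x| ∂lam = -(μ.meas.real sᶜ - ν.meas.real sᶜ) := by
    rw [← Measure.setIntegral_toReal_rnDeriv μ.ac, ← Measure.setIntegral_toReal_rnDeriv ν.ac,
      ← integral_sub ip.integrableOn iq.integrableOn, ← integral_neg]
    refine setIntegral_congr_fun hs.compl fun x (hx : ¬ q x < p x) => ?_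
    exact abs_of_nonpos (sub_nonpos.2 (not_lt.1 hx))
  have b1 := abs_le.1 (abs_real_sub_le_of_testFun h hs)
  have b2 := abs_le.1 (abs_real_sub_le_of_testFun h hs.compl)
  rw [e1, e2]
  linarith [b1.1, b1.2, b2.1, b2.2]

end TestFunctions

/-! ### Bump functions of Hellinger type -/

section Bump

/-- A bounded smooth function of `√(1 + a) - c`, vanishing only where `√(1 + a) = c`. -/
def bump (c a : ℝ) : ℝ := (√(1 + a) - c) ^ 2 / (1 + (√(1 + a) - c) ^ 2)

/-- The derivative of `bump c`. -/
def bumpDeriv (c a : ℝ) : ℝ :=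
  2 * (√(1 + a) - c) / (1 + (√(1 + a) - c) ^ 2) ^ 2 * (1 / (2 * √(1 + a)))

theorem bump_nonneg (c a : ℝ) : 0 ≤ bump c a := by unfold bump; positivity

theorem bump_le_one (c a : ℝ) : bump c a ≤ 1 :=
  div_le_one_of_le₀ (by linarith) (by positivity)

theorem continuous_bump (c : ℝ) : Continuous (bump c) := by
  unfold bump
  exact Continuous.div (by fun_prop) (by fun_prop) fun a => by positivity

theorem hasDerivAt_bump (c : ℝ) {a : ℝ} (ha : 0 ≤ a) : HasDerivAt (bump c) (bumpDeriv c a) a := by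
  have h1 : HasDerivAt (fun a : ℝ => √(1 + a)) (1 / (2 * √(1 + a))) a := by
    simpa using ((hasDerivAt_id a).const_add 1).sqrt (by simp; positivity)
  have h2 : HasDerivAt (fun a : ℝ => (√(1 + a) - c) ^ 2)
      (2 * (√(1 + a) - c) * (1 / (2 * √(1 + a)))) a := by
    simpa using (h1.sub_const c).fun_pow 2
  have h3 := h2.div (h2.const_add 1) (by positivity : 1 + (√(1 + a) - c) ^ 2 ≠ 0)
  refine h3.congr_deriv ?_
  unfold bumpDeriv
  have h4 : 1 + (√(1 + a) - c) ^ 2 ≠ 0 := by positivity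
  field_simp
  ring

/-- The decay in `a` is the purpose of the square root: for 0 ≤ f ≤ 1 the L²(μ) norm of f is at most
√μ(f), so the derivative of the bump stays bounded in L²(μ) although the mass of μ is unbounded. -/
theorem abs_bumpDeriv_le (c : ℝ) {a : ℝ} (ha : 0 ≤ a) : |bumpDeriv c a| ≤ 1 / (2 * √(1 + a)) := by
  have hs : 0 < √(1 + a) := Real.sqrt_pos.2 (by linarith)
  unfold bumpDeriv
  rw [abs_mul, abs_of_pos (by positivity : 0 < 1 / (2 * √(1 + a)))]
  refine mul_le_of_le_one_left (by positivity) ?_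
  set r := √(1 + a) - c
  rw [abs_div, abs_of_pos (by positivity : 0 < (1 + r ^ 2) ^ 2), div_le_one (by positivity), abs_le]
  constructor <;> nlinarith [sq_nonneg (r - 1), sq_nonneg (r + 1), sq_nonneg (r ^ 2)]

theorem continuousOn_bumpDeriv (c : ℝ) : ContinuousOn (bumpDeriv c) (Set.Ici 0) := by
  unfold bumpDeriv
  refine ContinuousOn.mul (Continuous.continuousOn ?_) (ContinuousOn.div (by fun_prop)
    (by fun_prop) fun a ha => ?_)
  · exact Continuous.div (by fun_prop) (by fun_prop) fun a => by positivity
  · have : 0 < √(1 + a) := Real.sqrt_pos.2 (by linarith [Set.mem_Ici.1 ha])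
    positivity

/-- (√A - √B)² ≤ |√A - √B| (√A + √B) = |A - B|. -/
theorem bump_sqrt_le {a b : ℝ} (ha : 0 ≤ a) (hb : 0 ≤ b) : bump (√(1 + b)) a ≤ |a - b| := by
  have h1 : bump (√(1 + b)) a ≤ (√(1 + a) - √(1 + b)) ^ 2 :=
    div_le_self (sq_nonneg _) (by linarith [sq_nonneg (√(1 + a) - √(1 + b))])
  refine h1.trans ?_
  have ea := Real.sq_sqrt (by linarith : 0 ≤ 1 + a)
  have eb := Real.sq_sqrt (by linarith : 0 ≤ 1 + b)
  have e : a - b = (√(1 + a) - √(1 + b)) * (√(1 + a) + √(1 + b)) := by ring_nf; linarith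
  rw [e, abs_mul, abs_of_nonneg (by positivity : 0 ≤ √(1 + a) + √(1 + b)), ← sq_abs, sq]
  refine mul_le_mul_of_nonneg_left ?_ (abs_nonneg _)
  rw [abs_le]
  constructor <;> linarith [Real.sqrt_nonneg (1 + a), Real.sqrt_nonneg (1 + b)]

/-- r²/(1 + r²) ≤ 1/(i+1) is equivalent to i r² ≤ 1, which explains both the height 1/(i+1) and the
radius 1/√i. -/
theorem abs_sqrt_sub_le_of_bump_le {a c : ℝ} {i : ℕ} (hi : 1 ≤ i)
    (h : bump c a ≤ 1 / ((i : ℝ) + 1)) : |√(1 + a) - c| ≤ 1 / √i := by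
  have hi' : (0 : ℝ) < i := by exact_mod_cast hi
  unfold bump at h
  rw [div_le_div_iff₀ (by positivity) (by positivity)] at h
  have h1 : (√(1 + a) - c) ^ 2 ≤ 1 / i := by
    rw [le_div_iff₀ hi']
    linarith
  calc |√(1 + a) - c| ≤ √(1 / i) := Real.abs_le_sqrt h1
    _ = 1 / √i := by rw [Real.sqrt_div zero_le_one, Real.sqrt_one]

end Bump

/-! ### Total variation neighbourhoods and compact sets described by bump functions. -/

section Geometry

variable {M : Type*} [TopologicalSpace M] [PolishSpace M] [MeasurableSpace M] [BorelSpace M]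
  {lam : Measure M}

theorem integral_testFun_nonneg (μ : Measure M) (j : ℕ) : 0 ≤ ∫ x, testFun M j x ∂μ :=
  integral_nonneg fun x => testFun_nonneg j x

theorem integral_testFun_le (μ : Measure M) [IsFiniteMeasure μ] (j : ℕ) :
    ∫ x, testFun M j x ∂μ ≤ μ.real Set.univ := by
  calc ∫ x, testFun M j x ∂μ ≤ ∫ _, (1 : ℝ) ∂μ :=
        integral_mono ((testFun M j).integrable μ) (integrable_const _) fun x => testFun_le_one j x
    _ = μ.real Set.univ := by simp

/-- The joint sublevel sets of the bump functions centred at `ν`. -/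
def NearBy (i : ℕ) (ν μ : AcMeasure lam) : Prop :=
  ∀ j, bump (√(1 + ∫ x, testFun M j x ∂ν.meas)) (∫ x, testFun M j x ∂μ.meas) ≤ 1 / ((i : ℝ) + 1)

/-- The constant test function controls the total mass. This allows the factor √(1 + mass) in later
bounds to refer to either of the two measures. -/
theorem NearBy.abs_sqrt_mass_sub_le {i : ℕ} (hi : 1 ≤ i) {ν μ : AcMeasure lam}
    (h : NearBy i ν μ) :
    |√(1 + μ.meas.real Set.univ) - √(1 + ν.meas.real Set.univ)| ≤ 1 / √i := by
  obtain ⟨j, hj⟩ := exists_testFun_eq_one (M := M)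
  have h1 := abs_sqrt_sub_le_of_bump_le hi (h j)
  have e : ∀ κ : AcMeasure lam, ∫ x, testFun M j x ∂κ.meas = κ.meas.real Set.univ := fun κ => by
    simp [hj]
  rwa [e, e] at h1

variable [SigmaFinite lam]

/-- From |a - b| = |√(1+a) - √(1+b)| (√(1+a) + √(1+b)) for every test integral, with the masses
bounding the second factor. -/
theorem NearBy.dist_le_add {i : ℕ} (hi : 1 ≤ i) {ν μ : AcMeasure lam} (h : NearBy i ν μ) :
    dist μ ν ≤ 2 * (1 / √i * (√(1 + μ.meas.real Set.univ) + √(1 + ν.meas.real Set.univ))) := by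
  refine AcMeasure.dist_le_of_testFun fun j => ?_
  have h1 := abs_sqrt_sub_le_of_bump_le hi (h j)
  have a0 := integral_testFun_nonneg μ.meas j
  have b0 := integral_testFun_nonneg ν.meas j
  have a1 := integral_testFun_le μ.meas j
  have b1 := integral_testFun_le ν.meas j
  set a := ∫ x, testFun M j x ∂μ.meas
  set b := ∫ x, testFun M j x ∂ν.meas
  have ea := Real.sq_sqrt (by linarith : 0 ≤ 1 + a)
  have eb := Real.sq_sqrt (by linarith : 0 ≤ 1 + b)
  have e : a - b = (√(1 + a) - √(1 + b)) * (√(1 + a) + √(1 + b)) := by ring_nf; linarith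
  rw [e, abs_mul, abs_of_nonneg (by positivity : 0 ≤ √(1 + a) + √(1 + b))]
  gcongr

theorem one_div_sqrt_le_one {i : ℕ} (hi : 1 ≤ i) : 1 / √(i : ℝ) ≤ 1 := by
  have : 1 ≤ √(i : ℝ) := Real.one_le_sqrt.2 (by exact_mod_cast hi)
  exact div_le_one_of_le₀ this (by positivity)

theorem NearBy.dist_le_center {i : ℕ} (hi : 1 ≤ i) {ν μ : AcMeasure lam} (h : NearBy i ν μ) :
    dist μ ν ≤ 2 * (1 / √i * (2 * √(1 + ν.meas.real Set.univ) + 1)) := by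
  refine (h.dist_le_add hi).trans ?_
  have h1 := abs_le.1 ((h.abs_sqrt_mass_sub_le hi).trans (one_div_sqrt_le_one hi))
  have h2 : √(1 + μ.meas.real Set.univ) + √(1 + ν.meas.real Set.univ) ≤
      2 * √(1 + ν.meas.real Set.univ) + 1 := by linarith [h1.2]
  exact mul_le_mul_of_nonneg_left (mul_le_mul_of_nonneg_left h2 (by positivity)) zero_le_two

theorem NearBy.dist_le_point {i : ℕ} (hi : 1 ≤ i) {ν μ : AcMeasure lam} (h : NearBy i ν μ) :
    dist μ ν ≤ 2 * (1 / √i * (2 * √(1 + μ.meas.real Set.univ) + 1)) := by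
  refine (h.dist_le_add hi).trans ?_
  have h1 := abs_le.1 ((h.abs_sqrt_mass_sub_le hi).trans (one_div_sqrt_le_one hi))
  have h2 : √(1 + μ.meas.real Set.univ) + √(1 + ν.meas.real Set.univ) ≤
      2 * √(1 + μ.meas.real Set.univ) + 1 := by linarith [h1.1]
  exact mul_le_mul_of_nonneg_left (mul_le_mul_of_nonneg_left h2 (by positivity)) zero_le_two

theorem tendsto_const_mul_one_div_sqrt (R : ℝ) :
    Tendsto (fun i : ℕ => 2 * (1 / √(i : ℝ) * R)) atTop (𝓝 0) := by
  have h1 : Tendsto (fun i : ℕ => √(i : ℝ)) atTop atTop :=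
    Real.tendsto_sqrt_atTop.comp tendsto_natCast_atTop_atTop
  have h2 := (tendsto_const_nhds (x := (1 : ℝ))).div_atTop h1
  simpa using (h2.mul_const R).const_mul 2

theorem exists_nearBy_nhds (μ : AcMeasure lam) {r : ℝ} (hr : 0 < r) (i₀ : ℕ) :
    ∃ i, i₀ ≤ i ∧ ∃ r' > 0, ∀ ν, dist ν μ < r' → NearBy i ν μ ∧
      ∀ μ', NearBy i ν μ' → dist μ' μ < r := by
  have hlim := tendsto_const_mul_one_div_sqrt
    (2 * √(1 + (μ.meas.real Set.univ + 1)) + 1)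
  obtain ⟨i, hi, hi₀⟩ := ((hlim.eventually (gt_mem_nhds (half_pos hr))).and
    (eventually_ge_atTop (max i₀ 1))).exists
  have hi1 : 1 ≤ i := (le_max_right _ _).trans hi₀
  -- The radius 1/(i+1) puts μ inside the sublevel sets centred at ν; r/2 leaves room for the
  -- triangle inequality. It also keeps the mass of ν below that of μ plus 1, the value used in
  -- choosing i.
  refine ⟨i, (le_max_left _ _).trans hi₀, min (1 / ((i : ℝ) + 1)) (r / 2), by positivity,
    fun ν hν => ⟨fun j => ?_, fun μ' h => ?_⟩⟩
  · refine (bump_sqrt_le (integral_testFun_nonneg _ _) (integral_testFun_nonneg _ _)).trans ?_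
    have h1 := μ.abs_integral_sub_le ν (testFun M j).continuous.measurable (C := 1) fun x => by
      rw [abs_of_nonneg (testFun_nonneg j x)]; exact testFun_le_one j x
    rw [one_mul, dist_comm] at h1
    exact h1.trans (hν.le.trans (min_le_left _ _))
  · have h1 := h.dist_le_center hi1
    have h2 := abs_le.1 (ν.abs_real_sub_le μ MeasurableSet.univ)
    have h3 : dist ν μ ≤ 1 := hν.le.trans ((min_le_left _ _).trans (by
      rw [div_le_one (by positivity)]
      have : (0 : ℝ) ≤ i := by positivity
      linarith))
    have h4 : dist μ' ν ≤ 2 * (1 / √i * (2 * √(1 + (μ.meas.real Set.univ + 1)) + 1)) := by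
      refine h1.trans ?_
      gcongr
      linarith [h2.2]
    calc dist μ' μ ≤ dist μ' ν + dist ν μ := dist_triangle _ _ _
      _ < r / 2 + r / 2 := add_lt_add (h4.trans_lt hi) (hν.trans_le (min_le_right _ _))
      _ = r := by ring

theorem isClosed_setOf_nearBy (i : ℕ) (ν : AcMeasure lam) : IsClosed {μ | NearBy i ν μ} := by
  have : {μ | NearBy i ν μ} = ⋂ j, {μ : AcMeasure lam |
      bump (√(1 + ∫ x, testFun M j x ∂ν.meas)) (∫ x, testFun M j x ∂μ.meas)
        ≤ 1 / ((i : ℝ) + 1)} := by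
    ext μ
    simp only [Set.mem_iInter]
    rfl
  rw [this]
  refine isClosed_iInter fun j => isClosed_le ((continuous_bump _).comp ?_) continuous_const
  exact (FiniteMeasure.continuous_integral_boundedContinuousFunction (testFun M j)).comp
    AcMeasure.continuous_toFinite

/-- Sets covered at every scale by finitely many joint sublevel sets are compact. -/
theorem isCompact_nearBy (ν : ℕ → AcMeasure lam) (n : ℕ → ℕ) :
    IsCompact {μ | ∀ i, ∃ k ≤ n i, NearBy i (ν k) μ} := by
  rw [isCompact_iff_totallyBounded_isComplete]
  constructor
  -- The condition at scale 1 involves finitely many centres and bounds all masses, so the radii at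
  -- the finer scales tend to 0 uniformly on the set.
  · obtain ⟨R, hR⟩ : ∃ R, ∀ μ ∈ {μ | ∀ i, ∃ k ≤ n i, NearBy i (ν k) μ},
        2 * √(1 + μ.meas.real Set.univ) + 1 ≤ R := by
      obtain ⟨R, hR⟩ := ((Set.finite_Iic (n 1)).image
        fun k => √(1 + (ν k).meas.real Set.univ)).bddAbove
      refine ⟨2 * (R + 1) + 1, fun μ hμ => ?_⟩
      obtain ⟨k, hk, h⟩ := hμ 1
      have h1 := abs_le.1 ((h.abs_sqrt_mass_sub_le le_rfl).trans (one_div_sqrt_le_one le_rfl))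
      have h2 := hR ⟨k, hk, rfl⟩
      linarith [h1.2]
    refine Metric.totallyBounded_iff.2 fun ε hε => ?_
    obtain ⟨i, hi, hi1⟩ := (((tendsto_const_mul_one_div_sqrt R).eventually
      (gt_mem_nhds hε)).and (eventually_ge_atTop 1)).exists
    refine ⟨ν '' Set.Iic (n i), (Set.finite_Iic _).image _, fun μ hμ => ?_⟩
    obtain ⟨k, hk, h⟩ := hμ i
    refine Set.mem_biUnion ⟨k, hk, rfl⟩ ?_
    refine lt_of_le_of_lt ((h.dist_le_point hi1).trans ?_) hi
    have := hR μ hμ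
    gcongr
  · refine IsClosed.isComplete ?_
    have : {μ | ∀ i, ∃ k ≤ n i, NearBy i (ν k) μ} =
        ⋂ i, ⋃ k ∈ Set.Iic (n i), {μ | NearBy i (ν k) μ} := by
      ext μ
      simp only [Set.mem_iInter, Set.mem_iUnion, Set.mem_Iic, exists_prop]
      rfl
    rw [this]
    exact isClosed_iInter fun i =>
      (Set.finite_Iic (n i)).isClosed_biUnion fun k _ => isClosed_setOf_nearBy i (ν k)

end Geometry

/-! ### Differentiability of `h ↦ u(h² lam)` -/

/-- `u` is continuous with right derivatives `D μ x` in the Dirac directions that are jointly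
continuous and bounded by `C`. -/
structure HasExtDeriv {M : Type*} [TopologicalSpace M] [MeasurableSpace M] [OpensMeasurableSpace M]
    (u : FiniteMeasure M → ℝ) (D : FiniteMeasure M → M → ℝ) (C : ℝ) : Prop where
  continuous : Continuous u
  continuous_deriv : Continuous fun p : FiniteMeasure M × M => D p.1 p.2
  bound : ∀ μ x, |D μ x| ≤ C
  hasDeriv : ∀ μ x, HasDerivWithinAt (fun t : ℝ => u (μ + t.toNNReal • diracF x)) (D μ x)
    (Set.Ici 0) 0

/-- The increments of `u` in the direction `ν` are the integrals of `∫ D dν` along segments. -/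
def IntegratesAlong {M : Type*} [MeasurableSpace M] (u : FiniteMeasure M → ℝ)
    (D : FiniteMeasure M → M → ℝ) (ν : FiniteMeasure M) : Prop :=
  ∀ (μ : FiniteMeasure M) (r : ℝ≥0), u (μ + r • ν) - u μ =
    r * ∫ s in (0 : ℝ)..1, ∫ x, D (μ + (r * s).toNNReal • ν) x ∂(ν : Measure M)

theorem toNNReal_add_smul {M : Type*} [MeasurableSpace M] (ν : FiniteMeasure M) {s t : ℝ}
    (hs : 0 ≤ s) (ht : 0 ≤ t) :
    (s + t).toNNReal • ν = s.toNNReal • ν + t.toNNReal • ν := by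
  rw [Real.toNNReal_add hs ht, add_smul]

theorem integratesAlong_zero {M : Type*} [MeasurableSpace M] {u : FiniteMeasure M → ℝ}
    {D : FiniteMeasure M → M → ℝ} : IntegratesAlong u D 0 := by
  intro μ r
  simp

theorem integratesAlong_smul {M : Type*} [MeasurableSpace M] {u : FiniteMeasure M → ℝ}
    {D : FiniteMeasure M → M → ℝ} (c : ℝ≥0)
    {ν : FiniteMeasure M}
    (hν : IntegratesAlong u D ν) : IntegratesAlong u D (c • ν) := by
  intro μ r
  rw [smul_smul, hν μ (r * c), NNReal.coe_mul, mul_assoc, ← intervalIntegral.integral_const_mul]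
  congr 1
  refine intervalIntegral.integral_congr fun s hs => ?_
  rw [Set.uIcc_of_le zero_le_one] at hs
  have e : (r * c * s : ℝ).toNNReal • ν = (r * s : ℝ).toNNReal • c • ν := by
    rw [smul_smul]
    congr 1
    rw [mul_right_comm, Real.toNNReal_mul (mul_nonneg r.coe_nonneg hs.1), Real.toNNReal_coe]
  simp only [e]
  rw [FiniteMeasure.toMeasure_smul, integral_smul_nnreal_measure]
  rfl

section Segments

variable {M : Type*} [TopologicalSpace M] [MeasurableSpace M] [BorelSpace M]
  {u : FiniteMeasure M → ℝ} {D : FiniteMeasure M → M → ℝ} {C : ℝ}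

theorem hasDerivWithinAt_of_eqOn_mul {f J : ℝ → ℝ} (hJ : ContinuousAt J 0)
    (h : ∀ ε, 0 ≤ ε → f ε = ε * J ε) : HasDerivWithinAt f (J 0) (Set.Ici 0) 0 := by
  rw [hasDerivWithinAt_iff_tendsto_slope]
  refine (hJ.tendsto.mono_left nhdsWithin_le_nhds).congr' ?_
  filter_upwards [self_mem_nhdsWithin] with ε hε
  have h0 : ε ≠ 0 := hε.2
  rw [slope_def_field, h ε hε.1, h 0 le_rfl]
  field_simp
  simp

theorem hasDerivWithinAt_Ici_of_shift {f : ℝ → ℝ} {f' t : ℝ}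
    (h : HasDerivWithinAt (fun s => f (t + s)) f' (Set.Ici 0) 0) :
    HasDerivWithinAt f f' (Set.Ici t) t := by
  have h1 : HasDerivWithinAt (fun s : ℝ => s - t) 1 (Set.Ici t) t :=
    ((hasDerivAt_id t).sub_const t).hasDerivWithinAt
  have h2 := HasDerivWithinAt.scomp (h := fun s : ℝ => s - t) t (t' := Set.Ici 0)
    (by simpa using h) h1 (fun s hs => by simpa using hs)
  simpa [Function.comp_def] using h2

namespace HasExtDeriv

theorem continuous_section (hu : HasExtDeriv u D C) (μ : FiniteMeasure M) : Continuous (D μ) :=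
  hu.continuous_deriv.comp (by fun_prop : Continuous fun x => (μ, x))

theorem integrable (hu : HasExtDeriv u D C) (μ : FiniteMeasure M) (ν : Measure M)
    [IsFiniteMeasure ν] : Integrable (D μ) ν :=
  (integrable_const C).mono' (hu.continuous_section μ).measurable.aestronglyMeasurable
    (Eventually.of_forall fun x => hu.bound μ x)

theorem continuous_integral (hu : HasExtDeriv u D C) {Y : Type*} [TopologicalSpace Y]
    [FirstCountableTopology Y] {a : Y → FiniteMeasure M} (ha : Continuous a)
    (ν : FiniteMeasure M) : Continuous fun y => ∫ x, D (a y) x ∂(ν : Measure M) := by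
  refine continuous_of_dominated (bound := fun _ => C)
    (fun y => (hu.continuous_section _).measurable.aestronglyMeasurable)
    (fun y => Eventually.of_forall fun x => hu.bound _ x) (integrable_const C)
    (Eventually.of_forall fun x => ?_)
  exact hu.continuous_deriv.comp (ha.prodMk continuous_const)

/-- The hypothesis holds at every base point, in particular at μ + tν, so it gives right derivatives
along the whole ray. These are continuous in t, and the fundamental theorem of calculus applies. -/
theorem integratesAlong_of_hasDeriv (hu : HasExtDeriv u D C) {ν : FiniteMeasure M}
    (h : ∀ μ, HasDerivWithinAt (fun t : ℝ => u (μ + t.toNNReal • ν))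
      (∫ x, D μ x ∂(ν : Measure M)) (Set.Ici 0) 0) : IntegratesAlong u D ν := by
  intro μ r
  have hray : Continuous fun t : ℝ => μ + t.toNNReal • ν := by fun_prop
  have hc : Continuous fun t : ℝ => ∫ x, D (μ + t.toNNReal • ν) x ∂(ν : Measure M) :=
    hu.continuous_integral hray ν
  have hd : ∀ t ∈ Set.Ioo (0 : ℝ) r, HasDerivWithinAt (fun t : ℝ => u (μ + t.toNNReal • ν))
      (∫ x, D (μ + t.toNNReal • ν) x ∂(ν : Measure M)) (Set.Ioi t) t := by
    intro t ht
    refine (hasDerivWithinAt_Ici_of_shift ?_).mono Set.Ioi_subset_Ici_self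
    refine (h (μ + t.toNNReal • ν)).congr (fun s hs => ?_) (by simp)
    rw [toNNReal_add_smul ν ht.1.le hs, add_assoc]
  have h1 := intervalIntegral.integral_eq_sub_of_hasDeriv_right_of_le r.2
    (hu.continuous.comp hray).continuousOn hd (hc.intervalIntegrable _ _)
  have h2 := intervalIntegral.mul_integral_comp_mul_left (a := 0) (b := 1)
    (f := fun t : ℝ => ∫ x, D (μ + t.toNNReal • ν) x ∂(ν : Measure M)) (r : ℝ)
  rw [h2, mul_zero, mul_one]
  simpa using h1.symm

/-- By the integral formula the difference quotient is an average of ∫ D dν over the segment,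
jointly continuous in t and the base point. The base may therefore move with t without changing the
limit. -/
theorem hasDeriv_moving (hu : HasExtDeriv u D C) {ν : FiniteMeasure M}
    (hν : IntegratesAlong u D ν) {a : ℝ → FiniteMeasure M} (ha : Continuous a) :
    HasDerivWithinAt (fun t : ℝ => u (a t + t.toNNReal • ν) - u (a t))
      (∫ x, D (a 0) x ∂(ν : Measure M)) (Set.Ici 0) 0 := by
  let J : ℝ → ℝ := fun t => ∫ s in (0 : ℝ)..1,
    ∫ x, D (a t + (t * s).toNNReal • ν) x ∂(ν : Measure M)
  have hJ : Continuous J := by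
    refine intervalIntegral.continuous_parametric_intervalIntegral_of_continuous' ?_ 0 1
    exact hu.continuous_integral (a := fun p : ℝ × ℝ => a p.1 + (p.1 * p.2).toNNReal • ν)
      (by fun_prop) ν
  have h0 : J 0 = ∫ x, D (a 0) x ∂(ν : Measure M) := by simp [J]
  rw [← h0]
  refine hasDerivWithinAt_of_eqOn_mul hJ.continuousAt fun t ht => ?_
  have h1 := hν (a t) t.toNNReal
  rwa [Real.coe_toNNReal t ht] at h1

theorem hasDeriv_of_integratesAlong (hu : HasExtDeriv u D C) {ν : FiniteMeasure M}
    (hν : IntegratesAlong u D ν) (μ : FiniteMeasure M) :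
    HasDerivWithinAt (fun t : ℝ => u (μ + t.toNNReal • ν))
      (∫ x, D μ x ∂(ν : Measure M)) (Set.Ici 0) 0 := by
  simpa using (hu.hasDeriv_moving hν (a := fun _ => μ) continuous_const).add_const (u μ)

theorem integratesAlong_dirac (hu : HasExtDeriv u D C) (x : M) :
    IntegratesAlong u D (diracF x) := by
  refine hu.integratesAlong_of_hasDeriv fun μ => ?_
  have h : ∫ y, D μ y ∂((diracF x : FiniteMeasure M) : Measure M) = D μ x :=
    integral_dirac' _ _ (hu.continuous_section μ).measurable.stronglyMeasurable
  rw [h]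
  exact hu.hasDeriv μ x

/-- The increment in direction ν₁ + ν₂ is an increment along ν₁ followed by one along ν₂ from the
moving base μ + tν₁. -/
theorem integratesAlong_add (hu : HasExtDeriv u D C) {ν₁ ν₂ : FiniteMeasure M}
    (h₁ : IntegratesAlong u D ν₁) (h₂ : IntegratesAlong u D ν₂) :
    IntegratesAlong u D (ν₁ + ν₂) := by
  refine hu.integratesAlong_of_hasDeriv fun μ => ?_
  have d1 := hu.hasDeriv_of_integratesAlong h₁ μ
  have d2 := hu.hasDeriv_moving h₂ (a := fun t : ℝ => μ + t.toNNReal • ν₁) (by fun_prop)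
  refine ((d1.add d2).congr_deriv ?_).congr (fun t _ => ?_) ?_
  · rw [FiniteMeasure.toMeasure_add, integral_add_measure (hu.integrable _ _) (hu.integrable _ _)]
    simp
  · simp [smul_add, add_assoc]
  · simp [smul_add, add_assoc]

/-- A push-forward under a map with finite range is a finite positive combination of Dirac measures.
-/
theorem integratesAlong_map (hu : HasExtDeriv u D C) (ν : FiniteMeasure M)
    (T : SimpleFunc M M) : IntegratesAlong u D (ν.map T) := by
  have h : ν.map T = ∑ y ∈ T.range, (ν (T ⁻¹' {y})) • diracF y := by
    refine Subtype.ext (Measure.ext fun s hs => ?_)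
    change ((ν : Measure M).map T) s = ((∑ y ∈ T.range, (ν (T ⁻¹' {y})) • diracF y :
      FiniteMeasure M) : Measure M) s
    rw [FiniteMeasure.toMeasure_sum, Measure.map_apply T.measurable hs]
    simp only [Measure.coe_finsetSum, Finset.sum_apply, FiniteMeasure.toMeasure_smul,
      Measure.smul_apply]
    have h1 : ∀ y, ν (T ⁻¹' {y}) • ((diracF y : FiniteMeasure M) : Measure M) s =
        s.indicator 1 y * (ν : Measure M) (T ⁻¹' {y}) := fun y => by
      change _ • Measure.dirac y s = _
      rw [Measure.dirac_apply' _ hs, mul_comm, ENNReal.smul_def, smul_eq_mul]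
      congr 1
      exact FiniteMeasure.ennreal_coeFn_eq_coeFn_toMeasure ν _
    simp only [h1]
    rw [← SimpleFunc.map_lintegral, ← SimpleFunc.lintegral_eq_lintegral]
    have h2 : ∀ x, (T.map (s.indicator (1 : M → ℝ≥0∞))) x = (T ⁻¹' s).indicator 1 x := fun x => by
      rw [SimpleFunc.map_apply]; rfl
    simp only [h2]
    rw [lintegral_indicator_one (T.measurable hs)]
  rw [h]
  exact Finset.sum_induction _ (IntegratesAlong u D) (fun _ _ h1 h2 => hu.integratesAlong_add h1 h2)
    integratesAlong_zero fun y _ => integratesAlong_smul _ (hu.integratesAlong_dirac y)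

/-- Nearest-point maps to a dense sequence give push-forwards converging weakly to ν. Both sides of
the formula pass to the limit by dominated convergence, using joint continuity of D because the
measure and the point move together. -/
theorem integratesAlong [PolishSpace M] (hu : HasExtDeriv u D C) (ν : FiniteMeasure M) :
    IntegratesAlong u D ν := by
  rcases isEmpty_or_nonempty M with hM | hM
  · have : ν = 0 := Subtype.ext (Measure.eq_zero_of_isEmpty _)
    rw [this]
    exact integratesAlong_zero
  let _ := TopologicalSpace.upgradeIsCompletelyMetrizable M
  let T : ℕ → SimpleFunc M M := SimpleFunc.nearestPt (TopologicalSpace.denseSeq M)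
  have hT : ∀ x, Tendsto (fun n => T n x) atTop (𝓝 x) := fun x =>
    SimpleFunc.tendsto_nearestPt (TopologicalSpace.denseRange_denseSeq M x)
  have hν : Tendsto (fun n => ν.map (T n)) atTop (𝓝 ν) := by
    rw [FiniteMeasure.tendsto_iff_forall_integral_tendsto]
    intro f
    have h1 : ∀ n, ∫ x, f x ∂(ν.map (T n) : Measure M) = ∫ x, f (T n x) ∂(ν : Measure M) :=
      fun n => integral_map (T n).measurable.aemeasurable
          f.continuous.measurable.aestronglyMeasurable
    simp only [h1]
    refine tendsto_integral_of_dominated_convergence (fun _ => ‖f‖)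
      (fun n => (f.continuous.measurable.comp (T n).measurable).aestronglyMeasurable)
      (integrable_const _) (fun n => Eventually.of_forall fun x => f.norm_coe_le_norm _)
      (Eventually.of_forall fun x => ?_)
    exact (f.continuous.tendsto x).comp (hT x)
  intro μ r
  have hl : Tendsto (fun n => u (μ + r • ν.map (T n)) - u μ) atTop (𝓝 (u (μ + r • ν) - u μ)) :=
    ((hu.continuous.tendsto _).comp ((hν.const_smul r).const_add μ)).sub_const _
  refine tendsto_nhds_unique hl ?_
  simp only [hu.integratesAlong_map ν (T _) μ r]
  refine Tendsto.const_mul _ ?_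
  have h1 : ∀ n (s : ℝ), ∫ x, D (μ + (r * s).toNNReal • ν.map (T n)) x ∂(ν.map (T n) : Measure M) =
      ∫ x, D (μ + (r * s).toNNReal • ν.map (T n)) (T n x) ∂(ν : Measure M) := fun n s =>
    integral_map (T n).measurable.aemeasurable
      (hu.continuous_section _).measurable.aestronglyMeasurable
  simp only [h1]
  have hbd : ∀ n (s : ℝ), ‖∫ x, D (μ + (r * s).toNNReal • ν.map (T n)) (T n x) ∂(ν : Measure M)‖ ≤
      C * (ν : Measure M).real Set.univ := fun n s =>
    norm_integral_le_of_norm_le_const (Eventually.of_forall fun x => hu.bound _ _)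
  refine intervalIntegral.tendsto_integral_filter_of_dominated_convergence
    (fun _ => C * (ν : Measure M).real Set.univ) (Eventually.of_forall fun n => ?_)
    (Eventually.of_forall fun n => Eventually.of_forall fun s _ => hbd n s)
    (intervalIntegrable_const) (Eventually.of_forall fun s _ => ?_)
  · refine Continuous.aestronglyMeasurable ?_
    simp only [← h1]
    exact hu.continuous_integral (a := fun s : ℝ => μ + (r * s).toNNReal • ν.map (T n))
      (by fun_prop) _
  · refine tendsto_integral_of_dominated_convergence (fun _ => C)
      (fun n => ((hu.continuous_section _).measurable.comp (T n).measurable).aestronglyMeasurable)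
      (integrable_const _) (fun n => Eventually.of_forall fun x => hu.bound _ _)
      (Eventually.of_forall fun x => ?_)
    exact (hu.continuous_deriv.tendsto (μ + (r * s).toNNReal • ν, x)).comp
      (((hν.const_smul _).const_add μ).prodMk_nhds (hT x))

end HasExtDeriv

end Segments

/-! ### The gradient of the composition with the square map. -/

section Gateaux

theorem withDensity_add_left_of_aemeasurable {M : Type*} [MeasurableSpace M] {m : Measure M}
    {f : M → ℝ≥0∞} (hf : AEMeasurable f m) (g : M → ℝ≥0∞) :
    m.withDensity (f + g) = m.withDensity f + m.withDensity g := by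
  ext s hs
  rw [withDensity_apply _ hs, Measure.add_apply, withDensity_apply _ hs, withDensity_apply _ hs]
  exact lintegral_add_left' hf.restrict g


theorem coeFn_toL2 {M : Type*} [MeasurableSpace M] {m : Measure M} {f : M → ℝ} (hf : MemLp f 2 m) :
    toL2 m f =ᵐ[m] f := by
  rw [toL2, dif_pos hf]
  exact hf.coeFn_toLp

variable {M : Type*} [TopologicalSpace M] [MeasurableSpace M] [BorelSpace M]
  {lam : Measure M} {u : FiniteMeasure M → ℝ} {D : FiniteMeasure M → M → ℝ} {C : ℝ}

/-- The class of `2 h D(h² lam)` in `L²(lam)`. -/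
def liftGrad (D : FiniteMeasure M → M → ℝ) (h : Lp ℝ 2 lam) : Lp ℝ 2 lam :=
  toL2 lam fun x => 2 * (h x * D (psiM h).toFinite x)

namespace HasExtDeriv

theorem memLp_liftGrad (hu : HasExtDeriv u D C) (h : Lp ℝ 2 lam) :
    MemLp (fun x => 2 * (h x * D (psiM h).toFinite x)) 2 lam := by
  refine (Lp.memLp h).of_le_mul (c := 2 * C) (AEStronglyMeasurable.const_mul
    ((Lp.aestronglyMeasurable h).mul
      (hu.continuous_section _).measurable.aestronglyMeasurable) 2)
    (Eventually.of_forall fun x => ?_)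
  simp only [Real.norm_eq_abs, abs_mul, abs_two]
  nlinarith [hu.bound (psiM h).toFinite x, abs_nonneg (h x)]

theorem coeFn_liftGrad (hu : HasExtDeriv u D C) (h : Lp ℝ 2 lam) :
    liftGrad D h =ᵐ[lam] fun x => 2 * (h x * D (psiM h).toFinite x) :=
  coeFn_toL2 (hu.memLp_liftGrad h)

theorem norm_liftGrad_sq (hu : HasExtDeriv u D C) (h : Lp ℝ 2 lam) :
    ‖liftGrad D h‖ ^ 2 = 4 * ∫ x, D (psiM h).toFinite x ^ 2 ∂(psiM h).meas := by
  change _ = 4 * ∫ x, _ ∂sqMeasure h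
  rw [L2_norm_sq_eq_integral, integral_sqMeasure, ← integral_const_mul]
  refine integral_congr_ae ?_
  filter_upwards [hu.coeFn_liftGrad h] with x hx
  rw [hx]
  ring

theorem continuous_liftGrad [SigmaFinite lam] (hu : HasExtDeriv u D C) :
    Continuous (liftGrad D : Lp ℝ 2 lam → Lp ℝ 2 lam) := by
  refine continuous_iff_continuousAt.2 fun h => ?_
  let R : Lp ℝ 2 lam → ℝ := fun k =>
    ∫ x, (D (psiM k).toFinite x - D (psiM h).toFinite x) ^ 2 ∂sqMeasure h
  have hD : ∀ k : Lp ℝ 2 lam, Measurable (D (psiM k).toFinite) := fun k =>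
    (hu.continuous_section _).measurable
  have hbd : ∀ (k : Lp ℝ 2 lam) x,
      ‖(D (psiM k).toFinite x - D (psiM h).toFinite x) ^ 2‖ ≤ (2 * C) ^ 2 := fun k x => by
    rw [Real.norm_eq_abs, abs_pow]
    refine pow_le_pow_left₀ (abs_nonneg _) ?_ 2
    have h1 := hu.bound (psiM k).toFinite x
    have h2 := hu.bound (psiM h).toFinite x
    have h3 := abs_sub (D (psiM k).toFinite x) (D (psiM h).toFinite x)
    linarith
  have hR : Continuous R := by
    refine continuous_of_dominated (bound := fun _ => (2 * C) ^ 2)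
      (fun k => (((hD k).sub (hD h)).pow_const 2).aestronglyMeasurable)
      (fun k => Eventually.of_forall (hbd k)) (integrable_const _)
      (Eventually.of_forall fun x => ?_)
    have : Continuous fun k : Lp ℝ 2 lam => D (psiM k).toFinite x :=
      hu.continuous_deriv.comp ((AcMeasure.continuous_toFinite.comp continuous_psiM).prodMk
        continuous_const)
    exact (this.sub continuous_const).pow 2
  have hle : ∀ k, ‖liftGrad D k - liftGrad D h‖ ^ 2 ≤ 8 * C ^ 2 * ‖k - h‖ ^ 2 + 8 * R k := by
    intro k
    have i1 : Integrable (fun x => (k - h) x ^ 2) lam := (Lp.memLp (k - h)).integrable_sq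
    have i2 : Integrable (fun x => h x ^ 2 *
        (D (psiM k).toFinite x - D (psiM h).toFinite x) ^ 2) lam :=
      (Lp.memLp h).integrable_sq.mul_bdd (c := (2 * C) ^ 2)
        (((hD k).sub (hD h)).pow_const 2).aestronglyMeasurable (Eventually.of_forall (hbd k))
    change _ ≤ 8 * C ^ 2 * ‖k - h‖ ^ 2 + 8 * ∫ x, _ ∂sqMeasure h
    rw [integral_sqMeasure, L2_norm_sq_eq_integral, L2_norm_sq_eq_integral, ← integral_const_mul,
      ← integral_const_mul, ← integral_add (i1.const_mul _) (i2.const_mul _)]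
    refine integral_mono_ae (Lp.memLp _).integrable_sq ((i1.const_mul _).add (i2.const_mul _)) ?_
    filter_upwards [hu.coeFn_liftGrad h, hu.coeFn_liftGrad k, Lp.coeFn_sub k h,
      Lp.coeFn_sub (liftGrad D k) (liftGrad D h)] with x h1 h2 h3 h4
    rw [h4, h3]
    simp only [Pi.sub_apply]
    rw [h1, h2]
    set a := D (psiM k).toFinite x with ha
    set b := D (psiM h).toFinite x
    have hC : a ^ 2 ≤ C ^ 2 := sq_le_sq' (abs_le.1 (hu.bound _ x)).1 (abs_le.1 (hu.bound _ x)).2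
    -- The first part is controlled by C ‖k - h‖; the second integrates to `R k`, which tends to 0
    -- by joint continuity of D and dominated convergence. The constant 8 comes from (2x + 2y)² ≤
    -- 8x² + 8y².
    have e : 2 * (k x * a) - 2 * (h x * b) = 2 * ((k x - h x) * a) + 2 * (h x * (a - b)) := by ring
    rw [e]
    nlinarith [sq_nonneg (2 * ((k x - h x) * a) - 2 * (h x * (a - b))),
      mul_le_mul_of_nonneg_left hC (sq_nonneg (k x - h x))]
  have hlim : Tendsto (fun k => ‖liftGrad D k - liftGrad D h‖ ^ 2) (𝓝 h) (𝓝 0) := by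
    refine squeeze_zero (fun _ => sq_nonneg _) hle ?_
    have : Continuous fun k => 8 * C ^ 2 * ‖k - h‖ ^ 2 + 8 * R k := by fun_prop
    simpa [R] using this.tendsto h
  rw [ContinuousAt, tendsto_iff_norm_sub_tendsto_zero]
  simpa [Real.sqrt_sq] using hlim.sqrt

/-- The direction 2hk is signed while the integral formula handles positive measures only. Adding
t(h² + k²) to both sides repairs this: u along the line is recovered from an increment in direction
(h+k)², an increment in direction h² + k², and a term moving like t², whose derivative at 0
vanishes. -/
theorem hasDeriv_line [PolishSpace M] [SigmaFinite lam] (hu : HasExtDeriv u D C)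
    (h k : Lp ℝ 2 lam) :
    HasDerivWithinAt (fun t : ℝ => u (psiM (h + t • k)).toFinite) (inner ℝ (liftGrad D h) k)
      (Set.Ici 0) 0 := by
  have hc : Continuous fun t : ℝ => (psiM (h + t • k)).toFinite :=
    AcMeasure.continuous_toFinite.comp (continuous_psiM.comp (by fun_prop))
  have d1 := hu.hasDeriv_moving (hu.integratesAlong ((psiM h).toFinite + (psiM k).toFinite)) hc
  have d2 := hu.hasDeriv_moving (hu.integratesAlong (psiM (h + k)).toFinite)
    (a := fun t : ℝ => (psiM h).toFinite + (t ^ 2).toNNReal • (psiM k).toFinite) (by fun_prop)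
  have d3 : HasDerivWithinAt (fun t : ℝ => u ((psiM h).toFinite +
      (t ^ 2).toNNReal • (psiM k).toFinite)) 0 (Set.Ici 0) 0 := by
    have e1 := hu.hasDeriv_of_integratesAlong (hu.integratesAlong (psiM k).toFinite)
      (psiM h).toFinite
    have e2 : HasDerivWithinAt (fun t : ℝ => t ^ 2) 0 (Set.Ici 0) 0 := by
      simpa using (hasDerivAt_pow 2 (0 : ℝ)).hasDerivWithinAt
    have e3 := HasDerivWithinAt.scomp (h := fun t : ℝ => t ^ 2) 0 (t' := Set.Ici 0)
      (by simpa using e1) e2 (fun t _ => by simp [sq_nonneg])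
    simpa [Function.comp_def] using e3
  -- This is (h + tk)² + t(h² + k²) = h² + t²k² + t(h + k)², an identity of positive densities.
  have key : ∀ t : ℝ, 0 ≤ t → (psiM (h + t • k)).toFinite +
      t.toNNReal • ((psiM h).toFinite + (psiM k).toFinite) = (psiM h).toFinite +
        (t ^ 2).toNNReal • (psiM k).toFinite + t.toNNReal • (psiM (h + k)).toFinite := by
    intro t ht
    refine Subtype.ext ?_
    change sqMeasure (h + t • k) + ENNReal.ofReal t • (sqMeasure h + sqMeasure k) =
      sqMeasure h + ENNReal.ofReal (t ^ 2) • sqMeasure k + ENNReal.ofReal t • sqMeasure (h + k)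
    simp only [sqMeasure]
    rw [← withDensity_add_left_of_aemeasurable (measurable_ofReal_sq h),
      ← withDensity_smul' _ _ ENNReal.ofReal_ne_top, ← withDensity_smul' _ _ ENNReal.ofReal_ne_top,
      ← withDensity_smul' _ _ ENNReal.ofReal_ne_top,
      ← withDensity_add_left_of_aemeasurable (measurable_ofReal_sq _),
      ← withDensity_add_left_of_aemeasurable (measurable_ofReal_sq h),
      ← withDensity_add_left_of_aemeasurable
        ((measurable_ofReal_sq h).add ((measurable_ofReal_sq k).const_smul _))]
    refine withDensity_congr_ae ?_
    filter_upwards [Lp.coeFn_add h (t • k), Lp.coeFn_smul t k, Lp.coeFn_add h k] with x h1 h2 h3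
    simp only [Pi.add_apply, Pi.smul_apply, smul_eq_mul]
    rw [h1, h3]
    simp only [Pi.add_apply]
    rw [h2]
    simp only [Pi.smul_apply, smul_eq_mul]
    rw [← ENNReal.ofReal_add (by positivity) (by positivity), ← ENNReal.ofReal_mul ht,
      ← ENNReal.ofReal_add (by positivity) (by positivity), ← ENNReal.ofReal_mul (by positivity),
      ← ENNReal.ofReal_mul ht, ← ENNReal.ofReal_add (by positivity) (by positivity),
      ← ENNReal.ofReal_add (by positivity) (by positivity)]
    congr 1
    ring
  refine (((d2.sub d1).add d3).congr_deriv ?_).congr (fun t ht => ?_) ?_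
  · simp only [zero_smul, add_zero, ne_eq, OfNat.ofNat_ne_zero, not_false_eq_true, zero_pow,
      Real.toNNReal_zero]
    change ∫ x, D (psiM h).toFinite x ∂sqMeasure (h + k) -
      ∫ x, D (psiM h).toFinite x ∂(sqMeasure h + sqMeasure k) = _
    have hbd : ∀ p : Lp ℝ 2 lam, Integrable (fun x => p x ^ 2 * D (psiM h).toFinite x) lam :=
      fun p => (Lp.memLp p).integrable_sq.mul_bdd (c := C)
        (hu.continuous_section _).measurable.aestronglyMeasurable
        (Eventually.of_forall (hu.bound _))
    rw [integral_add_measure (hu.integrable _ _) (hu.integrable _ _), integral_sqMeasure,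
      integral_sqMeasure, integral_sqMeasure, L2.inner_def, ← integral_add (hbd h) (hbd k)]
    refine (integral_sub (hbd _) ((hbd h).add (hbd k))).symm.trans (integral_congr_ae ?_)
    filter_upwards [hu.coeFn_liftGrad h, Lp.coeFn_add h k] with x h1 h2
    rw [h1, h2]
    simp only [Pi.add_apply, RCLike.inner_apply, conj_trivial]
    ring
  · simp only [Pi.add_apply, Pi.sub_apply]
    rw [key t ht]
    ring
  · simp

theorem hasGradientAt [PolishSpace M] [SigmaFinite lam] (hu : HasExtDeriv u D C)
    (h : Lp ℝ 2 lam) :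
    HasGradientAt (fun h : Lp ℝ 2 lam => u (psiM h).toFinite) (liftGrad D h) h := by
  rw [hasGradientAt_iff_isLittleO, Asymptotics.isLittleO_iff]
  intro c hc
  obtain ⟨r, hr, hball⟩ := Metric.continuousAt_iff.1
    (hu.continuous_liftGrad.continuousAt (x := h)) c hc
  filter_upwards [Metric.ball_mem_nhds h hr] with k' hk'
  set k := k' - h with hk
  have hk0 : ‖k‖ < r := by rwa [hk, ← dist_eq_norm]
  have hline : Continuous fun t : ℝ => u (psiM (h + t • k)).toFinite :=
    hu.continuous.comp (AcMeasure.continuous_toFinite.comp (continuous_psiM.comp (by fun_prop)))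
  -- Directional derivatives become a Fréchet gradient by the mean value inequality on the segment,
  -- since the candidate gradient is continuous in h.
  have hm := norm_image_sub_le_of_norm_deriv_right_le_segment (a := 0) (b := 1)
    (f := fun t : ℝ => u (psiM (h + t • k)).toFinite - t * inner ℝ (liftGrad D h) k)
    (f' := fun t => inner ℝ (liftGrad D (h + t • k)) k - inner ℝ (liftGrad D h) k)
    (C := c * ‖k‖) (hline.sub (by fun_prop)).continuousOn (fun t ht => ?_) (fun t ht => ?_) 1
    (by simp)
  · simp only [one_smul, zero_smul, add_zero, one_mul, zero_mul, sub_zero, mul_one] at hm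
    have e : h + k = k' := by rw [hk]; abel
    rw [e] at hm
    rw [sub_right_comm] at hm
    exact hm
  · refine HasDerivWithinAt.sub (hasDerivWithinAt_Ici_of_shift ?_) ?_
    · simpa [add_smul, add_assoc] using hu.hasDeriv_line (h + t • k) k
    · simpa using ((hasDerivAt_id t).mul_const (inner ℝ (liftGrad D h) k)).hasDerivWithinAt
  · rw [← inner_sub_left]
    refine (norm_inner_le_norm _ _).trans (mul_le_mul_of_nonneg_right ?_ (norm_nonneg _))
    rw [← dist_eq_norm]
    refine (hball ?_).le
    rw [dist_eq_norm, add_sub_cancel_left, norm_smul, Real.norm_eq_abs, abs_of_nonneg ht.1]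
    nlinarith [ht.2, norm_nonneg k]

theorem contDiff [PolishSpace M] [SigmaFinite lam] (hu : HasExtDeriv u D C) :
    ContDiff ℝ 1 fun h : Lp ℝ 2 lam => u (psiM h).toFinite :=
  contDiff_one_iff_hasFDerivAt.2 ⟨fun h => InnerProductSpace.toDual ℝ _ (liftGrad D h),
    (InnerProductSpace.toDual ℝ _).continuous.comp hu.continuous_liftGrad,
    fun h => (hu.hasGradientAt h).hasFDerivAt⟩

end HasExtDeriv

end Gateaux

/-! ### Energy densities given by families of operators -/

section ToL2

variable {M : Type*} [MeasurableSpace M] {m : Measure M}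

theorem toL2_congr {f g : M → ℝ} (h : f =ᵐ[m] g) : toL2 m f = toL2 m g := by
  by_cases hf : MemLp f 2 m
  · have hg : MemLp g 2 m := hf.ae_eq h
    rw [toL2, toL2, dif_pos hf, dif_pos hg]
    exact (MemLp.toLp_eq_toLp_iff hf hg).2 h
  · have hg : ¬ MemLp g 2 m := fun hg => hf (hg.ae_eq h.symm)
    rw [toL2, toL2, dif_neg hf, dif_neg hg]

theorem toL2_add {f g : M → ℝ} (hf : MemLp f 2 m) (hg : MemLp g 2 m) :
    toL2 m (fun x => f x + g x) = toL2 m f + toL2 m g := by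
  have hfg : MemLp (fun x => f x + g x) 2 m := hf.add hg
  rw [toL2, toL2, toL2, dif_pos hf, dif_pos hg, dif_pos hfg]
  rfl

theorem toL2_const_mul (c : ℝ) {f : M → ℝ} (hf : MemLp f 2 m) :
    toL2 m (fun x => c * f x) = c • toL2 m f := by
  have hfg : MemLp (fun x => c * f x) 2 m := hf.const_mul c
  rw [toL2, toL2, dif_pos hf, dif_pos hfg]
  rfl

theorem memLp_of_bounded [IsFiniteMeasure m] {f : M → ℝ} (hf : Measurable f) {C : ℝ}
    (hC : ∀ x, |f x| ≤ C) : MemLp f 2 m :=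
  MemLp.of_bound hf.aestronglyMeasurable C (Eventually.of_forall hC)

theorem norm_toL2_eq {f : M → ℝ} (hf : MemLp f 2 m) :
    ‖toL2 m f‖ = (eLpNorm f 2 m).toReal := by
  rw [toL2, dif_pos hf, Lp.norm_toLp]

theorem norm_toL2_sq {f : M → ℝ} (hf : MemLp f 2 m) : ‖toL2 m f‖ ^ 2 = ∫ x, f x ^ 2 ∂m := by
  rw [L2_norm_sq_eq_integral]
  refine integral_congr_ae ?_
  filter_upwards [coeFn_toL2 hf] with x hx
  rw [hx]

theorem norm_toL2_le [IsProbabilityMeasure m] {f : M → ℝ} (hf : Measurable f) {C : ℝ}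
    (h0 : 0 ≤ C) (hC : ∀ x, |f x| ≤ C) : ‖toL2 m f‖ ≤ C := by
  refine abs_le_of_sq_le_sq' ?_ h0 |>.2
  rw [norm_toL2_sq (memLp_of_bounded hf hC)]
  calc ∫ x, f x ^ 2 ∂m ≤ ∫ _, C ^ 2 ∂m :=
        integral_mono (memLp_of_bounded hf hC).integrable_sq (integrable_const _) fun x =>
          sq_le_sq' (abs_le.1 (hC x)).1 (abs_le.1 (hC x)).2
    _ = C ^ 2 := by simp

end ToL2

section Energy

variable {X M : Type*} [MeasurableSpace M] {κ : X → Measure M}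

/-- `⟨A(x) a(x), b(x)⟩` in `L²(κ x)`. -/
def energy (A : ∀ x, Lp ℝ 2 (κ x) →L[ℝ] Lp ℝ 2 (κ x)) (a b : X → M → ℝ) (x : X) : ℝ :=
  inner ℝ (A x (toL2 (κ x) (a x))) (toL2 (κ x) (b x))

variable (A : ∀ x, Lp ℝ 2 (κ x) →L[ℝ] Lp ℝ 2 (κ x))

theorem abs_energy_le (a b : X → M → ℝ) (x : X) :
    |energy A a b x| ≤ ‖A x‖ * ‖toL2 (κ x) (a x)‖ * ‖toL2 (κ x) (b x)‖ :=
  (abs_real_inner_le_norm _ _).trans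
    (mul_le_mul_of_nonneg_right ((A x).le_opNorm _) (norm_nonneg _))

theorem energy_symm (hA : ∀ x, (A x).IsPositive) (a b : X → M → ℝ) (x : X) :
    energy A a b x = energy A b a x := by
  rw [energy, energy, real_inner_comm]
  exact ((hA x).isSymmetric _ _).symm

theorem energy_nonneg (hA : ∀ x, (A x).IsPositive) (a : X → M → ℝ) (x : X) :
    0 ≤ energy A a a x :=
  (hA x).re_inner_nonneg_left (toL2 (κ x) (a x))

/-- The jointly measurable version of A(x)a(x) turns the inner product into a parameter integral
over the measurable family `κ`. -/
theorem measurable_energy [TopologicalSpace X] [MeasurableSpace X] [BorelSpace X]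
    [SecondCountableTopology X] [TopologicalSpace M] [BorelSpace M]
    [SecondCountableTopology M] (hκ : Measurable κ) (hfin : ∀ x, IsFiniteMeasure (κ x))
    (hA : ∀ η : (X × M) →ᵇ ℝ, ∃ G : X × M → ℝ, Measurable G ∧
      ∀ x, ∀ᵐ y ∂κ x, A x (toL2 (κ x) fun y => η (x, y)) y = G (x, y))
    {a b : X → M → ℝ} (ha : Continuous fun p : X × M => a p.1 p.2) {Ca : ℝ}
    (hCa : ∀ x y, |a x y| ≤ Ca) (hb : Continuous fun p : X × M => b p.1 p.2) {Cb : ℝ}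
    (hCb : ∀ x y, |b x y| ≤ Cb) : Measurable (energy A a b) := by
  obtain ⟨G, hG, hGA⟩ := hA (BoundedContinuousFunction.ofNormedAddCommGroup _ ha Ca
    fun p => hCa p.1 p.2)
  have h : energy A a b = fun x => ∫ y, (G (x, y) * b x y) ∂κ x := by
    funext x
    have := hfin x
    rw [energy, L2.inner_def]
    refine integral_congr_ae ?_
    have hbx : Measurable (b x) := (hb.comp (by fun_prop : Continuous fun y => (x, y))).measurable
    filter_upwards [hGA x, coeFn_toL2 (m := κ x) (memLp_of_bounded hbx (hCb x))] with y h1 h2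
    rw [h2, ← h1]
    simp only [RCLike.inner_apply, conj_trivial]
    exact mul_comm _ _
  rw [h]
  exact measurable_integral_family hκ hfin (f := fun p => G p * b p.1 p.2) (hG.mul hb.measurable)

end Energy

/-! ### From derivations and operator families to a carré du champ. -/

section Derivations

variable {α X M : Type*} [AddCommGroup α] [Module ℝ α] [TopologicalSpace X]
  [TopologicalSpace M] [MeasurableSpace M]

/-- A linear class of bounded continuous functions with a bounded continuous derivation `d` with
values in the functions on `M`, bounded in `L²(κ x)`. -/
structure DerivationClass (κ : X → Measure M) (P : PreForm α X) (d : α → X → M → ℝ) : Prop where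
  zero_mem : (0 : α) ∈ P.dom
  add_mem : ∀ {u v}, u ∈ P.dom → v ∈ P.dom → u + v ∈ P.dom
  smul_mem : ∀ (c : ℝ) {u}, u ∈ P.dom → c • u ∈ P.dom
  val_add : ∀ u v, P.val (u + v) = P.val u + P.val v
  val_smul : ∀ (c : ℝ) u, P.val (c • u) = c • P.val u
  continuous_val : ∀ {u}, u ∈ P.dom → Continuous (P.val u)
  bounded_val : ∀ {u}, u ∈ P.dom → ∃ C, ∀ x, |P.val u x| ≤ C
  continuous_deriv : ∀ {u}, u ∈ P.dom → Continuous fun p : X × M => d u p.1 p.2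
  bounded_deriv : ∀ {u}, u ∈ P.dom → ∃ C, ∀ x y, |d u x y| ≤ C
  norm_deriv : ∀ {u}, u ∈ P.dom → ∃ C, ∀ x, ‖toL2 (κ x) (d u x)‖ ≤ C
  deriv_add : ∀ {u v}, u ∈ P.dom → v ∈ P.dom → ∀ x y, d (u + v) x y = d u x y + d v x y
  deriv_smul : ∀ (c : ℝ) {u}, u ∈ P.dom → ∀ x y, d (c • u) x y = c * d u x y
  chain : ∀ {φ : ℝ → ℝ} {u}, ContDiff ℝ 1 φ → u ∈ P.dom → ∃ z ∈ P.dom,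
    (∀ x, P.val z x = φ (P.val u x)) ∧ ∀ x y, d z x y = deriv φ (P.val u x) * d u x y

variable {κ : X → Measure M} {P : PreForm α X} {d : α → X → M → ℝ}

theorem DerivationClass.memLp [OpensMeasurableSpace M] (hP : DerivationClass κ P d)
    (hfin : ∀ x, IsFiniteMeasure (κ x)) {u : α} (hu : u ∈ P.dom) (x : X) :
    MemLp (d u x) 2 (κ x) := by
  have := hfin x
  obtain ⟨C, hC⟩ := hP.bounded_deriv hu
  exact memLp_of_bounded ((hP.continuous_deriv hu).comp
    (by fun_prop : Continuous fun y => (x, y))).measurable (hC x)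

/-- The chain rule survives for arbitrary operators A(x), even nonlocal on M: the factor φ'(u(x))
does not depend on the point of M, so linearity of A(x) is enough. The integrable majorant is ‖A‖
times the two L² bounds on the derivatives. -/
theorem DerivationClass.diffusionCore [MeasurableSpace X] [BorelSpace X]
    [SecondCountableTopology X] [BorelSpace M] [SecondCountableTopology M]
    (hP : DerivationClass κ P d) (hκ : Measurable κ) (hfin : ∀ x, IsFiniteMeasure (κ x))
    {m : Measure X} (A : ∀ x, Lp ℝ 2 (κ x) →L[ℝ] Lp ℝ 2 (κ x))
    (hpos : ∀ x, (A x).IsPositive)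
    (hA : ∀ η : (X × M) →ᵇ ℝ, ∃ G : X × M → ℝ, Measurable G ∧
      ∀ x, ∀ᵐ y ∂κ x, A x (toL2 (κ x) fun y => η (x, y)) y = G (x, y))
    (hAint : Integrable (fun x => ‖A x‖) m)
    (hform : ∀ u v, P.form u v = ∫ x, energy A (d u) (d v) x ∂m) :
    DiffusionCore m P fun u v => energy A (d u) (d v) where
  zero_mem := hP.zero_mem
  add_mem := hP.add_mem
  smul_mem := hP.smul_mem
  val_add := hP.val_add
  val_smul := hP.val_smul
  continuous_val := hP.continuous_val
  bounded_val := hP.bounded_val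
  form_eq _ _ := hform _ _
  integrable {u v} hu hv := by
    obtain ⟨Cu, hCu⟩ := hP.bounded_deriv hu
    obtain ⟨Cv, hCv⟩ := hP.bounded_deriv hv
    obtain ⟨Nu, hNu⟩ := hP.norm_deriv hu
    obtain ⟨Nv, hNv⟩ := hP.norm_deriv hv
    refine (hAint.mul_const (Nu * Nv)).mono' (measurable_energy A hκ hfin hA
      (hP.continuous_deriv hu) hCu (hP.continuous_deriv hv) hCv).aestronglyMeasurable
      (Eventually.of_forall fun x => (abs_energy_le A _ _ x).trans ?_)
    rw [mul_assoc]
    refine mul_le_mul_of_nonneg_left ?_ (norm_nonneg _)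
    exact mul_le_mul (hNu x) (hNv x) (norm_nonneg _) ((norm_nonneg _).trans (hNu x))
  add_left {u v w} hu hv _ x := by
    have h : toL2 (κ x) (d (u + v) x) = toL2 (κ x) (d u x) + toL2 (κ x) (d v x) := by
      rw [← toL2_add (hP.memLp hfin hu x) (hP.memLp hfin hv x)]
      exact congrArg _ (funext fun y => hP.deriv_add hu hv x y)
    simp only [energy]
    rw [h, map_add, inner_add_left]
  smul_left c {u w} hu _ x := by
    have h : toL2 (κ x) (d (c • u) x) = c • toL2 (κ x) (d u x) := by
      rw [← toL2_const_mul c (hP.memLp hfin hu x)]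
      exact congrArg _ (funext fun y => hP.deriv_smul c hu x y)
    simp only [energy]
    rw [h, map_smul, real_inner_smul_left]
  symm _ _ x := energy_symm A hpos _ _ x
  nonneg _ x := energy_nonneg A hpos _ x
  chain {φ u} hφ hu := by
    obtain ⟨z, hz, hval, hd⟩ := hP.chain hφ hu
    refine ⟨z, hz, hval, fun v _ x => ?_⟩
    have h : toL2 (κ x) (d z x) = deriv φ (P.val u x) • toL2 (κ x) (d u x) := by
      rw [← toL2_const_mul _ (hP.memLp hfin hu x)]
      exact congrArg _ (funext fun y => hd x y)
    simp only [energy]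
    rw [h, map_smul, real_inner_smul_left]

end Derivations

/-! ### Comparison of the inner products of `L²(lam)` and `L²(h² lam)` -/

section Lift

variable {M : Type*} [MeasurableSpace M] {lam : Measure M} {h : Lp ℝ 2 lam} {κ : Measure M}
  {c : ℝ}

theorem integral_of_eq_smul_sqMeasure (hc : 0 < c) (hκ : κ = ENNReal.ofReal c • sqMeasure h)
    (f : M → ℝ) : ∫ x, f x ∂κ = c * ∫ x, h x ^ 2 * f x ∂lam := by
  rw [hκ, integral_smul_measure, integral_sqMeasure, ENNReal.toReal_ofReal hc.le, smul_eq_mul]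

theorem ae_of_eq_smul_sqMeasure (hκ : κ = ENNReal.ofReal c • sqMeasure h) {p : M → Prop}
    (hp : ∀ᵐ x ∂lam, h x ≠ 0 → p x) : ∀ᵐ x ∂κ, p x := by
  rw [hκ]
  refine Measure.ae_smul_measure ?_ _
  rw [sqMeasure, ae_withDensity_iff' (measurable_ofReal_sq h)]
  filter_upwards [hp] with x hx h0
  refine hx fun h1 => h0 ?_
  simp [h1]

theorem memLp_mul_of_eq_smul_sqMeasure (hc : 0 < c) (hκ : κ = ENNReal.ofReal c • sqMeasure h)
    (Φ : Lp ℝ 2 κ) : MemLp (fun x => h x * Φ x) 2 lam := by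
  have hΦ : StronglyMeasurable Φ := Lp.stronglyMeasurable Φ
  refine (memLp_two_iff_integrable_sq
    ((Lp.aestronglyMeasurable h).mul hΦ.aestronglyMeasurable)).2 ?_
  have h0 : ∀ κ' : Measure M, κ = κ' → Integrable (fun x => Φ x ^ 2) κ' := by
    rintro _ rfl
    exact (Lp.memLp Φ).integrable_sq
  have h1 := h0 _ hκ
  rw [integrable_smul_measure (ENNReal.ofReal_pos.2 hc).ne' ENNReal.ofReal_ne_top, sqMeasure,
    integrable_withDensity_iff_integrable_smul₀' (measurable_ofReal_sq h)
      (Eventually.of_forall fun x => ENNReal.ofReal_lt_top)] at h1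
  refine h1.congr (Eventually.of_forall fun x => ?_)
  simp only [smul_eq_mul]
  rw [ENNReal.toReal_ofReal (sq_nonneg _), Pi.mul_apply, mul_pow]

/-- Division by h is harmless because κ does not charge {h = 0}, so G₁/h and a agree in L²(κ). The
density c h² of κ then accounts for the two factors h and for c⁻¹. -/
theorem inner_lift_eq (hc : 0 < c) (hκ : κ = ENNReal.ofReal c • sqMeasure h)
    (T : Lp ℝ 2 κ →L[ℝ] Lp ℝ 2 κ) {a b : M → ℝ} (hb : MemLp b 2 κ)
    {G₁ G₂ : Lp ℝ 2 lam} (h₁ : G₁ =ᵐ[lam] fun x => h x * a x)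
    (h₂ : G₂ =ᵐ[lam] fun x => h x * b x) :
    inner ℝ (toL2 lam fun x => h x * T (toL2 κ fun y => G₁ y / h y) x) G₂ =
      c⁻¹ * inner ℝ (T (toL2 κ a)) (toL2 κ b) := by
  have e : toL2 κ (fun y => G₁ y / h y) = toL2 κ a := by
    refine toL2_congr (ae_of_eq_smul_sqMeasure hκ ?_)
    filter_upwards [h₁] with x hx h0
    rw [hx, mul_div_cancel_left₀ _ h0]
  rw [e, L2.inner_def, L2.inner_def]
  have h3 : ∫ x, inner ℝ (T (toL2 κ a) x) (toL2 κ b x) ∂κ = ∫ x, T (toL2 κ a) x * b x ∂κ := by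
    refine integral_congr_ae ?_
    filter_upwards [coeFn_toL2 hb] with x hx
    rw [hx]
    simp only [RCLike.inner_apply, conj_trivial]
    exact mul_comm _ _
  rw [h3, integral_of_eq_smul_sqMeasure hc hκ, inv_mul_cancel_left₀ hc.ne']
  refine integral_congr_ae ?_
  filter_upwards [h₂, coeFn_toL2 (memLp_mul_of_eq_smul_sqMeasure hc hκ (T (toL2 κ a)))] with x h4 h5
  rw [h4, h5]
  simp only [RCLike.inner_apply, conj_trivial]
  ring

end Lift

/-! ### Calculus of the extrinsic derivative -/

section ExtCalculus

theorem tendsto_toNNReal_nhdsGT : Tendsto Real.toNNReal (𝓝[>] 0) (𝓝[>] 0) := by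
  refine tendsto_nhdsWithin_iff.2 ⟨?_, ?_⟩
  · have := (continuous_real_toNNReal.tendsto 0).mono_left (nhdsWithin_le_nhds (s := Set.Ioi 0))
    simpa using this
  · filter_upwards [self_mem_nhdsWithin] with t ht
    exact Real.toNNReal_pos.2 ht

theorem tendsto_coe_nnreal_nhdsGT : Tendsto ((↑) : ℝ≥0 → ℝ) (𝓝[>] 0) (𝓝[>] 0) := by
  refine tendsto_nhdsWithin_iff.2 ⟨?_, ?_⟩
  · have := (NNReal.continuous_coe.tendsto 0).mono_left (nhdsWithin_le_nhds (s := Set.Ioi 0))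
    simpa using this
  · filter_upwards [self_mem_nhdsWithin] with t ht
    exact_mod_cast ht

/-- It transfers the limit over nonnegative ε to a right derivative at 0 on the real line, where
one-variable calculus is available. -/
theorem tendsto_extQuot_iff {M : Type*} [MeasurableSpace M] {u : FiniteMeasure M → ℝ}
    {μ : FiniteMeasure M} {x : M} {d : ℝ} :
    Tendsto (extQuot u μ x) (𝓝[>] 0) (𝓝 d) ↔
      HasDerivWithinAt (fun t : ℝ => u (μ + t.toNNReal • diracF x)) d (Set.Ici 0) 0 := by
  rw [← hasDerivWithinAt_Ioi_iff_Ici, hasDerivWithinAt_iff_tendsto_slope' (by simp)]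
  constructor
  · intro h
    refine (h.comp tendsto_toNNReal_nhdsGT).congr' ?_
    filter_upwards [self_mem_nhdsWithin] with t ht
    simp [extQuot, slope_def_field, Real.coe_toNNReal t (le_of_lt ht)]
  · intro h
    refine (h.comp tendsto_coe_nnreal_nhdsGT).congr' (Eventually.of_forall fun t => ?_)
    simp [extQuot, slope_def_field]

variable {M : Type*} [TopologicalSpace M] [MeasurableSpace M] [OpensMeasurableSpace M]
  {u v : FiniteMeasure M → ℝ} {D D' : FiniteMeasure M → M → ℝ} {C C' : ℝ}

namespace HasExtDeriv

theorem extDeriv_eq (hu : HasExtDeriv u D C) : extDeriv u = D := by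
  funext μ x
  exact (tendsto_extQuot_iff.2 (hu.hasDeriv μ x)).limUnder_eq

theorem cbE1 (hu : HasExtDeriv u D C) {B : ℝ} (hB : ∀ μ, |u μ| ≤ B) : CbE1 u where
  continuous := hu.continuous
  hasDeriv μ x := by
    rw [hu.extDeriv_eq]
    exact tendsto_extQuot_iff.2 (hu.hasDeriv μ x)
  continuous_deriv := by
    rw [hu.extDeriv_eq]
    exact hu.continuous_deriv
  bounded := by
    rw [hu.extDeriv_eq]
    exact ⟨B + C, fun μ x => add_le_add (hB μ) (hu.bound μ x)⟩

theorem add (hu : HasExtDeriv u D C) (hv : HasExtDeriv v D' C') :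
    HasExtDeriv (u + v) (fun μ x => D μ x + D' μ x) (C + C') where
  continuous := hu.continuous.add hv.continuous
  continuous_deriv := hu.continuous_deriv.add hv.continuous_deriv
  bound μ x := (abs_add_le _ _).trans (add_le_add (hu.bound μ x) (hv.bound μ x))
  hasDeriv μ x := (hu.hasDeriv μ x).add (hv.hasDeriv μ x)

theorem const_smul (c : ℝ) (hu : HasExtDeriv u D C) :
    HasExtDeriv (c • u) (fun μ x => c * D μ x) (|c| * C) where
  continuous := hu.continuous.const_smul c
  continuous_deriv := continuous_const.mul hu.continuous_deriv
  bound μ x := by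
    rw [abs_mul]
    exact mul_le_mul_of_nonneg_left (hu.bound μ x) (abs_nonneg c)
  hasDeriv μ x := (hu.hasDeriv μ x).const_mul c

theorem comp {φ : ℝ → ℝ} (hφ : ContDiff ℝ 1 φ) {K : ℝ} (hu : HasExtDeriv u D C)
    (hK : ∀ μ, |deriv φ (u μ)| ≤ K) :
    HasExtDeriv (fun μ => φ (u μ)) (fun μ x => deriv φ (u μ) * D μ x) (K * C) where
  continuous := hφ.continuous.comp hu.continuous
  continuous_deriv := (((hφ.continuous_deriv le_rfl).comp hu.continuous).comp continuous_fst).mul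
    hu.continuous_deriv
  bound μ x := by
    rw [abs_mul]
    exact mul_le_mul (hK μ) (hu.bound μ x) (abs_nonneg _) ((abs_nonneg _).trans (hK μ))
  hasDeriv μ x := by
    have h1 : HasDerivAt φ (deriv φ (u μ)) (u (μ + (0 : ℝ).toNNReal • diracF x)) := by
      simpa using ((hφ.differentiable one_ne_zero) (u μ)).hasDerivAt
    exact h1.comp_hasDerivWithinAt 0 (hu.hasDeriv μ x)

end HasExtDeriv

theorem integral_add_smul_diracF (f : M →ᵇ ℝ) (μ : FiniteMeasure M) (x : M) {t : ℝ} (ht : 0 ≤ t) :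
    ∫ y, f y ∂((μ + t.toNNReal • diracF x : FiniteMeasure M) : Measure M) =
      ∫ y, f y ∂(μ : Measure M) + t * f x := by
  rw [FiniteMeasure.toMeasure_add, integral_add_measure (f.integrable _) (f.integrable _),
    FiniteMeasure.toMeasure_smul, integral_smul_nnreal_measure]
  change _ + t.toNNReal • ∫ y, f y ∂Measure.dirac x = _
  rw [integral_dirac' _ _ f.continuous.measurable.stronglyMeasurable, NNReal.smul_def,
    Real.coe_toNNReal t ht, smul_eq_mul]

/-- Integrals of nonnegative functions stay in [0, ∞), so g' is only required to be controlled
there; this matters for √(1 + a). -/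
theorem hasExtDeriv_integral {g g' : ℝ → ℝ} {K : ℝ} (hg : Continuous g)
    (hg' : ∀ a, 0 ≤ a → HasDerivAt g (g' a) a) (hc : ContinuousOn g' (Set.Ici 0))
    (hK : ∀ a, 0 ≤ a → |g' a| ≤ K) {f : M →ᵇ ℝ} (hf : ∀ x, 0 ≤ f x) :
    HasExtDeriv (fun μ : FiniteMeasure M => g (∫ y, f y ∂(μ : Measure M)))
      (fun μ x => g' (∫ y, f y ∂(μ : Measure M)) * f x) (K * ‖f‖) where
  continuous := hg.comp (FiniteMeasure.continuous_integral_boundedContinuousFunction f)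
  continuous_deriv := by
    have h1 : Continuous fun μ : FiniteMeasure M => g' (∫ y, f y ∂(μ : Measure M)) :=
      hc.comp_continuous (FiniteMeasure.continuous_integral_boundedContinuousFunction f)
        fun μ => Set.mem_Ici.2 (integral_nonneg hf)
    exact (h1.comp continuous_fst).mul (f.continuous.comp continuous_snd)
  bound μ x := by
    rw [abs_mul]
    have h0 := hK _ (integral_nonneg (μ := (μ : Measure M)) hf)
    exact mul_le_mul h0 (f.norm_coe_le_norm x) (abs_nonneg _) ((abs_nonneg _).trans h0)
  hasDeriv μ x := by
    have h1 : HasDerivWithinAt (fun t : ℝ => ∫ y, f y ∂(μ : Measure M) + t * f x) (f x)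
        (Set.Ici 0) 0 := by
      simpa using (((hasDerivAt_id (0 : ℝ)).mul_const (f x)).const_add
        (∫ y, f y ∂(μ : Measure M))).hasDerivWithinAt
    have h2 : HasDerivAt g (g' (∫ y, f y ∂(μ : Measure M)))
        (∫ y, f y ∂(μ : Measure M) + (0 : ℝ) * f x) := by
      simpa using hg' _ (integral_nonneg (μ := (μ : Measure M)) hf)
    refine (h2.comp_hasDerivWithinAt 0 h1).congr (fun t ht => ?_) ?_
    · simp only [integral_add_smul_diracF f μ x ht, Function.comp]
    · simp only [integral_add_smul_diracF f μ x le_rfl, Function.comp]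

theorem CbE1.hasExtDeriv (hu : CbE1 u) : ∃ C, HasExtDeriv u (extDeriv u) C := by
  obtain ⟨C, hC⟩ := hu.bounded
  exact ⟨C, hu.continuous, hu.continuous_deriv, fun μ x => by
    linarith [hC μ x, abs_nonneg (u μ)], fun μ x => tendsto_extQuot_iff.1 (hu.hasDeriv μ x)⟩

/-- The bound in the class is quantified over pairs (μ, x), so a point of M is needed to extract a
bound on u alone. -/
theorem CbE1.exists_bound [Nonempty M] (hu : CbE1 u) : ∃ B, ∀ μ, |u μ| ≤ B := by
  obtain ⟨C, hC⟩ := hu.bounded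
  obtain ⟨x⟩ := ‹Nonempty M›
  exact ⟨C, fun μ => by linarith [hC μ x, abs_nonneg (extDeriv u μ x)]⟩

theorem exists_abs_le_of_bounded {φ : ℝ → ℝ} (hφ : Continuous φ) {β : Type*} {f : β → ℝ} {B : ℝ}
    (hB : ∀ x, |f x| ≤ B) : ∃ K, ∀ x, |φ (f x)| ≤ K := by
  obtain ⟨K, hK⟩ := (isCompact_Icc (a := -B) (b := B)).exists_bound_of_continuousOn
    hφ.continuousOn
  exact ⟨K, fun x => hK _ (abs_le.1 (hB x))⟩

end ExtCalculus

/-! ### The form on functions of finite measures -/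

section FiniteMeasures

variable {M : Type*} [TopologicalSpace M] [MeasurableSpace M] [BorelSpace M]
  {lam : Measure M} {u v : FiniteMeasure M → ℝ}

theorem HasExtDeriv.memLp {D : FiniteMeasure M → M → ℝ} {C : ℝ} (hu : HasExtDeriv u D C)
    (μ : AcMeasure lam) : MemLp (D μ.toFinite) 2 μ.meas :=
  memLp_of_bounded (hu.continuous_section _).measurable (hu.bound _)

theorem HasExtDeriv.cbE12 {D : FiniteMeasure M → M → ℝ} {C : ℝ} (hu : HasExtDeriv u D C) {B N : ℝ}
    (hB : ∀ μ, |u μ| ≤ B) (hN : ∀ μ : AcMeasure lam, ‖toL2 μ.meas (D μ.toFinite)‖ ≤ N) :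
    CbE12 lam u where
  toCbE1 := hu.cbE1 hB
  bounded_L2 := by
    refine ⟨N.toNNReal, fun μ => ?_⟩
    rw [hu.extDeriv_eq, ← ENNReal.ofReal_toReal (hu.memLp μ).2.ne, ← norm_toL2_eq (hu.memLp μ)]
    exact ENNReal.ofReal_le_ofReal (hN μ)

theorem CbE12.norm_extDeriv (hu : CbE12 lam u) :
    ∃ N, ∀ μ : AcMeasure lam, ‖toL2 μ.meas (extDeriv u μ.toFinite)‖ ≤ N := by
  obtain ⟨N, hN⟩ := hu.bounded_L2
  obtain ⟨C, hC⟩ := hu.hasExtDeriv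
  refine ⟨N, fun μ => ?_⟩
  rw [norm_toL2_eq (hC.memLp μ)]
  exact ENNReal.toReal_le_coe_of_le_coe (hN μ)

theorem cbE12_zero : CbE12 lam (0 : FiniteMeasure M → ℝ) := by
  have h : HasExtDeriv (0 : FiniteMeasure M → ℝ) (fun _ _ => 0) 0 :=
    ⟨continuous_const, continuous_const, fun _ _ => by simp, fun μ x =>
      hasDerivWithinAt_const _ _ _⟩
  refine h.cbE12 (B := 0) (N := 0) (fun _ => by simp) fun μ => ?_
  have e := toL2_const_mul (m := μ.meas) 0 (h.memLp μ)
  simp only [mul_zero, zero_smul] at e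
  rw [e, norm_zero]

theorem CbE12.add [Nonempty M] (hu : CbE12 lam u) (hv : CbE12 lam v) : CbE12 lam (u + v) := by
  obtain ⟨Cu, hCu⟩ := hu.hasExtDeriv
  obtain ⟨Cv, hCv⟩ := hv.hasExtDeriv
  obtain ⟨Bu, hBu⟩ := hu.exists_bound
  obtain ⟨Bv, hBv⟩ := hv.exists_bound
  obtain ⟨Nu, hNu⟩ := hu.norm_extDeriv
  obtain ⟨Nv, hNv⟩ := hv.norm_extDeriv
  refine (hCu.add hCv).cbE12 (B := Bu + Bv) (N := Nu + Nv)
    (fun μ => (abs_add_le _ _).trans (add_le_add (hBu μ) (hBv μ))) fun μ => ?_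
  rw [toL2_add (hCu.memLp μ) (hCv.memLp μ)]
  exact (norm_add_le _ _).trans (add_le_add (hNu μ) (hNv μ))

theorem CbE12.const_smul [Nonempty M] (c : ℝ) (hu : CbE12 lam u) : CbE12 lam (c • u) := by
  obtain ⟨Cu, hCu⟩ := hu.hasExtDeriv
  obtain ⟨Bu, hBu⟩ := hu.exists_bound
  obtain ⟨Nu, hNu⟩ := hu.norm_extDeriv
  refine (hCu.const_smul c).cbE12 (B := |c| * Bu) (N := |c| * Nu) (fun μ => ?_) fun μ => ?_
  · rw [Pi.smul_apply, smul_eq_mul, abs_mul]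
    exact mul_le_mul_of_nonneg_left (hBu μ) (abs_nonneg c)
  · rw [toL2_const_mul c (hCu.memLp μ), norm_smul, Real.norm_eq_abs]
    exact mul_le_mul_of_nonneg_left (hNu μ) (abs_nonneg c)

theorem CbE12.comp [Nonempty M] {φ : ℝ → ℝ} (hφ : ContDiff ℝ 1 φ) (hu : CbE12 lam u) :
    CbE12 lam (fun μ => φ (u μ)) ∧
      extDeriv (fun μ => φ (u μ)) = fun μ x => deriv φ (u μ) * extDeriv u μ x := by
  obtain ⟨C, hC⟩ := hu.hasExtDeriv
  obtain ⟨B, hB⟩ := hu.exists_bound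
  obtain ⟨N, hN⟩ := hu.norm_extDeriv
  obtain ⟨K, hK⟩ := exists_abs_le_of_bounded (hφ.continuous_deriv le_rfl) hB
  obtain ⟨B', hB'⟩ := exists_abs_le_of_bounded hφ.continuous hB
  have h := hC.comp hφ hK
  refine ⟨h.cbE12 (B := B') (N := K * N) hB' fun μ => ?_, h.extDeriv_eq⟩
  rw [toL2_const_mul _ (hC.memLp μ), norm_smul, Real.norm_eq_abs]
  exact mul_le_mul (hK _) (hN μ) (norm_nonneg _) ((abs_nonneg _).trans (hK μ.toFinite))

theorem derivationClassM [SigmaFinite lam] [Nonempty M] (Lam : Measure (AcMeasure lam))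
    (A : FamilyM lam) :
    DerivationClass (fun μ : AcMeasure lam => μ.meas) (measureFormM Lam A)
      fun u μ => extDeriv u μ.toFinite where
  zero_mem := cbE12_zero
  add_mem hu hv := CbE12.add hu hv
  smul_mem c _ hu := CbE12.const_smul c hu
  val_add _ _ := rfl
  val_smul _ _ := rfl
  continuous_val hu := (CbE1.continuous (CbE12.toCbE1 hu)).comp AcMeasure.continuous_toFinite
  bounded_val hu := by
    obtain ⟨B, hB⟩ := CbE1.exists_bound (CbE12.toCbE1 hu)
    exact ⟨B, fun μ => hB _⟩
  continuous_deriv {u} hu := by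
    have h : Continuous fun p : FiniteMeasure M × M => extDeriv u p.1 p.2 :=
      CbE1.continuous_deriv (CbE12.toCbE1 hu)
    exact h.comp (f := fun p : AcMeasure lam × M => (p.1.toFinite, p.2))
      ((AcMeasure.continuous_toFinite.comp continuous_fst).prodMk continuous_snd)
  bounded_deriv hu := by
    obtain ⟨C, hC⟩ := CbE1.hasExtDeriv (CbE12.toCbE1 hu)
    exact ⟨C, fun μ x => hC.bound _ x⟩
  norm_deriv hu := CbE12.norm_extDeriv hu
  deriv_add hu hv μ x := by
    obtain ⟨Cu, hCu⟩ := CbE1.hasExtDeriv (CbE12.toCbE1 hu)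
    obtain ⟨Cv, hCv⟩ := CbE1.hasExtDeriv (CbE12.toCbE1 hv)
    rw [(hCu.add hCv).extDeriv_eq]
  deriv_smul c _ hu μ x := by
    obtain ⟨Cu, hCu⟩ := CbE1.hasExtDeriv (CbE12.toCbE1 hu)
    rw [(hCu.const_smul c).extDeriv_eq]
  chain hφ hu := by
    obtain ⟨h1, h2⟩ := CbE12.comp hφ hu
    exact ⟨_, h1, fun μ => rfl, fun μ x => congrFun (congrFun h2 μ.toFinite) x⟩

variable [PolishSpace M]

theorem diffusionCoreM [SigmaFinite lam] [Nonempty M] {Lam : Measure (AcMeasure lam)}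
    {A : FamilyM lam}
    (hA : AdmissibleM Lam A) : DiffusionCore Lam (measureFormM Lam A) (integrandM A) :=
  (derivationClassM Lam A).diffusionCore AcMeasure.measurable_meas (fun _ => inferInstance) A
    hA.positive hA.measurable hA.integrable fun _ _ => rfl

/-- The bump functions on finite measures. -/
def bumpM (ν : AcMeasure lam) (j : ℕ) (μ : FiniteMeasure M) : ℝ :=
  bump (√(1 + ∫ x, testFun M j x ∂ν.meas)) (∫ x, testFun M j x ∂(μ : Measure M))

theorem hasExtDeriv_bumpM (ν : AcMeasure lam) (j : ℕ) :
    HasExtDeriv (bumpM ν j) (fun μ x => bumpDeriv (√(1 + ∫ x, testFun M j x ∂ν.meas))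
      (∫ x, testFun M j x ∂(μ : Measure M)) * testFun M j x) (1 / 2 * ‖testFun M j‖) := by
  refine hasExtDeriv_integral (continuous_bump _) (fun a ha => hasDerivAt_bump _ ha)
    (continuousOn_bumpDeriv _) (fun a ha => (abs_bumpDeriv_le _ ha).trans ?_) (testFun_nonneg j)
  have h1 : 1 ≤ √(1 + a) := Real.one_le_sqrt.2 (by linarith)
  rw [div_le_div_iff₀ (by positivity) (by positivity)]
  linarith

/-- With a = μ(f) and f² ≤ f, the squared norm is at most a / (4(1 + a)), uniformly in the mass of
μ, the centre and the test function. -/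
theorem norm_toL2_bumpM_le (ν : AcMeasure lam) (j : ℕ) (μ : AcMeasure lam) :
    ‖toL2 μ.meas fun x => bumpDeriv (√(1 + ∫ x, testFun M j x ∂ν.meas))
      (∫ x, testFun M j x ∂μ.meas) * testFun M j x‖ ≤ 1 := by
  set a := ∫ x, testFun M j x ∂μ.meas with ha
  have ha0 : 0 ≤ a := integral_testFun_nonneg _ _
  have hf : MemLp (testFun M j) 2 μ.meas := memLp_of_bounded (testFun M j).continuous.measurable
    (testFun M j).norm_coe_le_norm
  rw [toL2_const_mul _ hf, norm_smul, Real.norm_eq_abs]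
  refine abs_le_of_sq_le_sq' ?_ zero_le_one |>.2
  have h1 : ‖toL2 μ.meas (testFun M j)‖ ^ 2 ≤ a := by
    rw [norm_toL2_sq hf]
    refine integral_mono hf.integrable_sq ((testFun M j).integrable _) fun x => ?_
    have := testFun_nonneg j x
    have := testFun_le_one j x
    simp only []
    nlinarith
  have h2 : bumpDeriv (√(1 + ∫ x, testFun M j x ∂ν.meas)) a ^ 2 ≤ 1 / (4 * (1 + a)) := by
    have h3 := pow_le_pow_left₀ (abs_nonneg _)
      (abs_bumpDeriv_le (√(1 + ∫ x, testFun M j x ∂ν.meas)) ha0) 2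
    rw [sq_abs] at h3
    refine h3.trans (le_of_eq ?_)
    rw [div_pow, mul_pow, Real.sq_sqrt (by linarith)]
    norm_num
  rw [mul_pow, sq_abs]
  calc _ ≤ 1 / (4 * (1 + a)) * a := mul_le_mul h2 h1 (sq_nonneg _) (by positivity)
    _ ≤ 1 ^ 2 := by
      rw [one_div_mul_eq_div, one_pow, div_le_one (by positivity)]
      linarith

theorem barrierM [SigmaFinite lam] {Lam : Measure (AcMeasure lam)} {A : FamilyM lam}
    (hA : AdmissibleM Lam A) {ν : ℕ → AcMeasure lam} (hν : DenseRange ν) :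
    Barrier Lam (measureFormM Lam A) (integrandM A) (fun μ => ‖A μ‖) fun k j => bumpM (ν k) j where
  integrable := hA.integrable
  mem k j := (hasExtDeriv_bumpM (ν k) j).cbE12 (B := 1) (N := 1)
    (fun μ => by rw [bumpM, abs_of_nonneg (bump_nonneg _ _)]; exact bump_le_one _ _)
    fun μ => norm_toL2_bumpM_le (ν k) j μ
  nonneg _ _ _ := bump_nonneg _ _
  le_one _ _ _ := bump_le_one _ _
  energy k j μ := by
    have h := norm_toL2_bumpM_le (ν k) j μ
    have e := (hasExtDeriv_bumpM (ν k) j).extDeriv_eq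
    refine (le_abs_self _).trans ((abs_energy_le A (fun μ => extDeriv (bumpM (ν k) j) μ.toFinite)
      (fun μ => extDeriv (bumpM (ν k) j) μ.toFinite) μ).trans ?_)
    simp only [e]
    rw [mul_assoc]
    exact mul_le_of_le_one_right (norm_nonneg _) (mul_le_one₀ h (norm_nonneg _) h)
  nhds μ O hO hμ i₀ := by
    obtain ⟨r, hr, hball⟩ := Metric.isOpen_iff.1 hO μ hμ
    obtain ⟨i, hi, r', hr', h⟩ := exists_nearBy_nhds μ hr i₀
    obtain ⟨k, hk⟩ := hν.exists_dist_lt μ hr'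
    rw [dist_comm] at hk
    exact ⟨k, i, hi, (h _ hk).1, fun μ' hμ' => hball ((h _ hk).2 μ' hμ')⟩
  compact n := isCompact_nearBy ν n

variable [SigmaFinite lam] {A : FamilyM lam}

/-- The norm of 2hD in L²(lam) is twice the norm of D in L²(h² lam); boundedness of the gradient on
all of H is thus the extra condition in `CbE12`. -/
theorem cb1_comp_psiM [Nonempty M] (hu : CbE12 lam u) :
    Cb1 fun h : Lp ℝ 2 lam => u (psiM h).toFinite := by
  obtain ⟨C, hC⟩ := hu.hasExtDeriv
  obtain ⟨B, hB⟩ := hu.exists_bound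
  obtain ⟨N, hN⟩ := hu.norm_extDeriv
  refine ⟨hC.contDiff, B + 2 * N, fun h => add_le_add (hB _) ?_⟩
  rw [(hC.hasGradientAt h).gradient]
  have hN0 : 0 ≤ N := (norm_nonneg _).trans (hN (psiM h))
  refine abs_le_of_sq_le_sq' ?_ (by positivity) |>.2
  rw [hC.norm_liftGrad_sq, ← norm_toL2_sq (hC.memLp (psiM h)), mul_pow]
  have := pow_le_pow_left₀ (norm_nonneg _) (hN (psiM h)) 2
  linarith

/-- Both gradients are h times twice the extrinsic derivative, and the two factors 2 give the 4. -/
theorem hilbertIntegrandM_comp_psiM (hu : CbE12 lam u) (hv : CbE12 lam v) (h : Lp ℝ 2 lam) :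
    hilbertIntegrandM A (fun h => u (psiM h).toFinite) (fun h => v (psiM h).toFinite) h =
      4 * integrandM A u v (psiM h) := by
  obtain ⟨Cu, hCu⟩ := hu.hasExtDeriv
  obtain ⟨Cv, hCv⟩ := hv.hasExtDeriv
  have hκ : (psiM h).meas = ENNReal.ofReal 1 • sqMeasure h := by
    rw [ENNReal.ofReal_one, one_smul]
    rfl
  have key := inner_lift_eq one_pos hκ (A (psiM h)) ((hCv.memLp (psiM h)).const_mul 2)
    (G₁ := liftGrad (extDeriv u) h) (G₂ := liftGrad (extDeriv v) h)
    (a := fun x => 2 * extDeriv u (psiM h).toFinite x) (by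
      filter_upwards [hCu.coeFn_liftGrad h] with x hx
      rw [hx]
      ring) (by
      filter_upwards [hCv.coeFn_liftGrad h] with x hx
      rw [hx]
      ring)
  rw [hilbertIntegrandM, hilbertOpM, (hCu.hasGradientAt h).gradient, (hCv.hasGradientAt h).gradient,
    key, toL2_const_mul 2 (hCu.memLp _), toL2_const_mul 2 (hCv.memLp _), map_smul,
    real_inner_smul_left, real_inner_smul_right, integrandM]
  ring

variable [MeasurableSpace (Lp ℝ 2 lam)] [BorelSpace (Lp ℝ 2 lam)] {L0 : Measure (Lp ℝ 2 lam)}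

theorem integrable_integrandM [Nonempty M] (hA : AdmissibleM (lawM L0) A) (hu : CbE12 lam u)
    (hv : CbE12 lam v) :
    Integrable (integrandM A u v) (lawM L0) ∧
      Integrable (hilbertIntegrandM A (fun h => u (psiM h).toFinite)
        (fun h => v (psiM h).toFinite)) L0 := by
  have h1 : Integrable (integrandM A u v) (lawM L0) := (diffusionCoreM hA).integrable hu hv
  refine ⟨h1, ?_⟩
  have h2 : hilbertIntegrandM A (fun h => u (psiM h).toFinite) (fun h => v (psiM h).toFinite) =
      fun h => 4 * integrandM A u v (psiM h) :=
    funext fun h => hilbertIntegrandM_comp_psiM hu hv h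
  rw [h2]
  exact (h1.comp_measurable continuous_psiM.measurable).const_mul 4

theorem measureFormM_eq [Nonempty M] (hA : AdmissibleM (lawM L0) A) (hu : CbE12 lam u)
    (hv : CbE12 lam v) :
    (measureFormM (lawM L0) A).form u v = 1 / 4 * (hilbertFormM L0 A).form
      (fun h => u (psiM h).toFinite) (fun h => v (psiM h).toFinite) := by
  change ∫ μ, integrandM A u v μ ∂(lawM L0) = 1 / 4 * ∫ h, hilbertIntegrandM A _ _ h ∂L0
  rw [lawM, integral_map continuous_psiM.measurable.aemeasurable
    (integrable_integrandM hA hu hv).1.aestronglyMeasurable]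
  simp only [hilbertIntegrandM_comp_psiM hu hv]
  rw [integral_const_mul]
  ring

/-- The pullback multiplies the form by 4, preserves L² norms because the law is an image measure,
and maps into C_b^1(H). -/
theorem isClosable_measureFormM [Nonempty M] (hA : AdmissibleM (lawM L0) A)
    (hcl : (hilbertFormM L0 A).IsClosable L0) :
    (measureFormM (lawM L0) A).IsClosable (lawM L0) := by
  intro s hs hlim
  have hP := diffusionCoreM hA
  have hsub : ∀ n m, CbE12 lam (s n - s m) := fun n m =>
    (hP.core.sub_mem (hs.1 n) (hs.1 m) : s n - s m ∈ hP.core)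
  let s' : ℕ → Lp ℝ 2 lam → ℝ := fun n h => s n (psiM h).toFinite
  have hc : (hilbertFormM L0 A).IsCauchySeq s' := by
    refine ⟨fun n => cb1_comp_psiM (hs.1 n), ?_⟩
    have h1 : ∀ p : ℕ × ℕ, (hilbertFormM L0 A).form (s' p.1 - s' p.2) (s' p.1 - s' p.2) =
        4 * (measureFormM (lawM L0) A).form (s p.1 - s p.2) (s p.1 - s p.2) := fun p => by
      rw [measureFormM_eq hA (hsub _ _) (hsub _ _)]
      have e : (fun h : Lp ℝ 2 lam => (s p.1 - s p.2) (psiM h).toFinite) = s' p.1 - s' p.2 := rfl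
      rw [e]
      ring
    simp only [h1]
    simpa using hs.2.const_mul 4
  have hl : Tendsto (fun n => eLpNorm ((hilbertFormM L0 A).val (s' n)) 2 L0) atTop (𝓝 0) := by
    refine hlim.congr fun n => ?_
    exact eLpNorm_map_measure ((hs.1 n).continuous.comp
      AcMeasure.continuous_toFinite).aestronglyMeasurable continuous_psiM.measurable.aemeasurable
  have h2 := (hcl s' hc hl).const_mul (1 / 4)
  rw [mul_zero] at h2
  exact h2.congr fun n => (measureFormM_eq hA (hs.1 n) (hs.1 n)).symm

theorem exists_closure_measureFormM [Nonempty M] [IsProbabilityMeasure L0]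
    (hA : AdmissibleM (lawM L0) A) (hcl : (hilbertFormM L0 A).IsClosable L0) :
    ∃ F : L2Form (lawM L0), (measureFormM (lawM L0) A).IsClosure F ∧
      F.IsDirichlet ∧ F.IsLocal ∧ F.IsQuasiRegular := by
  have : Nonempty (AcMeasure lam) := ⟨psiM 0⟩
  exact (barrierM hA (TopologicalSpace.denseRange_denseSeq (AcMeasure lam))).exists_closure
    (diffusionCoreM hA) (isClosable_measureFormM hA hcl)

end FiniteMeasures

/-! ### Calculus of the convexity extrinsic derivative -/

section ConvCalculus

/-- The point `t` of the unit interval, truncated. -/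
abbrev clip (t : ℝ) : unitInterval := Set.projIcc 0 1 zero_le_one t

theorem coe_clip {t : ℝ} (h0 : 0 ≤ t) (h1 : t ≤ 1) : (clip t : ℝ) = t := by
  rw [clip, Set.projIcc_of_mem zero_le_one ⟨h0, h1⟩]

theorem clip_zero : clip 0 = 0 := Set.projIcc_left _

theorem tendsto_clip_nhdsGT : Tendsto clip (𝓝[>] 0) (𝓝[>] 0) := by
  refine tendsto_nhdsWithin_iff.2 ⟨?_, ?_⟩
  · have h : Continuous clip := continuous_projIcc
    have := (h.tendsto 0).mono_left (nhdsWithin_le_nhds (s := Set.Ioi 0))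
    rwa [clip_zero] at this
  · filter_upwards [Ioc_mem_nhdsGT zero_lt_one] with t ht
    change (0 : ℝ) < clip t
    rw [coe_clip ht.1.le ht.2]
    exact ht.1

theorem tendsto_coe_unitInterval_nhdsGT :
    Tendsto ((↑) : unitInterval → ℝ) (𝓝[>] 0) (𝓝[>] 0) := by
  refine tendsto_nhdsWithin_iff.2 ⟨?_, ?_⟩
  · exact (continuous_subtype_val.tendsto (0 : unitInterval)).mono_left
      (nhdsWithin_le_nhds (s := Set.Ioi 0))
  · filter_upwards [self_mem_nhdsWithin] with t ht
    exact ht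

theorem nhdsGT_unitInterval_neBot : (𝓝[>] (0 : unitInterval)).NeBot :=
  tendsto_clip_nhdsGT.neBot

theorem mixDirac_zero {M : Type*} [MeasurableSpace M] (μ : ProbabilityMeasure M) (x : M) :
    mixDirac μ x 0 = μ := by
  refine Subtype.ext ?_
  simp [mixDirac]

theorem tendsto_convQuot_iff {M : Type*} [MeasurableSpace M] {u : ProbabilityMeasure M → ℝ}
    {μ : ProbabilityMeasure M} {x : M} {d : ℝ} :
    Tendsto (convQuot u μ x) (𝓝[>] 0) (𝓝 d) ↔
      HasDerivWithinAt (fun t : ℝ => u (mixDirac μ x (clip t))) d (Set.Ici 0) 0 := by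
  rw [← hasDerivWithinAt_Ioi_iff_Ici, hasDerivWithinAt_iff_tendsto_slope' (by simp)]
  constructor
  · intro h
    refine (h.comp tendsto_clip_nhdsGT).congr' ?_
    filter_upwards [Ioc_mem_nhdsGT zero_lt_one] with t ht
    rw [Function.comp, convQuot, slope_def_field, clip_zero, mixDirac_zero, coe_clip ht.1.le ht.2,
      sub_zero]
  · intro h
    refine (h.comp tendsto_coe_unitInterval_nhdsGT).congr' (Eventually.of_forall fun t => ?_)
    have ht : clip (t : ℝ) = t := Set.projIcc_val zero_le_one t
    rw [Function.comp, convQuot, slope_def_field, clip_zero, mixDirac_zero, ht, sub_zero]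

/-- `u` is continuous with right derivatives `D μ x` towards the Dirac measures that are jointly
continuous and bounded by `C`. -/
structure HasConvDeriv {M : Type*} [TopologicalSpace M] [MeasurableSpace M]
    [OpensMeasurableSpace M] (u : ProbabilityMeasure M → ℝ) (D : ProbabilityMeasure M → M → ℝ)
    (C : ℝ) : Prop where
  continuous : Continuous u
  continuous_deriv : Continuous fun p : ProbabilityMeasure M × M => D p.1 p.2
  bound : ∀ μ x, |D μ x| ≤ C
  hasDeriv : ∀ μ x, HasDerivWithinAt (fun t : ℝ => u (mixDirac μ x (clip t))) (D μ x)
    (Set.Ici 0) 0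

variable {M : Type*} [TopologicalSpace M] [MeasurableSpace M] [OpensMeasurableSpace M]
  {u v : ProbabilityMeasure M → ℝ} {D D' : ProbabilityMeasure M → M → ℝ} {C C' : ℝ}

namespace HasConvDeriv

theorem continuous_section (hu : HasConvDeriv u D C) (μ : ProbabilityMeasure M) :
    Continuous (D μ) :=
  hu.continuous_deriv.comp (by fun_prop : Continuous fun x => (μ, x))

theorem convDeriv_eq (hu : HasConvDeriv u D C) : convDeriv u = D := by
  funext μ x
  have := nhdsGT_unitInterval_neBot
  exact (tendsto_convQuot_iff.2 (hu.hasDeriv μ x)).limUnder_eq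

theorem cbE1P (hu : HasConvDeriv u D C) {B : ℝ} (hB : ∀ μ, |u μ| ≤ B) : CbE1P u where
  continuous := hu.continuous
  hasDeriv μ x := by
    rw [hu.convDeriv_eq]
    exact tendsto_convQuot_iff.2 (hu.hasDeriv μ x)
  continuous_deriv := by
    rw [hu.convDeriv_eq]
    exact hu.continuous_deriv
  bounded := by
    rw [hu.convDeriv_eq]
    exact ⟨B + C, fun μ x => add_le_add (hB μ) (hu.bound μ x)⟩

theorem add (hu : HasConvDeriv u D C) (hv : HasConvDeriv v D' C') :
    HasConvDeriv (u + v) (fun μ x => D μ x + D' μ x) (C + C') where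
  continuous := hu.continuous.add hv.continuous
  continuous_deriv := hu.continuous_deriv.add hv.continuous_deriv
  bound μ x := (abs_add_le _ _).trans (add_le_add (hu.bound μ x) (hv.bound μ x))
  hasDeriv μ x := (hu.hasDeriv μ x).add (hv.hasDeriv μ x)

theorem const_smul (c : ℝ) (hu : HasConvDeriv u D C) :
    HasConvDeriv (c • u) (fun μ x => c * D μ x) (|c| * C) where
  continuous := hu.continuous.const_smul c
  continuous_deriv := continuous_const.mul hu.continuous_deriv
  bound μ x := by
    rw [abs_mul]
    exact mul_le_mul_of_nonneg_left (hu.bound μ x) (abs_nonneg c)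
  hasDeriv μ x := (hu.hasDeriv μ x).const_mul c

theorem comp {φ : ℝ → ℝ} (hφ : ContDiff ℝ 1 φ) {K : ℝ} (hu : HasConvDeriv u D C)
    (hK : ∀ μ, |deriv φ (u μ)| ≤ K) :
    HasConvDeriv (fun μ => φ (u μ)) (fun μ x => deriv φ (u μ) * D μ x) (K * C) where
  continuous := hφ.continuous.comp hu.continuous
  continuous_deriv := (((hφ.continuous_deriv le_rfl).comp hu.continuous).comp continuous_fst).mul
    hu.continuous_deriv
  bound μ x := by
    rw [abs_mul]
    exact mul_le_mul (hK μ) (hu.bound μ x) (abs_nonneg _) ((abs_nonneg _).trans (hK μ))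
  hasDeriv μ x := by
    have h1 : HasDerivAt φ (deriv φ (u μ)) (u (mixDirac μ x (clip 0))) := by
      rw [clip_zero, mixDirac_zero]
      exact ((hφ.differentiable one_ne_zero) (u μ)).hasDerivAt
    exact h1.comp_hasDerivWithinAt 0 (hu.hasDeriv μ x)

end HasConvDeriv

theorem integral_mixDirac (f : M →ᵇ ℝ) (μ : ProbabilityMeasure M) (x : M) (t : unitInterval) :
    ∫ y, f y ∂(mixDirac μ x t : Measure M) =
      (1 - (t : ℝ)) * ∫ y, f y ∂(μ : Measure M) + t * f x := by
  have h0 := t.2.1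
  have h1 := t.2.2
  change ∫ y, f y ∂(ENNReal.ofReal (1 - t) • (μ : Measure M) +
    ENNReal.ofReal t • Measure.dirac x) = _
  rw [integral_add_measure ((f.integrable _).smul_measure ENNReal.ofReal_ne_top)
    ((f.integrable _).smul_measure ENNReal.ofReal_ne_top), integral_smul_measure,
    integral_smul_measure, integral_dirac' _ _ f.continuous.measurable.stronglyMeasurable,
    ENNReal.toReal_ofReal (by linarith), ENNReal.toReal_ofReal h0, smul_eq_mul, smul_eq_mul]

/-- Along (1-t)μ + tδ_x the integral of f is affine with slope f(x) - μ(f), at most 1 in absolute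
value when 0 ≤ f ≤ 1. -/
theorem hasConvDeriv_integral {g g' : ℝ → ℝ} {K : ℝ} (hg : Continuous g)
    (hg' : ∀ a, 0 ≤ a → HasDerivAt g (g' a) a) (hc : ContinuousOn g' (Set.Ici 0))
    (hK : ∀ a, 0 ≤ a → |g' a| ≤ K) {f : M →ᵇ ℝ} (hf : ∀ x, 0 ≤ f x) (hf1 : ∀ x, f x ≤ 1) :
    HasConvDeriv (fun μ : ProbabilityMeasure M => g (∫ y, f y ∂(μ : Measure M)))
      (fun μ x => g' (∫ y, f y ∂(μ : Measure M)) * (f x - ∫ y, f y ∂(μ : Measure M))) K where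
  continuous := hg.comp (ProbabilityMeasure.continuous_integral_boundedContinuousFunction f)
  continuous_deriv := by
    have h0 := ProbabilityMeasure.continuous_integral_boundedContinuousFunction f
    have h1 : Continuous fun μ : ProbabilityMeasure M => g' (∫ y, f y ∂(μ : Measure M)) :=
      hc.comp_continuous h0 fun μ => Set.mem_Ici.2 (integral_nonneg fun x => hf x)
    exact (h1.comp continuous_fst).mul
      ((f.continuous.comp continuous_snd).sub (h0.comp continuous_fst))
  bound μ x := by
    have h0 : 0 ≤ ∫ y, f y ∂(μ : Measure M) := integral_nonneg hf
    have h1 : ∫ y, f y ∂(μ : Measure M) ≤ 1 := by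
      calc ∫ y, f y ∂(μ : Measure M) ≤ ∫ _, (1 : ℝ) ∂(μ : Measure M) :=
            integral_mono (f.integrable _) (integrable_const _) hf1
        _ = 1 := by simp
    have h2 : |f x - ∫ y, f y ∂(μ : Measure M)| ≤ 1 := by
      rw [abs_le]
      constructor <;> linarith [hf x, hf1 x]
    rw [abs_mul]
    exact (mul_le_of_le_one_right (abs_nonneg _) h2).trans (hK _ h0)
  hasDeriv μ x := by
    set a := ∫ y, f y ∂(μ : Measure M) with ha
    have h1 : HasDerivWithinAt (fun t : ℝ => (1 - t) * a + t * f x) (f x - a) (Set.Ici 0) 0 := by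
      have := ((((hasDerivAt_id (0 : ℝ)).const_sub 1).mul_const a).add
        ((hasDerivAt_id (0 : ℝ)).mul_const (f x))).hasDerivWithinAt (s := Set.Ici 0)
      refine this.congr_deriv ?_
      ring
    have h2 : HasDerivAt g (g' a) ((1 - (0 : ℝ)) * a + (0 : ℝ) * f x) := by
      simpa using hg' a (integral_nonneg (μ := (μ : Measure M)) hf)
    refine (h2.comp_hasDerivWithinAt 0 h1).congr_of_eventuallyEq ?_ ?_
    · filter_upwards [Icc_mem_nhdsGE zero_lt_one] with t ht
      simp only [integral_mixDirac, coe_clip ht.1 ht.2, Function.comp, ha]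
    · simp only [integral_mixDirac, coe_clip le_rfl zero_le_one, Function.comp, ha]

theorem CbE1P.hasConvDeriv (hu : CbE1P u) : ∃ C, HasConvDeriv u (convDeriv u) C := by
  obtain ⟨C, hC⟩ := hu.bounded
  exact ⟨C, hu.continuous, hu.continuous_deriv, fun μ x => by
    linarith [hC μ x, abs_nonneg (u μ)], fun μ x => tendsto_convQuot_iff.1 (hu.hasDeriv μ x)⟩

theorem CbE1P.exists_bound [Nonempty M] (hu : CbE1P u) : ∃ B, ∀ μ, |u μ| ≤ B := by
  obtain ⟨C, hC⟩ := hu.bounded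
  obtain ⟨x⟩ := ‹Nonempty M›
  exact ⟨C, fun μ => by linarith [hC μ x, abs_nonneg (convDeriv u μ x)]⟩

end ConvCalculus

/-! ### The form on functions of probability measures -/

section ProbabilityMeasures

variable {M : Type*} [TopologicalSpace M] [MeasurableSpace M] [BorelSpace M]
  {u v : ProbabilityMeasure M → ℝ}

theorem cbE1P_zero : CbE1P (0 : ProbabilityMeasure M → ℝ) := by
  have h : HasConvDeriv (0 : ProbabilityMeasure M → ℝ) (fun _ _ => 0) 0 :=
    ⟨continuous_const, continuous_const, fun _ _ => by simp, fun μ x =>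
      hasDerivWithinAt_const _ _ _⟩
  exact h.cbE1P (B := 0) fun _ => by simp

theorem CbE1P.add [Nonempty M] (hu : CbE1P u) (hv : CbE1P v) : CbE1P (u + v) := by
  obtain ⟨Cu, hCu⟩ := hu.hasConvDeriv
  obtain ⟨Cv, hCv⟩ := hv.hasConvDeriv
  obtain ⟨Bu, hBu⟩ := hu.exists_bound
  obtain ⟨Bv, hBv⟩ := hv.exists_bound
  exact (hCu.add hCv).cbE1P (B := Bu + Bv)
    fun μ => (abs_add_le _ _).trans (add_le_add (hBu μ) (hBv μ))

theorem CbE1P.const_smul [Nonempty M] (c : ℝ) (hu : CbE1P u) : CbE1P (c • u) := by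
  obtain ⟨Cu, hCu⟩ := hu.hasConvDeriv
  obtain ⟨Bu, hBu⟩ := hu.exists_bound
  refine (hCu.const_smul c).cbE1P (B := |c| * Bu) fun μ => ?_
  rw [Pi.smul_apply, smul_eq_mul, abs_mul]
  exact mul_le_mul_of_nonneg_left (hBu μ) (abs_nonneg c)

theorem CbE1P.comp [Nonempty M] {φ : ℝ → ℝ} (hφ : ContDiff ℝ 1 φ) (hu : CbE1P u) :
    CbE1P (fun μ => φ (u μ)) ∧
      convDeriv (fun μ => φ (u μ)) = fun μ x => deriv φ (u μ) * convDeriv u μ x := by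
  obtain ⟨C, hC⟩ := hu.hasConvDeriv
  obtain ⟨B, hB⟩ := hu.exists_bound
  obtain ⟨K, hK⟩ := exists_abs_le_of_bounded (hφ.continuous_deriv le_rfl) hB
  obtain ⟨B', hB'⟩ := exists_abs_le_of_bounded hφ.continuous hB
  have h := hC.comp hφ hK
  exact ⟨h.cbE1P (B := B') hB', h.convDeriv_eq⟩

variable {lam : Measure M}

theorem HasConvDeriv.memLp {D : ProbabilityMeasure M → M → ℝ} {C : ℝ} (hu : HasConvDeriv u D C)
    (μ : AcProb lam) : MemLp (D μ.toProb) 2 μ.meas :=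
  memLp_of_bounded (hu.continuous_section _).measurable (hu.bound _)

theorem HasConvDeriv.norm_toL2_le {D : ProbabilityMeasure M → M → ℝ} {C : ℝ}
    (hu : HasConvDeriv u D C) (μ : AcProb lam) : ‖toL2 μ.meas (D μ.toProb)‖ ≤ |C| :=
  ExtrinsicForms.norm_toL2_le (hu.continuous_section _).measurable (abs_nonneg C)
    fun x => (hu.bound _ x).trans (le_abs_self C)

theorem derivationClassP [SigmaFinite lam] [Nonempty M] (Lam : Measure (AcProb lam))
    (A : FamilyP lam) :
    DerivationClass (fun μ : AcProb lam => μ.meas) (measureFormP Lam A)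
      fun u μ => convDeriv u μ.toProb where
  zero_mem := cbE1P_zero
  add_mem hu hv := CbE1P.add hu hv
  smul_mem c _ hu := CbE1P.const_smul c hu
  val_add _ _ := rfl
  val_smul _ _ := rfl
  continuous_val hu := (CbE1P.continuous hu).comp AcProb.continuous_toProb
  bounded_val hu := by
    obtain ⟨B, hB⟩ := CbE1P.exists_bound hu
    exact ⟨B, fun μ => hB _⟩
  continuous_deriv {u} hu := by
    have h : Continuous fun p : ProbabilityMeasure M × M => convDeriv u p.1 p.2 :=
      CbE1P.continuous_deriv hu
    exact h.comp (f := fun p : AcProb lam × M => (p.1.toProb, p.2))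
      ((AcProb.continuous_toProb.comp continuous_fst).prodMk continuous_snd)
  bounded_deriv hu := by
    obtain ⟨C, hC⟩ := CbE1P.hasConvDeriv hu
    exact ⟨C, fun μ x => hC.bound _ x⟩
  norm_deriv hu := by
    obtain ⟨C, hC⟩ := CbE1P.hasConvDeriv hu
    exact ⟨|C|, fun μ => hC.norm_toL2_le μ⟩
  deriv_add hu hv μ x := by
    obtain ⟨Cu, hCu⟩ := CbE1P.hasConvDeriv hu
    obtain ⟨Cv, hCv⟩ := CbE1P.hasConvDeriv hv
    rw [(hCu.add hCv).convDeriv_eq]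
  deriv_smul c _ hu μ x := by
    obtain ⟨Cu, hCu⟩ := CbE1P.hasConvDeriv hu
    rw [(hCu.const_smul c).convDeriv_eq]
  chain hφ hu := by
    obtain ⟨h1, h2⟩ := CbE1P.comp hφ hu
    exact ⟨_, h1, fun μ => rfl, fun μ x => congrFun (congrFun h2 μ.toProb) x⟩

variable [PolishSpace M]

theorem diffusionCoreP [SigmaFinite lam] [Nonempty M] {Lam : Measure (AcProb lam)}
    {A : FamilyP lam} (hA : AdmissibleP Lam A) :
    DiffusionCore Lam (measureFormP Lam A) (integrandP A) :=
  (derivationClassP Lam A).diffusionCore AcProb.measurable_meas (fun _ => inferInstance) A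
    hA.positive hA.measurable hA.integrable fun _ _ => rfl

/-- The bump functions on probability measures. -/
def bumpP (ν : AcProb lam) (j : ℕ) (μ : ProbabilityMeasure M) : ℝ :=
  bump (√(1 + ∫ x, testFun M j x ∂ν.meas)) (∫ x, testFun M j x ∂(μ : Measure M))

theorem hasConvDeriv_bumpP (ν : AcProb lam) (j : ℕ) :
    HasConvDeriv (bumpP ν j) (fun μ x => bumpDeriv (√(1 + ∫ x, testFun M j x ∂ν.meas))
      (∫ x, testFun M j x ∂(μ : Measure M)) *
        (testFun M j x - ∫ x, testFun M j x ∂(μ : Measure M))) 1 := by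
  refine hasConvDeriv_integral (continuous_bump _) (fun a ha => hasDerivAt_bump _ ha)
    (continuousOn_bumpDeriv _) (fun a ha => (abs_bumpDeriv_le _ ha).trans ?_) (testFun_nonneg j)
    (testFun_le_one j)
  have h1 : 1 ≤ √(1 + a) := Real.one_le_sqrt.2 (by linarith)
  rw [div_le_one (by positivity)]
  linarith

/-- The geometry is that of finite measures, restricted along the isometric closed embedding. The
derivative bound is immediate here, since it is a sup bound and the measures have mass 1. -/
theorem barrierP [SigmaFinite lam] {Lam : Measure (AcProb lam)} {A : FamilyP lam}
    (hA : AdmissibleP Lam A) {ν : ℕ → AcProb lam} (hν : DenseRange ν) :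
    Barrier Lam (measureFormP Lam A) (integrandP A) (fun μ => ‖A μ‖) fun k j => bumpP (ν k) j where
  integrable := hA.integrable
  mem k j := (hasConvDeriv_bumpP (ν k) j).cbE1P (B := 1)
    fun μ => by rw [bumpP, abs_of_nonneg (bump_nonneg _ _)]; exact bump_le_one _ _
  nonneg _ _ _ := bump_nonneg _ _
  le_one _ _ _ := bump_le_one _ _
  energy k j μ := by
    have h := (hasConvDeriv_bumpP (ν k) j).norm_toL2_le μ
    rw [abs_one] at h
    have e := (hasConvDeriv_bumpP (ν k) j).convDeriv_eq
    refine (le_abs_self _).trans ((abs_energy_le A (fun μ => convDeriv (bumpP (ν k) j) μ.toProb)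
      (fun μ => convDeriv (bumpP (ν k) j) μ.toProb) μ).trans ?_)
    simp only [e]
    rw [mul_assoc]
    exact mul_le_of_le_one_right (norm_nonneg _) (mul_le_one₀ h (norm_nonneg _) h)
  nhds μ O hO hμ i₀ := by
    obtain ⟨r, hr, hball⟩ := Metric.isOpen_iff.1 hO μ hμ
    obtain ⟨i, hi, r', hr', h⟩ := exists_nearBy_nhds μ.toAcMeasure hr i₀
    obtain ⟨k, hk⟩ := hν.exists_dist_lt μ hr'
    rw [dist_comm] at hk
    have h1 := h (ν k).toAcMeasure hk
    exact ⟨k, i, hi, h1.1, fun μ' hμ' => hball (h1.2 μ'.toAcMeasure hμ')⟩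
  compact n := AcProb.isClosedEmbedding_toAcMeasure.isCompact_preimage
    (isCompact_nearBy (fun k => (ν k).toAcMeasure) n)

end ProbabilityMeasures

/-! ### Cut-offs near the origin -/

section Cut

/-- A smooth function, zero for `k s ≤ 1` and one for `2 ≤ k s`. -/
def cut (k : ℕ) (s : ℝ) : ℝ := Real.smoothTransition (k * s - 1)

/-- The derivative of `cut k`. -/
def cutDeriv (k : ℕ) (s : ℝ) : ℝ := deriv Real.smoothTransition (k * s - 1) * k

theorem cut_nonneg (k : ℕ) (s : ℝ) : 0 ≤ cut k s := Real.smoothTransition.nonneg _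

theorem cut_le_one (k : ℕ) (s : ℝ) : cut k s ≤ 1 := Real.smoothTransition.le_one _

theorem cut_eq_zero {k : ℕ} {s : ℝ} (h : k * s ≤ 1) : cut k s = 0 :=
  Real.smoothTransition.zero_of_nonpos (by linarith)

theorem cut_eq_one {k : ℕ} {s : ℝ} (h : 2 ≤ k * s) : cut k s = 1 :=
  Real.smoothTransition.one_of_one_le (by linarith)

theorem continuous_cut (k : ℕ) : Continuous (cut k) :=
  Real.smoothTransition.continuous.comp (by fun_prop)

theorem hasDerivAt_cut (k : ℕ) (s : ℝ) : HasDerivAt (cut k) (cutDeriv k s) s := by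
  have h1 : HasDerivAt (fun s : ℝ => (k : ℝ) * s - 1) k s := by
    simpa using ((hasDerivAt_id s).const_mul (k : ℝ)).sub_const 1
  have h2 : HasDerivAt Real.smoothTransition (deriv Real.smoothTransition (k * s - 1))
      (k * s - 1) :=
    ((Real.smoothTransition.contDiff (n := 1)).differentiable one_ne_zero _).hasDerivAt
  exact h2.comp s h1

theorem continuous_deriv_smoothTransition : Continuous (deriv Real.smoothTransition) :=
  (Real.smoothTransition.contDiff (n := 1)).continuous_deriv le_rfl

theorem continuous_cutDeriv (k : ℕ) : Continuous (cutDeriv k) :=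
  (continuous_deriv_smoothTransition.comp (by fun_prop)).mul continuous_const

theorem deriv_smoothTransition_of_nonpos {x : ℝ} (hx : x ≤ 0) :
    deriv Real.smoothTransition x = 0 :=
  IsLocalMin.deriv_eq_zero (Eventually.of_forall fun y => by
    rw [Real.smoothTransition.zero_of_nonpos hx]
    exact Real.smoothTransition.nonneg y)

theorem deriv_smoothTransition_of_one_le {x : ℝ} (hx : 1 ≤ x) :
    deriv Real.smoothTransition x = 0 :=
  IsLocalMax.deriv_eq_zero (Eventually.of_forall fun y => by
    rw [Real.smoothTransition.one_of_one_le hx]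
    exact Real.smoothTransition.le_one y)

theorem cutDeriv_eq_zero {k : ℕ} {s : ℝ} (h : k * s ≤ 1) : cutDeriv k s = 0 := by
  rw [cutDeriv, deriv_smoothTransition_of_nonpos (by linarith), zero_mul]

theorem cutDeriv_eq_zero' {k : ℕ} {s : ℝ} (h : 2 ≤ k * s) : cutDeriv k s = 0 := by
  rw [cutDeriv, deriv_smoothTransition_of_one_le (by linarith), zero_mul]

theorem exists_abs_deriv_smoothTransition_le :
    ∃ S : ℝ, 0 ≤ S ∧ ∀ x, |deriv Real.smoothTransition x| ≤ S := by
  obtain ⟨S, hS⟩ := (isCompact_Icc (a := (0 : ℝ)) (b := 1)).exists_bound_of_continuousOn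
    continuous_deriv_smoothTransition.continuousOn
  refine ⟨|S|, abs_nonneg S, fun x => ?_⟩
  rcases le_total x 0 with h0 | h0
  · rw [deriv_smoothTransition_of_nonpos h0, abs_zero]
    exact abs_nonneg S
  rcases le_total 1 x with h1 | h1
  · rw [deriv_smoothTransition_of_one_le h1, abs_zero]
    exact abs_nonneg S
  exact (hS x ⟨h0, h1⟩).trans (le_abs_self S)

/-- A uniform bound for the derivative of the profile of the cut-offs. -/
def slopeBound : ℝ := exists_abs_deriv_smoothTransition_le.choose

theorem slopeBound_nonneg : 0 ≤ slopeBound := exists_abs_deriv_smoothTransition_le.choose_spec.1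

theorem abs_cutDeriv_le (k : ℕ) (s : ℝ) : |cutDeriv k s| ≤ slopeBound * k := by
  rw [cutDeriv, abs_mul, Nat.abs_cast]
  exact mul_le_mul_of_nonneg_right (exists_abs_deriv_smoothTransition_le.choose_spec.2 _)
    (Nat.cast_nonneg k)

/-- Scale invariance: the derivative is of size k but lives where ks ≤ 2. Independence of k is what
makes the cut-off harmless. -/
theorem abs_mul_cutDeriv_le (k : ℕ) {s : ℝ} (hs : 0 ≤ s) :
    |s * cutDeriv k s| ≤ 2 * slopeBound := by
  rcases le_total 2 (k * s) with h | h
  · rw [cutDeriv_eq_zero' h, mul_zero, abs_zero]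
    linarith [slopeBound_nonneg]
  · rw [abs_mul, abs_of_nonneg hs]
    nlinarith [abs_cutDeriv_le k s, slopeBound_nonneg]

theorem cut_div_le (k : ℕ) {s : ℝ} (hs : 0 ≤ s) : cut k s / s ≤ k := by
  rcases hs.eq_or_lt with rfl | hs
  · simp
  rcases le_total (k * s) 1 with h | h
  · rw [cut_eq_zero h, zero_div]
    exact Nat.cast_nonneg k
  · rw [div_le_iff₀ hs]
    exact (cut_le_one k s).trans h

end Cut

/-! ### Extending functions of probability measures to finite measures -/

section Extension

theorem mass_add_smul_diracF {M : Type*} [MeasurableSpace M] (μ : FiniteMeasure M) (x : M)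
    (t : ℝ≥0) :
    (μ + t • diracF x).mass = μ.mass + t := by
  have h : (diracF x).mass = 1 := by
    rw [← ENNReal.coe_inj, FiniteMeasure.ennreal_mass]
    exact measure_univ (μ := Measure.dirac x)
  have h2 : (μ + t • diracF x).mass = μ.mass + t * (diracF x).mass := by
    change (μ + t • diracF x) Set.univ = μ Set.univ + t * diracF x Set.univ
    rw [FiniteMeasure.coeFn_add, Pi.add_apply, FiniteMeasure.smul_apply, smul_eq_mul]
  rw [h2, h, mul_one]

theorem eventually_mul_mass_lt {M : Type*} [MeasurableSpace M] [TopologicalSpace M]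
    [OpensMeasurableSpace M] (k : ℕ) : ∀ᶠ μ : FiniteMeasure M in 𝓝 0, (k : ℝ) * μ.mass < 1 := by
  have h : Continuous fun μ : FiniteMeasure M => (k : ℝ) * μ.mass :=
    continuous_const.mul (NNReal.continuous_coe.comp FiniteMeasure.continuous_mass)
  refine (h.tendsto 0).eventually (gt_mem_nhds ?_)
  simp

variable {M : Type*} [Nonempty M] [MeasurableSpace M]

/-- The homogeneous extension of `u`, cut off near the zero measure. -/
def cutExt (k : ℕ) (u : ProbabilityMeasure M → ℝ) (μ : FiniteMeasure M) : ℝ :=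
  cut k μ.mass * u μ.normalize

/-- The extrinsic derivative of `cutExt k u`. -/
def cutExtDeriv (k : ℕ) (u : ProbabilityMeasure M → ℝ) (D : ProbabilityMeasure M → M → ℝ)
    (μ : FiniteMeasure M) (x : M) : ℝ :=
  cutDeriv k μ.mass * u μ.normalize + cut k μ.mass / μ.mass * D μ.normalize x

/-- Adding mass t to a measure of mass m moves the normalisation towards δ_x by the fraction t/(m +
t), whose derivative at t = 0 is 1/m. -/
theorem normalize_add_smul_diracF {μ : FiniteMeasure M} (hμ : μ ≠ 0) (x : M) {t : ℝ}
    (ht : 0 ≤ t) :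
    (μ + t.toNNReal • diracF x).normalize = mixDirac μ.normalize x (clip (t / (μ.mass + t))) := by
  have hm : 0 < μ.mass := pos_iff_ne_zero.2 (μ.mass_nonzero_iff.2 hμ)
  have hm' : (0 : ℝ) < μ.mass := by exact_mod_cast hm
  have hne : μ + t.toNNReal • diracF x ≠ 0 := by
    rw [← FiniteMeasure.mass_nonzero_iff, mass_add_smul_diracF]
    positivity
  have hq0 : 0 ≤ t / (μ.mass + t) := by positivity
  have hq1 : t / (μ.mass + t) ≤ 1 := by
    rw [div_le_one (by positivity)]
    linarith
  refine Subtype.ext ?_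
  change ((μ + t.toNNReal • diracF x).normalize : Measure M) =
    ENNReal.ofReal (1 - (clip (t / (μ.mass + t)) : ℝ)) • (μ.normalize : Measure M) +
      ENNReal.ofReal (clip (t / (μ.mass + t)) : ℝ) • Measure.dirac x
  rw [FiniteMeasure.toMeasure_normalize_eq_of_nonzero _ hne,
    FiniteMeasure.toMeasure_normalize_eq_of_nonzero _ hμ, mass_add_smul_diracF, coe_clip hq0 hq1]
  change (μ.mass + t.toNNReal)⁻¹ • ((μ : Measure M) + t.toNNReal • Measure.dirac x) =
    (1 - t / (μ.mass + t)).toNNReal • μ.mass⁻¹ • (μ : Measure M) +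
      (t / (μ.mass + t)).toNNReal • Measure.dirac x
  rw [smul_add, smul_smul, smul_smul]
  have ht' : (t.toNNReal : ℝ) = t := Real.coe_toNNReal t ht
  congr 2
  · refine NNReal.eq ?_
    rw [NNReal.coe_mul, Real.coe_toNNReal _ (by linarith), NNReal.coe_inv, NNReal.coe_inv,
      NNReal.coe_add, ht']
    field_simp
    ring
  · refine NNReal.eq ?_
    rw [NNReal.coe_mul, Real.coe_toNNReal _ hq0, NNReal.coe_inv, NNReal.coe_add, ht']
    field_simp

variable [TopologicalSpace M] [OpensMeasurableSpace M] {u : ProbabilityMeasure M → ℝ}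
  {D : ProbabilityMeasure M → M → ℝ} {C : ℝ}

/-- Near the zero measure, where normalisation is arbitrary and discontinuity could occur, the
cut-off makes the function vanish identically. Elsewhere the product and chain rules apply. The
bound depends on k, which is permitted since it only serves differentiability. -/
theorem hasExtDeriv_cutExt (k : ℕ) (hu : HasConvDeriv u D C) {B : ℝ} (hB : ∀ μ, |u μ| ≤ B) :
    HasExtDeriv (cutExt k u) (cutExtDeriv k u D) (slopeBound * k * B + k * C) where
  continuous := by
    refine continuous_iff_continuousAt.2 fun μ => ?_
    rcases eq_or_ne μ 0 with rfl | hμ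
    · refine continuousAt_const (y := (0 : ℝ)).congr ?_
      filter_upwards [eventually_mul_mass_lt k] with ν hν
      rw [cutExt, cut_eq_zero hν.le, zero_mul]
    · have h1 : ContinuousAt (fun ν : FiniteMeasure M => cut k ν.mass) μ :=
        ((continuous_cut k).comp (NNReal.continuous_coe.comp
          FiniteMeasure.continuous_mass)).continuousAt
      exact h1.mul (hu.continuous.continuousAt.comp
        (FiniteMeasure.tendsto_normalize_of_tendsto tendsto_id hμ))
  continuous_deriv := by
    have hmass : Continuous fun p : FiniteMeasure M × M => (p.1.mass : ℝ) :=
      NNReal.continuous_coe.comp (FiniteMeasure.continuous_mass.comp continuous_fst)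
    refine continuous_iff_continuousAt.2 fun p => ?_
    rcases eq_or_ne p.1 0 with hp | hp
    · refine continuousAt_const (y := (0 : ℝ)).congr ?_
      have h0 : Tendsto Prod.fst (𝓝 p) (𝓝 0) := by
        rw [← hp]
        exact continuous_fst.continuousAt
      filter_upwards [h0.eventually (eventually_mul_mass_lt k)] with q hq
      rw [cutExtDeriv, cut_eq_zero hq.le, cutDeriv_eq_zero hq.le]
      simp
    · have hn : ContinuousAt (fun q : FiniteMeasure M × M => q.1.normalize) p :=
        FiniteMeasure.tendsto_normalize_of_tendsto continuous_fst.continuousAt hp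
      have hm : (p.1.mass : ℝ) ≠ 0 := by
        exact_mod_cast p.1.mass_nonzero_iff.2 hp
      have h1 : ContinuousAt (fun q : FiniteMeasure M × M => cutDeriv k q.1.mass *
          u q.1.normalize) p :=
        ((continuous_cutDeriv k).comp hmass).continuousAt.mul
          (hu.continuous.continuousAt.comp hn)
      have h2 : ContinuousAt (fun q : FiniteMeasure M × M => D q.1.normalize q.2) p :=
        ContinuousAt.comp (g := fun q : ProbabilityMeasure M × M => D q.1 q.2)
          hu.continuous_deriv.continuousAt (hn.prodMk continuous_snd.continuousAt)
      exact h1.add ((((continuous_cut k).comp hmass).continuousAt.div hmass.continuousAt hm).mul h2)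
  bound μ x := by
    refine (abs_add_le _ _).trans (add_le_add ?_ ?_)
    · rw [abs_mul]
      exact mul_le_mul (abs_cutDeriv_le k _) (hB _) (abs_nonneg _)
        (mul_nonneg slopeBound_nonneg (Nat.cast_nonneg k))
    · rw [abs_mul, abs_of_nonneg (div_nonneg (cut_nonneg _ _) (NNReal.coe_nonneg _))]
      exact mul_le_mul (cut_div_le k (NNReal.coe_nonneg _)) (hu.bound _ x) (abs_nonneg _)
        (Nat.cast_nonneg k)
  hasDeriv μ x := by
    rcases eq_or_ne μ 0 with rfl | hμ
    · have h0 : cutExtDeriv k u D 0 x = 0 := by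
        rw [cutExtDeriv, cut_eq_zero (by simp), cutDeriv_eq_zero (by simp)]
        simp
      rw [h0]
      refine (hasDerivWithinAt_const (0 : ℝ) (Set.Ici 0) (0 : ℝ)).congr_of_eventuallyEq ?_ ?_
      · have hray : Continuous fun t : ℝ => (0 : FiniteMeasure M) + t.toNNReal • diracF x := by
          fun_prop
        have h1 : Tendsto (fun t : ℝ => (0 : FiniteMeasure M) + t.toNNReal • diracF x)
            (𝓝[≥] 0) (𝓝 0) := by
          have := (hray.tendsto 0).mono_left (nhdsWithin_le_nhds (s := Set.Ici 0))
          simpa using this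
        filter_upwards [h1.eventually (eventually_mul_mass_lt k)] with t ht
        rw [cutExt, cut_eq_zero ht.le, zero_mul]
      · rw [cutExt, cut_eq_zero (by simp), zero_mul]
    · have hm : 0 < (μ.mass : ℝ) := by
        exact_mod_cast pos_iff_ne_zero.2 (μ.mass_nonzero_iff.2 hμ)
      have d1 : HasDerivWithinAt (fun t : ℝ => cut k (μ.mass + t)) (cutDeriv k μ.mass)
          (Set.Ici 0) 0 := by
        have := HasDerivAt.comp_const_add (f := cut k) (μ.mass : ℝ) 0
          (by simpa using hasDerivAt_cut k (μ.mass : ℝ))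
        exact this.hasDerivWithinAt
      have d2 : HasDerivWithinAt (fun t : ℝ => t / (μ.mass + t)) (μ.mass : ℝ)⁻¹ (Set.Ici 0) 0 := by
        have := (hasDerivAt_id (0 : ℝ)).div ((hasDerivAt_id (0 : ℝ)).const_add (μ.mass : ℝ))
          (by simpa using hm.ne')
        refine this.hasDerivWithinAt.congr_deriv ?_
        simp only [id, add_zero]
        field_simp
        simp
      have d3 := HasDerivWithinAt.scomp (h := fun t : ℝ => t / (μ.mass + t)) 0 (t' := Set.Ici 0)
        (by simpa using hu.hasDeriv μ.normalize x) d2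
        (fun t ht => div_nonneg ht (add_nonneg hm.le ht))
      refine ((d1.mul d3).congr_deriv ?_).congr (fun t ht => ?_) ?_
      · simp only [cutExtDeriv, Function.comp, zero_div, add_zero, clip_zero, mixDirac_zero,
          smul_eq_mul]
        ring
      · have ht' : ((μ.mass + t.toNNReal : ℝ≥0) : ℝ) = μ.mass + t := by
          rw [NNReal.coe_add, Real.coe_toNNReal t ht]
        simp only [cutExt, Pi.mul_apply, Function.comp]
        rw [normalize_add_smul_diracF hμ x ht, mass_add_smul_diracF, ht']
      · simp [cutExt, mixDirac_zero]

end Extension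

/-! ### Lifting functions of probability measures to `L²(lam)` -/

section LiftP

variable {M : Type*} [MeasurableSpace M] {lam : Measure M}

theorem meas_psiP_eq (h : {h : Lp ℝ 2 lam // h ≠ 0}) :
    (psiP h).meas = ENNReal.ofReal (‖h.1‖ ^ 2)⁻¹ • sqMeasure h.1 := by
  have h0 : 0 < ‖h.1‖ := norm_pos_iff.2 h.2
  rw [ENNReal.ofReal_inv_of_pos (by positivity), ← sqMeasure_univ]
  rfl

theorem mass_psiM (h : Lp ℝ 2 lam) : ((psiM h).toFinite.mass : ℝ) = ‖h‖ ^ 2 := by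
  rw [← sqMeasure_real_univ]
  rfl

theorem normalize_psiM [Nonempty M] (h : {h : Lp ℝ 2 lam // h ≠ 0}) :
    (psiM h.1).toFinite.normalize = (psiP h).toProb := by
  have h0 : 0 < ‖h.1‖ := norm_pos_iff.2 h.2
  have hm : (psiM h.1).toFinite ≠ 0 := by
    rw [← FiniteMeasure.mass_nonzero_iff]
    intro h1
    have h2 := mass_psiM h.1
    rw [h1, NNReal.coe_zero] at h2
    exact absurd h2.symm (by positivity)
  refine Subtype.ext ?_
  change ((psiM h.1).toFinite.normalize : Measure M) = (psiP h).meas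
  rw [FiniteMeasure.toMeasure_normalize_eq_of_nonzero _ hm, meas_psiP_eq]
  change ((((psiM h.1).toFinite.mass)⁻¹ : ℝ≥0) : ℝ≥0∞) • sqMeasure h.1 = _
  congr 1
  rw [ENNReal.ofReal, ENNReal.coe_inj]
  refine NNReal.eq ?_
  rw [NNReal.coe_inv, mass_psiM, Real.coe_toNNReal _ (by positivity)]

theorem norm_le_of_ae_eq_mul {G h : Lp ℝ 2 lam} {a : M → ℝ} {c : ℝ}
    (hG : G =ᵐ[lam] fun x => h x * a x) (ha : ∀ x, |a x| ≤ c) : ‖G‖ ≤ c * ‖h‖ := by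
  refine Lp.norm_le_mul_norm_of_ae_le_mul ?_
  filter_upwards [hG] with x hx
  rw [hx, norm_mul, mul_comm]
  exact mul_le_mul_of_nonneg_right (ha x) (norm_nonneg _)

variable {A : FamilyP lam}

/-- One factor ‖h‖² is the weight of the form, the other is the normalising constant of the measure
h² lam / ‖h‖². -/
theorem hilbertIntegrandP_eq {f g : Lp ℝ 2 lam → ℝ} {h : {h : Lp ℝ 2 lam // h ≠ 0}} {a b : M → ℝ}
    (hf : (gradient f h.1 : Lp ℝ 2 lam) =ᵐ[lam] fun x => h.1 x * a x)
    (hg : (gradient g h.1 : Lp ℝ 2 lam) =ᵐ[lam] fun x => h.1 x * b x)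
    (hb : MemLp b 2 (psiP h).meas) :
    hilbertIntegrandP A f g h = ‖h.1‖ ^ 4 *
      inner ℝ (A (psiP h) (toL2 (psiP h).meas a)) (toL2 (psiP h).meas b) := by
  have h0 : 0 < ‖h.1‖ := norm_pos_iff.2 h.2
  rw [hilbertIntegrandP, hilbertOpP,
    inner_lift_eq (inv_pos.2 (by positivity : 0 < ‖h.1‖ ^ 2)) (meas_psiP_eq h) (A (psiP h)) hb hf
      hg,
    inv_inv]
  ring

variable [TopologicalSpace M] [PolishSpace M] [BorelSpace M] [SigmaFinite lam]

theorem hilbertIntegrandP_comp_psiM {w : FiniteMeasure M → ℝ} {D : FiniteMeasure M → M → ℝ}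
    {C : ℝ} (hw : HasExtDeriv w D C) (h : {h : Lp ℝ 2 lam // h ≠ 0}) :
    hilbertIntegrandP A (fun h => w (psiM h).toFinite) (fun h => w (psiM h).toFinite) h =
      4 * inner ℝ (A (psiP h) (‖h.1‖ ^ 2 • toL2 (psiP h).meas (D (psiM h.1).toFinite)))
        (‖h.1‖ ^ 2 • toL2 (psiP h).meas (D (psiM h.1).toFinite)) := by
  have hL : MemLp (D (psiM h.1).toFinite) 2 (psiP h).meas :=
    memLp_of_bounded (hw.continuous_section _).measurable (hw.bound _)
  have hg : (gradient (fun h : Lp ℝ 2 lam => w (psiM h).toFinite) h.1 : Lp ℝ 2 lam) =ᵐ[lam]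
      fun x => h.1 x * (2 * D (psiM h.1).toFinite x) := by
    rw [(hw.hasGradientAt h.1).gradient]
    filter_upwards [hw.coeFn_liftGrad h.1] with x hx
    rw [hx]
    ring
  rw [hilbertIntegrandP_eq hg hg (hL.const_mul 2), toL2_const_mul 2 hL]
  simp only [map_smul, real_inner_smul_left, real_inner_smul_right]
  ring

variable [Nonempty M] {u v : ProbabilityMeasure M → ℝ} {D : ProbabilityMeasure M → M → ℝ} {C : ℝ}

/-- With k > 2/‖h‖² the cut-off equals 1 in a neighbourhood of h, so the function agrees there with
the lift of a function on finite measures and the gradient formula for those applies. -/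
theorem exists_hasGradientAt_compPsiP (hu : HasConvDeriv u D C) {B : ℝ} (hB : ∀ μ, |u μ| ≤ B)
    (h : {h : Lp ℝ 2 lam // h ≠ 0}) :
    ContDiffAt ℝ 1 (compPsiP u) h.1 ∧
      (gradient (compPsiP u) h.1 : Lp ℝ 2 lam) =ᵐ[lam] fun x =>
        h.1 x * (2 * (‖h.1‖ ^ 2)⁻¹ * D (psiP h).toProb x) := by
  have h0 : 0 < ‖h.1‖ := norm_pos_iff.2 h.2
  obtain ⟨k, hk⟩ := exists_nat_gt (2 / ‖h.1‖ ^ 2)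
  rw [div_lt_iff₀ (by positivity)] at hk
  have hw := hasExtDeriv_cutExt k hu hB
  have heq : compPsiP u =ᶠ[𝓝 h.1] fun h : Lp ℝ 2 lam => cutExt k u (psiM h).toFinite := by
    have hc : Continuous fun h : Lp ℝ 2 lam => (k : ℝ) * ‖h‖ ^ 2 := by fun_prop
    filter_upwards [(hc.tendsto h.1).eventually (lt_mem_nhds hk),
      isOpen_ne.mem_nhds h.2] with h' h1 h2
    rw [compPsiP, dif_pos h2, cutExt, mass_psiM, cut_eq_one h1.le, one_mul,
      normalize_psiM ⟨h', h2⟩]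
  refine ⟨hw.contDiff.contDiffAt.congr_of_eventuallyEq heq, ?_⟩
  have hg : HasGradientAt (compPsiP u) (liftGrad (cutExtDeriv k u D) h.1) h.1 :=
    (hw.hasGradientAt h.1).congr_of_eventuallyEq heq
  rw [hg.gradient]
  filter_upwards [hw.coeFn_liftGrad h.1] with x hx
  rw [hx, cutExtDeriv, mass_psiM, cut_eq_one hk.le, cutDeriv_eq_zero' hk.le, normalize_psiM h]
  ring

theorem cb10_compPsiP (hu : CbE1P u) : Cb10 {0}ᶜ (compPsiP (lam := lam) u) := by
  obtain ⟨C, hC⟩ := hu.hasConvDeriv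
  obtain ⟨B, hB⟩ := hu.exists_bound
  refine ⟨fun h hh => (exists_hasGradientAt_compPsiP hC hB ⟨h, hh⟩).1.contDiffWithinAt,
    B + 2 * C, fun h hh => add_le_add ?_ ?_⟩
  · rw [compPsiP, dif_pos (Set.mem_compl_singleton_iff.1 hh)]
    exact hB _
  · have h0 : 0 < ‖h‖ := norm_pos_iff.2 hh
    have h1 := norm_le_of_ae_eq_mul (exists_hasGradientAt_compPsiP hC hB ⟨h, hh⟩).2
      (c := 2 * (‖h‖ ^ 2)⁻¹ * C) fun x => by
        rw [abs_mul, abs_of_nonneg (by positivity : 0 ≤ 2 * (‖h‖ ^ 2)⁻¹)]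
        exact mul_le_mul_of_nonneg_left (hC.bound _ x) (by positivity)
    calc ‖h‖ * ‖gradient (compPsiP u) h‖ ≤ ‖h‖ * (2 * (‖h‖ ^ 2)⁻¹ * C * ‖h‖) :=
          mul_le_mul_of_nonneg_left h1 h0.le
      _ = 2 * C := by field_simp

/-- Each gradient carries a factor ‖h‖⁻², and the two of them cancel the ‖h‖⁴ of
`hilbertIntegrandP_eq`. -/
theorem hilbertIntegrandP_compPsiP (hu : CbE1P u) (hv : CbE1P v)
    (h : {h : Lp ℝ 2 lam // h ≠ 0}) :
    hilbertIntegrandP A (compPsiP u) (compPsiP v) h = 4 * integrandP A u v (psiP h) := by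
  obtain ⟨Cu, hCu⟩ := hu.hasConvDeriv
  obtain ⟨Cv, hCv⟩ := hv.hasConvDeriv
  obtain ⟨Bu, hBu⟩ := hu.exists_bound
  obtain ⟨Bv, hBv⟩ := hv.exists_bound
  have h0 : 0 < ‖h.1‖ := norm_pos_iff.2 h.2
  rw [hilbertIntegrandP_eq (exists_hasGradientAt_compPsiP hCu hBu h).2
    (exists_hasGradientAt_compPsiP hCv hBv h).2 ((hCv.memLp (psiP h)).const_mul _),
    toL2_const_mul _ (hCu.memLp (psiP h)), toL2_const_mul _ (hCv.memLp (psiP h)), map_smul,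
    real_inner_smul_left, real_inner_smul_right, integrandP]
  field_simp
  ring

variable [MeasurableSpace (Lp ℝ 2 lam)] [BorelSpace (Lp ℝ 2 lam)] {L0 : Measure (Lp ℝ 2 lam)}

theorem integrable_integrandP (hA : AdmissibleP (lawP L0) A) (hu : CbE1P u) (hv : CbE1P v) :
    Integrable (integrandP A u v) (lawP L0) ∧
      Integrable (hilbertIntegrandP A (compPsiP u) (compPsiP v)) (restrictNonzero L0) := by
  have h1 : Integrable (integrandP A u v) (lawP L0) := (diffusionCoreP hA).integrable hu hv
  refine ⟨h1, ?_⟩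
  have h2 : hilbertIntegrandP A (compPsiP u) (compPsiP v) =
      fun h => 4 * integrandP A u v (psiP h) :=
    funext fun h => hilbertIntegrandP_compPsiP hu hv h
  rw [h2]
  exact (h1.comp_measurable continuous_psiP.measurable).const_mul 4

theorem measureFormP_eq_integral (hA : AdmissibleP (lawP L0) A) (hu : CbE1P u) (hv : CbE1P v) :
    (measureFormP (lawP L0) A).form u v =
      ∫ h, integrandP A u v (psiP h) ∂(restrictNonzero L0) :=
  integral_map continuous_psiP.measurable.aemeasurable
    (integrable_integrandP hA hu hv).1.aestronglyMeasurable

theorem measureFormP_eq (hA : AdmissibleP (lawP L0) A) (hu : CbE1P u) (hv : CbE1P v) :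
    (measureFormP (lawP L0) A).form u v =
      1 / 4 * (hilbertFormP L0 A).form (compPsiP u) (compPsiP v) := by
  rw [measureFormP_eq_integral hA hu hv]
  change _ = 1 / 4 * ∫ h, hilbertIntegrandP A _ _ h ∂(restrictNonzero L0)
  simp only [hilbertIntegrandP_compPsiP hu hv]
  rw [integral_const_mul]
  ring

end LiftP

/-! ### Closability of the form on functions of probability measures -/

section Quadratic

variable {H : Type*} [NormedAddCommGroup H] [InnerProductSpace ℝ H] {T : H →L[ℝ] H}

theorem inner_map_add_self_le (hT : ∀ x, 0 ≤ inner ℝ (T x) x) (x y : H) :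
    inner ℝ (T (x + y)) (x + y) ≤ 2 * inner ℝ (T x) x + 2 * inner ℝ (T y) y := by
  have h := hT (x - y)
  simp only [map_add, map_sub, inner_add_left, inner_add_right, inner_sub_left,
    inner_sub_right] at h ⊢
  linarith

theorem inner_map_add_sub_self_le (hT : ∀ x, 0 ≤ inner ℝ (T x) x) (x y z : H) :
    inner ℝ (T (x + (y - z))) (x + (y - z)) ≤
      2 * inner ℝ (T x) x + 4 * inner ℝ (T y) y + 4 * inner ℝ (T z) z := by
  have h1 := inner_map_add_self_le hT x (y - z)
  have h2 := inner_map_add_self_le hT y (-z)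
  rw [← sub_eq_add_neg, map_neg, inner_neg_neg] at h2
  linarith

theorem inner_map_self_le (T : H →L[ℝ] H) {x : H} {K : ℝ} (hx : ‖x‖ ≤ K) :
    inner ℝ (T x) x ≤ K ^ 2 * ‖T‖ := by
  have h1 := (real_inner_le_norm (T x) x).trans
    (mul_le_mul_of_nonneg_right (T.le_opNorm x) (norm_nonneg x))
  have h2 := mul_le_mul_of_nonneg_right (pow_le_pow_left₀ (norm_nonneg x) hx 2) (norm_nonneg T)
  nlinarith

end Quadratic

/-! ### Energy lost by cutting off near the origin. -/

section CutEnergy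

theorem norm_toL2_one {M : Type*} [MeasurableSpace M] {lam : Measure M} (μ : AcProb lam) :
    ‖toL2 μ.meas fun _ => (1 : ℝ)‖ ≤ 1 :=
  norm_toL2_le measurable_const zero_le_one fun _ => by simp

theorem measurableSet_cutLoss {M : Type*} [MeasurableSpace M] {lam : Measure M}
    [MeasurableSpace (Lp ℝ 2 lam)] [BorelSpace (Lp ℝ 2 lam)] (k : ℕ) :
    MeasurableSet {h : {h : Lp ℝ 2 lam // h ≠ 0} | (k : ℝ) * ‖h.1‖ ^ 2 < 2} := by
  have : Continuous fun h : {h : Lp ℝ 2 lam // h ≠ 0} => (k : ℝ) * ‖h.1‖ ^ 2 := by fun_prop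
  exact (isOpen_lt this continuous_const).measurableSet

theorem integrable_norm_psiP {M : Type*} [TopologicalSpace M] [MeasurableSpace M]
    {lam : Measure M} [SigmaFinite lam] [MeasurableSpace (Lp ℝ 2 lam)] [BorelSpace (Lp ℝ 2 lam)]
    {L0 : Measure (Lp ℝ 2 lam)} {A : FamilyP lam} (hA : AdmissibleP (lawP L0) A) :
    Integrable (fun h => ‖A (psiP h)‖) (restrictNonzero L0) :=
  hA.integrable.comp_measurable continuous_psiP.measurable

/-- A bound for the energy lost by the cut-off. -/
def cutLoss {M : Type*} [MeasurableSpace M] {lam : Measure M} (A : FamilyP lam) (k : ℕ)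
    (h : {h : Lp ℝ 2 lam // h ≠ 0}) : ℝ :=
  {h : {h : Lp ℝ 2 lam // h ≠ 0} | (k : ℝ) * ‖h.1‖ ^ 2 < 2}.indicator (fun h => ‖A (psiP h)‖) h

theorem integrable_cutLoss {M : Type*} [TopologicalSpace M] [MeasurableSpace M]
    {lam : Measure M} [SigmaFinite lam] [MeasurableSpace (Lp ℝ 2 lam)] [BorelSpace (Lp ℝ 2 lam)]
    {L0 : Measure (Lp ℝ 2 lam)} {A : FamilyP lam} (hA : AdmissibleP (lawP L0) A) (k : ℕ) :
    Integrable (cutLoss A k) (restrictNonzero L0) :=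
  (integrable_norm_psiP hA).indicator (measurableSet_cutLoss k)

/-- For each fixed h ≠ 0 the loss vanishes once k ‖h‖² ≥ 2, and ‖A‖ is an integrable majorant. -/
theorem exists_integral_cutLoss_le {M : Type*} [TopologicalSpace M] [MeasurableSpace M]
    {lam : Measure M} [SigmaFinite lam] [MeasurableSpace (Lp ℝ 2 lam)] [BorelSpace (Lp ℝ 2 lam)]
    {L0 : Measure (Lp ℝ 2 lam)} {A : FamilyP lam} (hA : AdmissibleP (lawP L0) A) (K : ℝ) {ε : ℝ}
    (hε : 0 < ε) :
    ∃ k, K * ∫ h, cutLoss A k h ∂(restrictNonzero L0) ≤ ε := by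
  have h : Tendsto (fun k => ∫ h, cutLoss A k h ∂(restrictNonzero L0)) atTop (𝓝 0) := by
    rw [← integral_zero {h : Lp ℝ 2 lam // h ≠ 0} ℝ (μ := restrictNonzero L0)]
    refine tendsto_integral_of_dominated_convergence (fun h => ‖A (psiP h)‖)
      (fun k => (integrable_cutLoss hA k).aestronglyMeasurable) (integrable_norm_psiP hA)
      (fun k => Eventually.of_forall fun h => ?_) (Eventually.of_forall fun h => ?_)
    · refine (norm_indicator_le_norm_self _ _).trans ?_
      rw [norm_norm]
    · have h0 : 0 < ‖h.1‖ := norm_pos_iff.2 h.2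
      refine tendsto_const_nhds.congr' ?_
      obtain ⟨k₀, hk₀⟩ := exists_nat_gt (2 / ‖h.1‖ ^ 2)
      rw [div_lt_iff₀ (by positivity)] at hk₀
      filter_upwards [eventually_ge_atTop k₀] with k hk
      have h1 : (k₀ : ℝ) * ‖h.1‖ ^ 2 ≤ k * ‖h.1‖ ^ 2 := by gcongr
      rw [cutLoss, Set.indicator_of_notMem]
      exact not_lt.2 (hk₀.le.trans h1)
  have h1 := h.const_mul K
  rw [mul_zero] at h1
  obtain ⟨k, hk⟩ := (h1.eventually (gt_mem_nhds hε)).exists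
  exact ⟨k, hk.le⟩

variable {M : Type*} [Nonempty M] [TopologicalSpace M] [MeasurableSpace M] [BorelSpace M]
  {lam : Measure M} {u : ProbabilityMeasure M → ℝ} {D : ProbabilityMeasure M → M → ℝ} {C B : ℝ}

/-- The rescaled class of `cutExtDeriv k u D` at `h² lam`. -/
def cutVec (k : ℕ) (u : ProbabilityMeasure M → ℝ) (D : ProbabilityMeasure M → M → ℝ)
    (h : {h : Lp ℝ 2 lam // h ≠ 0}) : Lp ℝ 2 (psiP h).meas :=
  ‖h.1‖ ^ 2 • toL2 (psiP h).meas (cutExtDeriv k u D (psiM h.1).toFinite)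

/-- Multiplication by s = ‖h‖² turns the coefficients cut(s)/s and cut'(s) into cut(s) and s ·
cut'(s), both bounded uniformly in k. -/
theorem cutVec_eq (k : ℕ) (hu : HasConvDeriv u D C) (h : {h : Lp ℝ 2 lam // h ≠ 0}) :
    cutVec k u D h = cut k (‖h.1‖ ^ 2) • toL2 (psiP h).meas (D (psiP h).toProb) +
      (‖h.1‖ ^ 2 * cutDeriv k (‖h.1‖ ^ 2) * u (psiP h).toProb) •
        toL2 (psiP h).meas fun _ => 1 := by
  have h0 : ‖h.1‖ ≠ 0 := norm_ne_zero_iff.2 h.2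
  have hD := hu.memLp (psiP h)
  have h1 : MemLp (fun _ : M => (1 : ℝ)) 2 (psiP h).meas := memLp_const 1
  have e : cutExtDeriv k u D (psiM h.1).toFinite = fun x =>
      (cut k (‖h.1‖ ^ 2) / ‖h.1‖ ^ 2) * D (psiP h).toProb x +
        (cutDeriv k (‖h.1‖ ^ 2) * u (psiP h).toProb) * 1 := by
    funext x
    rw [cutExtDeriv, mass_psiM, normalize_psiM h]
    ring
  rw [cutVec, e, toL2_add (hD.const_mul _) (h1.const_mul _), toL2_const_mul _ hD,
    toL2_const_mul _ h1, smul_add, smul_smul, smul_smul]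
  congr 2
  · field_simp
  · ring

theorem sub_cutVec_eq_zero {k : ℕ} (hu : HasConvDeriv u D C) {h : {h : Lp ℝ 2 lam // h ≠ 0}}
    (hk : 2 ≤ k * ‖h.1‖ ^ 2) :
    toL2 (psiP h).meas (D (psiP h).toProb) - cutVec k u D h = 0 := by
  rw [cutVec_eq k hu h, cut_eq_one hk, cutDeriv_eq_zero' hk]
  simp

theorem norm_sub_cutVec_le (k : ℕ) (hu : HasConvDeriv u D C) (hB : ∀ μ, |u μ| ≤ B)
    (h : {h : Lp ℝ 2 lam // h ≠ 0}) :
    ‖toL2 (psiP h).meas (D (psiP h).toProb) - cutVec k u D h‖ ≤ |C| + 2 * slopeBound * B := by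
  rw [cutVec_eq k hu h, ← sub_sub]
  refine (norm_sub_le _ _).trans (add_le_add ?_ ?_)
  · have e : ∀ z : Lp ℝ 2 (psiP h).meas, z - cut k (‖h.1‖ ^ 2) • z =
        (1 - cut k (‖h.1‖ ^ 2)) • z := fun z => by rw [sub_smul, one_smul]
    have h1 := cut_nonneg k (‖h.1‖ ^ 2)
    have h2 := cut_le_one k (‖h.1‖ ^ 2)
    rw [e, norm_smul, Real.norm_eq_abs, abs_of_nonneg (by linarith)]
    exact (mul_le_of_le_one_left (norm_nonneg _) (by linarith)).trans (hu.norm_toL2_le (psiP h))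
  · rw [norm_smul, Real.norm_eq_abs, abs_mul]
    refine (mul_le_of_le_one_right (by positivity) (norm_toL2_one (psiP h))).trans ?_
    exact mul_le_mul (abs_mul_cutDeriv_le k (by positivity)) (hB _) (abs_nonneg _)
      (by linarith [slopeBound_nonneg])

/-- The constant on the right does not involve k, so k can be chosen afterwards to make the integral
small. -/
theorem inner_sub_cutVec_le (A : FamilyP lam) (k : ℕ) (hu : HasConvDeriv u D C)
    (hB : ∀ μ, |u μ| ≤ B) (h : {h : Lp ℝ 2 lam // h ≠ 0}) :
    inner ℝ (A (psiP h) (toL2 (psiP h).meas (D (psiP h).toProb) - cutVec k u D h))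
      (toL2 (psiP h).meas (D (psiP h).toProb) - cutVec k u D h) ≤
        (|C| + 2 * slopeBound * B) ^ 2 * cutLoss A k h := by
  by_cases hk : (k : ℝ) * ‖h.1‖ ^ 2 < 2
  · rw [cutLoss, Set.indicator_of_mem (by exact hk)]
    exact inner_map_self_le _ (norm_sub_cutVec_le k hu hB h)
  · rw [sub_cutVec_eq_zero hu (not_lt.1 hk), cutLoss, Set.indicator_of_notMem (by exact hk)]
    simp

variable [PolishSpace M] [SigmaFinite lam]

/-- The weight ‖h‖ in this class matches the size 1/‖h‖ of the gradient: ‖h‖ times |h| contributes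
the ‖h‖² that tames cut(s)/s and cut'(s). -/
theorem cb10_cutExt (k : ℕ) (hu : HasConvDeriv u D C) (hB : ∀ μ, |u μ| ≤ B) :
    Cb10 Set.univ fun h : Lp ℝ 2 lam => cutExt k u (psiM h).toFinite := by
  have hw := hasExtDeriv_cutExt k hu hB
  have hB0 : 0 ≤ B := (abs_nonneg _).trans (hB (diracF (Classical.arbitrary M)).normalize)
  refine ⟨hw.contDiff.contDiffOn, B + 2 * (2 * slopeBound * B + |C|), fun h _ =>
    add_le_add ?_ ?_⟩
  · change |cut k _ * u _| ≤ B
    rw [abs_mul, abs_of_nonneg (cut_nonneg _ _)]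
    exact (mul_le_of_le_one_left (abs_nonneg _) (cut_le_one _ _)).trans (hB _)
  · rw [(hw.hasGradientAt h).gradient]
    have h1 := norm_le_of_ae_eq_mul (G := liftGrad (cutExtDeriv k u D) h) (h := h)
      (a := fun x => 2 * cutExtDeriv k u D (psiM h).toFinite x)
      (c := 2 * (|cutDeriv k (‖h‖ ^ 2)| * B + cut k (‖h‖ ^ 2) / ‖h‖ ^ 2 * |C|)) (by
        filter_upwards [hw.coeFn_liftGrad h] with x hx
        rw [hx]
        ring) (fun x => by
        rw [abs_mul, abs_two, cutExtDeriv, mass_psiM]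
        refine mul_le_mul_of_nonneg_left ((abs_add_le _ _).trans (add_le_add ?_ ?_)) zero_le_two
        · rw [abs_mul]
          exact mul_le_mul_of_nonneg_left (hB _) (abs_nonneg _)
        · rw [abs_mul, abs_of_nonneg (div_nonneg (cut_nonneg _ _) (by positivity))]
          exact mul_le_mul_of_nonneg_left ((hu.bound _ x).trans (le_abs_self C))
            (div_nonneg (cut_nonneg _ _) (by positivity)))
    have h2 := abs_mul_cutDeriv_le k (by positivity : 0 ≤ ‖h‖ ^ 2)
    rw [abs_mul, abs_of_nonneg (by positivity : 0 ≤ ‖h‖ ^ 2)] at h2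
    have h3 : cut k (‖h‖ ^ 2) / ‖h‖ ^ 2 * ‖h‖ ^ 2 ≤ 1 := by
      rcases eq_or_ne (‖h‖ ^ 2) 0 with h4 | h4
      · rw [h4, mul_zero]
        exact zero_le_one
      · rw [div_mul_cancel₀ _ h4]
        exact cut_le_one _ _
    calc ‖h‖ * ‖liftGrad (cutExtDeriv k u D) h‖
        ≤ ‖h‖ * (2 * (|cutDeriv k (‖h‖ ^ 2)| * B + cut k (‖h‖ ^ 2) / ‖h‖ ^ 2 * |C|) * ‖h‖) :=
          mul_le_mul_of_nonneg_left h1 (norm_nonneg _)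
      _ = 2 * (‖h‖ ^ 2 * |cutDeriv k (‖h‖ ^ 2)| * B +
            cut k (‖h‖ ^ 2) / ‖h‖ ^ 2 * ‖h‖ ^ 2 * |C|) := by ring
      _ ≤ 2 * (2 * slopeBound * B + 1 * |C|) := by gcongr
      _ = 2 * (2 * slopeBound * B + |C|) := by ring

variable [MeasurableSpace (Lp ℝ 2 lam)] [BorelSpace (Lp ℝ 2 lam)]
  {L0 : Measure (Lp ℝ 2 lam)} {A : FamilyP lam}

/-- The coefficients of the expansion depend on h rather than on the measure alone, so admissibility
is applied to the convexity derivative and to the constant 1 separately. -/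
theorem measurable_inner_cutVec (hA : AdmissibleP (lawP L0) A) (k : ℕ) (hu : HasConvDeriv u D C) :
    Measurable fun h : {h : Lp ℝ 2 lam // h ≠ 0} =>
      inner ℝ (A (psiP h) (cutVec k u D h)) (cutVec k u D h) := by
  have hD : Continuous fun p : AcProb lam × M => D p.1.toProb p.2 :=
    hu.continuous_deriv.comp (f := fun p : AcProb lam × M => (p.1.toProb, p.2))
      ((AcProb.continuous_toProb.comp continuous_fst).prodMk continuous_snd)
  let d : AcProb lam → M → ℝ := fun μ => D μ.toProb
  let e : AcProb lam → M → ℝ := fun _ _ => 1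
  have he : Continuous fun p : AcProb lam × M => e p.1 p.2 := continuous_const
  have hd1 : ∀ μ x, |d μ x| ≤ C := fun μ x => hu.bound _ x
  have he1 : ∀ μ x, |e μ x| ≤ 1 := fun μ x => by simp [e]
  have mE : ∀ {a b : AcProb lam → M → ℝ} {Ca Cb : ℝ},
      (Continuous fun p : AcProb lam × M => a p.1 p.2) → (∀ μ x, |a μ x| ≤ Ca) →
      (Continuous fun p : AcProb lam × M => b p.1 p.2) → (∀ μ x, |b μ x| ≤ Cb) →
      Measurable fun h : {h : Lp ℝ 2 lam // h ≠ 0} => energy A a b (psiP h) :=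
    fun ha hCa hb hCb => (measurable_energy A AcProb.measurable_meas (fun _ => inferInstance)
      hA.measurable ha hCa hb hCb).comp continuous_psiP.measurable
  have hα : Measurable fun h : {h : Lp ℝ 2 lam // h ≠ 0} => cut k (‖h.1‖ ^ 2) :=
    ((continuous_cut k).comp (by fun_prop)).measurable
  have hβ : Measurable fun h : {h : Lp ℝ 2 lam // h ≠ 0} =>
      ‖h.1‖ ^ 2 * cutDeriv k (‖h.1‖ ^ 2) * u (psiP h).toProb := by
    have h1 : Continuous fun h : {h : Lp ℝ 2 lam // h ≠ 0} => ‖h.1‖ ^ 2 := by fun_prop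
    exact ((h1.mul ((continuous_cutDeriv k).comp h1)).mul
      (hu.continuous.comp (AcProb.continuous_toProb.comp continuous_psiP))).measurable
  have key : (fun h : {h : Lp ℝ 2 lam // h ≠ 0} =>
      inner ℝ (A (psiP h) (cutVec k u D h)) (cutVec k u D h)) = fun h =>
        cut k (‖h.1‖ ^ 2) ^ 2 * energy A d d (psiP h) + cut k (‖h.1‖ ^ 2) *
          (‖h.1‖ ^ 2 * cutDeriv k (‖h.1‖ ^ 2) * u (psiP h).toProb) *
            (energy A d e (psiP h) + energy A e d (psiP h)) +
        (‖h.1‖ ^ 2 * cutDeriv k (‖h.1‖ ^ 2) * u (psiP h).toProb) ^ 2 * energy A e e (psiP h) := by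
    funext h
    rw [cutVec_eq k hu h]
    simp only [energy, d, e, map_add, map_smul, inner_add_left, inner_add_right,
      real_inner_smul_left, real_inner_smul_right]
    ring
  rw [key]
  exact (((hα.pow_const 2).mul (mE hD hd1 hD hd1)).add ((hα.mul hβ).mul
    ((mE hD hd1 he he1).add (mE he he1 hD hd1)))).add ((hβ.pow_const 2).mul (mE he he1 he he1))

end CutEnergy

/-! ### Transfer of closability to probability measures. -/

section Closability

variable {M : Type*} [Nonempty M] [TopologicalSpace M] [PolishSpace M] [MeasurableSpace M]
  [BorelSpace M] {lam : Measure M} [SigmaFinite lam] [MeasurableSpace (Lp ℝ 2 lam)]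
  [BorelSpace (Lp ℝ 2 lam)] {L0 : Measure (Lp ℝ 2 lam)} {A : FamilyP lam}

theorem eLpNorm_cutExt_le (hL0 : L0 {0} = 0) (k : ℕ) {u : ProbabilityMeasure M → ℝ}
    (hu : CbE1P u) :
    eLpNorm (fun h : Lp ℝ 2 lam => cutExt k u (psiM h).toFinite) 2 L0 ≤
      eLpNorm (fun μ : AcProb lam => u μ.toProb) 2 (lawP L0) := by
  obtain ⟨C, hC⟩ := hu.hasConvDeriv
  obtain ⟨B, hB⟩ := hu.exists_bound
  have hc : Continuous fun h : Lp ℝ 2 lam => cutExt k u (psiM h).toFinite :=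
    (hasExtDeriv_cutExt k hC hB).contDiff.continuous
  have e1 := eLpNorm_map_measure (p := 2) (μ := restrictNonzero L0) hc.aestronglyMeasurable
    measurable_subtype_coe.aemeasurable
  have e2 := eLpNorm_map_measure (p := 2) (μ := restrictNonzero L0)
    (hu.continuous.comp (AcProb.continuous_toProb (lam := lam))).aestronglyMeasurable
    continuous_psiP.measurable.aemeasurable
  rw [map_restrictNonzero L0 hL0] at e1
  rw [e1]
  refine le_trans ?_ e2.ge
  refine eLpNorm_mono fun h => ?_
  change ‖cut k _ * u (psiM h.1).toFinite.normalize‖ ≤ ‖u (psiP h).toProb‖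
  rw [norm_mul, normalize_psiM h, Real.norm_eq_abs, abs_of_nonneg (cut_nonneg _ _)]
  exact mul_le_of_le_one_left (norm_nonneg _) (cut_le_one _ _)

/-- The lift of u need not be C¹ at the origin, so the hypothesis is applied to cut-off lifts. Each
member of the sequence receives its own k with energy loss at most 1/(n+1). The cut-off lifts are
then Cauchy and tend to 0 in L², so their energies tend to 0, and the loss bound returns the
conclusion to the original sequence. -/
theorem isClosable_measureFormP (hL0 : L0 {0} = 0) (hA : AdmissibleP (lawP L0) A)
    (hcl : (hilbertFormP L0 A).IsClosable L0) :
    (measureFormP (lawP L0) A).IsClosable (lawP L0) := by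
  intro s hs hlim
  have hP := diffusionCoreP hA
  have hmem : ∀ n, CbE1P (s n) := hs.1
  have hsub : ∀ n m, CbE1P (s n - s m) := fun n m =>
    (hP.core.sub_mem (hs.1 n) (hs.1 m) : s n - s m ∈ hP.core)
  choose C hC using fun n => (hmem n).hasConvDeriv
  choose B hB using fun n => (hmem n).exists_bound
  let K : ℕ → ℝ := fun n => (|C n| + 2 * slopeBound * B n) ^ 2
  choose k hk using fun n : ℕ => exists_integral_cutLoss_le hA (K n)
    (by positivity : 0 < 1 / ((n : ℝ) + 1))
  let w : ℕ → FiniteMeasure M → ℝ := fun n => cutExt (k n) (s n)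
  have hw : ∀ n, HasExtDeriv (w n) (cutExtDeriv (k n) (s n) (convDeriv (s n))) _ := fun n =>
    hasExtDeriv_cutExt (k n) (hC n) (hB n)
  let W : ℕ → Lp ℝ 2 lam → ℝ := fun n h => w n (psiM h).toFinite
  let U : ∀ (_ : ℕ) (h : {h : Lp ℝ 2 lam // h ≠ 0}), Lp ℝ 2 (psiP h).meas := fun n h =>
    toL2 (psiP h).meas (convDeriv (s n) (psiP h).toProb)
  let V : ∀ (_ : ℕ) (h : {h : Lp ℝ 2 lam // h ≠ 0}), Lp ℝ 2 (psiP h).meas := fun n h =>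
    cutVec (k n) (s n) (convDeriv (s n)) h
  have hpos : ∀ (h : {h : Lp ℝ 2 lam // h ≠ 0}) (z : Lp ℝ 2 (psiP h).meas),
      0 ≤ inner ℝ (A (psiP h) z) z := fun h z => (hA.positive (psiP h)).re_inner_nonneg_left z
  have hloss : ∀ n h, inner ℝ (A (psiP h) (U n h - V n h)) (U n h - V n h) ≤
      K n * cutLoss A (k n) h := fun n h => inner_sub_cutVec_le A (k n) (hC n) (hB n) h
  have hlossInt : ∀ n, Integrable (fun h => K n * cutLoss A (k n) h) (restrictNonzero L0) :=
    fun n => (integrable_cutLoss hA (k n)).const_mul _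
  have hlossLe : ∀ n : ℕ, ∫ h, K n * cutLoss A (k n) h ∂(restrictNonzero L0) ≤
      1 / ((n : ℝ) + 1) := fun n => by
    rw [integral_const_mul]
    exact hk n
  have hW : ∀ n h, hilbertIntegrandP A (W n) (W n) h =
      4 * inner ℝ (A (psiP h) (V n h)) (V n h) := fun n h =>
    hilbertIntegrandP_comp_psiM (hw n) h
  have hWsub : ∀ n m h, hilbertIntegrandP A (W n - W m) (W n - W m) h =
      4 * inner ℝ (A (psiP h) (V n h - V m h)) (V n h - V m h) := fun n m h => by
    have e := hilbertIntegrandP_comp_psiM (A := A) ((hw n).add ((hw m).const_smul (-1))) h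
    have e1 : (fun h : Lp ℝ 2 lam => (w n + (-1 : ℝ) • w m) (psiM h).toFinite) = W n - W m := by
      funext h
      simp [W, sub_eq_add_neg]
    have hL : ∀ n, MemLp (cutExtDeriv (k n) (s n) (convDeriv (s n)) (psiM h.1).toFinite) 2
        (psiP h).meas := fun n =>
      memLp_of_bounded ((hw n).continuous_section _).measurable ((hw n).bound _)
    rw [e1, toL2_add (hL n) ((hL m).const_mul (-1)), toL2_const_mul (-1) (hL m), smul_add,
      smul_comm, neg_one_smul, ← sub_eq_add_neg] at e
    exact e
  have hUsub : ∀ n m h, integrandP A (s n - s m) (s n - s m) (psiP h) =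
      inner ℝ (A (psiP h) (U n h - U m h)) (U n h - U m h) := fun n m h => by
    have e : toL2 (psiP h).meas (convDeriv (s n - s m) (psiP h).toProb) = U n h - U m h := by
      have e1 : s n - s m = s n + (-1 : ℝ) • s m := by rw [neg_one_smul, sub_eq_add_neg]
      rw [e1, ((hC n).add ((hC m).const_smul (-1))).convDeriv_eq,
        toL2_add ((hC n).memLp _) (((hC m).memLp _).const_mul (-1)),
        toL2_const_mul (-1) ((hC m).memLp _), neg_one_smul, ← sub_eq_add_neg]
    rw [integrandP, e]
  have hUint : ∀ u v, CbE1P u → CbE1P v →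
      Integrable (fun h => integrandP A u v (psiP h)) (restrictNonzero L0) := fun u v hu hv =>
    (integrable_integrandP hA hu hv).1.comp_measurable continuous_psiP.measurable
  have hcauchy : (hilbertFormP L0 A).IsCauchySeq W := by
    refine ⟨fun n => cb10_cutExt (k n) (hC n) (hB n), ?_⟩
    -- V_n - V_m is U_n - U_m plus the difference of the two losses. The quadratic bounds 2, 4, 4
    -- and the factor 4 of the lift give 8, 16, 16.
    have hle : ∀ p : ℕ × ℕ, (hilbertFormP L0 A).form (W p.1 - W p.2) (W p.1 - W p.2) ≤
        8 * (measureFormP (lawP L0) A).form (s p.1 - s p.2) (s p.1 - s p.2) +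
          16 * (1 / ((p.1 : ℝ) + 1)) + 16 * (1 / ((p.2 : ℝ) + 1)) := by
      rintro ⟨n, m⟩
      have i1 := (hUint _ _ (hsub n m) (hsub n m)).const_mul 8
      have i2 := (hlossInt n).const_mul 16
      have i3 := (hlossInt m).const_mul 16
      have h1 : (hilbertFormP L0 A).form (W n - W m) (W n - W m) ≤
          ∫ h, (8 * integrandP A (s n - s m) (s n - s m) (psiP h) +
            16 * (K n * cutLoss A (k n) h) + 16 * (K m * cutLoss A (k m) h))
              ∂(restrictNonzero L0) := by
        refine integral_mono_of_nonneg (Eventually.of_forall fun h => ?_) ((i1.add i2).add i3)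
          (Eventually.of_forall fun h => ?_)
        · change 0 ≤ hilbertIntegrandP A (W n - W m) (W n - W m) h
          rw [hWsub]
          exact mul_nonneg (by norm_num) (hpos h _)
        · change hilbertIntegrandP A (W n - W m) (W n - W m) h ≤ _
          rw [hWsub]
          beta_reduce
          rw [hUsub]
          have e : V n h - V m h = (U n h - U m h) + ((U m h - V m h) - (U n h - V n h)) := by abel
          have h2 := inner_map_add_sub_self_le (hpos h) (U n h - U m h) (U m h - V m h)
            (U n h - V n h)
          rw [← e] at h2
          linarith [hloss n h, hloss m h]
      have i12 : Integrable (fun h => 8 * integrandP A (s n - s m) (s n - s m) (psiP h) +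
          16 * (K n * cutLoss A (k n) h)) (restrictNonzero L0) := i1.add i2
      rw [integral_add i12 i3, integral_add i1 i2] at h1
      simp only [integral_const_mul] at h1
      rw [← measureFormP_eq_integral hA (hsub n m) (hsub n m)] at h1
      dsimp only
      linarith [hk n, hk m]
    have hz : Tendsto (fun n : ℕ => 16 * (1 / ((n : ℝ) + 1))) atTop (𝓝 0) := by
      simpa using tendsto_one_div_add_atTop_nhds_zero_nat.const_mul (16 : ℝ)
    have hlim' : Tendsto (fun p : ℕ × ℕ =>
        8 * (measureFormP (lawP L0) A).form (s p.1 - s p.2) (s p.1 - s p.2) +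
          16 * (1 / ((p.1 : ℝ) + 1)) + 16 * (1 / ((p.2 : ℝ) + 1))) atTop (𝓝 0) := by
      have h1 := hs.2.const_mul 8
      rw [← prod_atTop_atTop_eq] at h1 ⊢
      simpa using (h1.add (hz.comp tendsto_fst)).add (hz.comp tendsto_snd)
    refine squeeze_zero (fun p => integral_nonneg fun h => ?_) hle hlim'
    change 0 ≤ hilbertIntegrandP A (W p.1 - W p.2) (W p.1 - W p.2) h
    rw [hWsub]
    exact mul_nonneg (by norm_num) (hpos h _)
  have hzero : Tendsto (fun n => eLpNorm ((hilbertFormP L0 A).val (W n)) 2 L0) atTop (𝓝 0) :=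
    tendsto_of_tendsto_of_tendsto_of_le_of_le tendsto_const_nhds hlim (fun _ => bot_le)
      fun n => eLpNorm_cutExt_le hL0 (k n) (hmem n)
  have hfin := hcl W hcauchy hzero
  have hle : ∀ n : ℕ, (measureFormP (lawP L0) A).form (s n) (s n) ≤
      1 / 2 * (hilbertFormP L0 A).form (W n) (W n) + 2 * (1 / ((n : ℝ) + 1)) := by
    intro n
    have i1 := (hUint _ _ (hmem n) (hmem n)).const_mul 2
    have i2 := (hlossInt n).const_mul 2
    -- The lower bound for the energy of `W n` needs true integrability of its density, since the
    -- integral of a non-integrable function would be 0 by convention.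
    have i3 : Integrable (fun h => inner ℝ (A (psiP h) (V n h)) (V n h)) (restrictNonzero L0) := by
      refine (i1.add i2).mono' (measurable_inner_cutVec hA (k n) (hC n)).aestronglyMeasurable
        (Eventually.of_forall fun h => ?_)
      rw [Real.norm_eq_abs, abs_of_nonneg (hpos h _)]
      have e : V n h = U n h + -(U n h - V n h) := by abel
      have h2 := inner_map_add_self_le (hpos h) (U n h) (-(U n h - V n h))
      rw [← e, map_neg, inner_neg_neg] at h2
      have h3 := hloss n h
      change _ ≤ 2 * inner ℝ (A (psiP h) (U n h)) (U n h) + 2 * (K n * cutLoss A (k n) h)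
      linarith
    have i4 := i3.const_mul 2
    have h1 : ∫ h, integrandP A (s n) (s n) (psiP h) ∂(restrictNonzero L0) ≤
        ∫ h, (2 * inner ℝ (A (psiP h) (V n h)) (V n h) + 2 * (K n * cutLoss A (k n) h))
          ∂(restrictNonzero L0) := by
      refine integral_mono (hUint _ _ (hmem n) (hmem n)) (i4.add i2) fun h => ?_
      change inner ℝ (A (psiP h) (U n h)) (U n h) ≤ _
      have e : U n h = V n h + (U n h - V n h) := by abel
      have h2 := inner_map_add_self_le (hpos h) (V n h) (U n h - V n h)
      rw [← e] at h2
      have h3 := hloss n h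
      linarith
    have h2 : (hilbertFormP L0 A).form (W n) (W n) =
        4 * ∫ h, inner ℝ (A (psiP h) (V n h)) (V n h) ∂(restrictNonzero L0) := by
      rw [← integral_const_mul]
      exact integral_congr_ae (Eventually.of_forall fun h => hW n h)
    rw [integral_add i4 i2, integral_const_mul, integral_const_mul] at h1
    rw [measureFormP_eq_integral hA (hmem n) (hmem n), h2]
    linarith [hlossLe n]
  refine squeeze_zero (fun n => hP.form_nonneg ⟨s n, hs.1 n⟩) hle ?_
  have hz := tendsto_one_div_add_atTop_nhds_zero_nat.const_mul (2 : ℝ)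
  have hsum := (hfin.const_mul (1 / 2)).add hz
  rwa [mul_zero, mul_zero, add_zero] at hsum

theorem exists_closure_measureFormP [IsProbabilityMeasure L0] (hL0 : L0 {0} = 0)
    (hA : AdmissibleP (lawP L0) A) (hcl : (hilbertFormP L0 A).IsClosable L0) :
    ∃ F : L2Form (lawP L0), (measureFormP (lawP L0) A).IsClosure F ∧
      F.IsDirichlet ∧ F.IsLocal ∧ F.IsQuasiRegular := by
  have hprob := isProbabilityMeasure_lawP L0 hL0
  have : Nonempty (AcProb lam) := nonempty_of_isProbabilityMeasure (lawP L0)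
  exact (barrierP hA (TopologicalSpace.denseRange_denseSeq (AcProb lam))).exists_closure
    (diffusionCoreP hA) (isClosable_measureFormP hL0 hA hcl)

end Closability

end ExtrinsicForms

end

theorem theorem3p3 {M : Type*} [TopologicalSpace M] [PolishSpace M] [MeasurableSpace M]
    [BorelSpace M] (lam : Measure M) [SigmaFinite lam] (hlam : lam ≠ 0)
    [MeasurableSpace (Lp ℝ 2 lam)] [BorelSpace (Lp ℝ 2 lam)]
    (L0 : Measure (Lp ℝ 2 lam)) [IsProbabilityMeasure L0] (hL0 : L0 {0} = 0) :
    (∀ A : ExtrinsicForms.FamilyM lam,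
      ExtrinsicForms.AdmissibleM (ExtrinsicForms.lawM L0) A →
      (∀ u : FiniteMeasure M → ℝ, ExtrinsicForms.CbE12 lam u →
        ExtrinsicForms.Cb1 (fun h : Lp ℝ 2 lam => u (ExtrinsicForms.psiM h).toFinite)) ∧
      (∀ u v : FiniteMeasure M → ℝ,
        ExtrinsicForms.CbE12 lam u → ExtrinsicForms.CbE12 lam v →
        Integrable (ExtrinsicForms.integrandM A u v) (ExtrinsicForms.lawM L0) ∧
        Integrable (ExtrinsicForms.hilbertIntegrandM A
          (fun h => u (ExtrinsicForms.psiM h).toFinite)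
          (fun h => v (ExtrinsicForms.psiM h).toFinite)) L0 ∧
        (ExtrinsicForms.measureFormM (ExtrinsicForms.lawM L0) A).form u v =
          1 / 4 * (ExtrinsicForms.hilbertFormM L0 A).form
            (fun h => u (ExtrinsicForms.psiM h).toFinite)
            (fun h => v (ExtrinsicForms.psiM h).toFinite)) ∧
      ((ExtrinsicForms.hilbertFormM L0 A).IsClosable L0 →
        (ExtrinsicForms.measureFormM (ExtrinsicForms.lawM L0) A).IsClosable
          (ExtrinsicForms.lawM L0) ∧
        ∃ F : ExtrinsicForms.L2Form (ExtrinsicForms.lawM L0),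
          (ExtrinsicForms.measureFormM (ExtrinsicForms.lawM L0) A).IsClosure F ∧
          F.IsDirichlet ∧ F.IsLocal ∧ F.IsQuasiRegular)) ∧
    (∀ A : ExtrinsicForms.FamilyP lam,
      ExtrinsicForms.AdmissibleP (ExtrinsicForms.lawP L0) A →
      (∀ u : ProbabilityMeasure M → ℝ, ExtrinsicForms.CbE1P u →
        ExtrinsicForms.Cb10 {0}ᶜ (ExtrinsicForms.compPsiP (lam := lam) u)) ∧
      (∀ u v : ProbabilityMeasure M → ℝ,
        ExtrinsicForms.CbE1P u → ExtrinsicForms.CbE1P v →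
        Integrable (ExtrinsicForms.integrandP A u v) (ExtrinsicForms.lawP L0) ∧
        Integrable (ExtrinsicForms.hilbertIntegrandP A
          (ExtrinsicForms.compPsiP u) (ExtrinsicForms.compPsiP v))
          (ExtrinsicForms.restrictNonzero L0) ∧
        (ExtrinsicForms.measureFormP (ExtrinsicForms.lawP L0) A).form u v =
          1 / 4 * (ExtrinsicForms.hilbertFormP L0 A).form
            (ExtrinsicForms.compPsiP u) (ExtrinsicForms.compPsiP v)) ∧
      ((ExtrinsicForms.hilbertFormP L0 A).IsClosable L0 →
        (ExtrinsicForms.measureFormP (ExtrinsicForms.lawP L0) A).IsClosable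
          (ExtrinsicForms.lawP L0) ∧
        ∃ F : ExtrinsicForms.L2Form (ExtrinsicForms.lawP L0),
          (ExtrinsicForms.measureFormP (ExtrinsicForms.lawP L0) A).IsClosure F ∧
          F.IsDirichlet ∧ F.IsLocal ∧ F.IsQuasiRegular)) := by
  -- Nonemptiness of M is what lam ≠ 0 provides; it is needed for the sup bounds on u and for the
  -- normalisation of the zero measure.
  have hM : Nonempty M := by
    by_contra h
    rw [not_nonempty_iff] at h
    exact hlam (Measure.eq_zero_of_isEmpty lam)
  refine ⟨fun A hA => ⟨fun u hu => ExtrinsicForms.cb1_comp_psiM hu, fun u v hu hv => ?_,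
    fun hcl => ⟨ExtrinsicForms.isClosable_measureFormM hA hcl,
      ExtrinsicForms.exists_closure_measureFormM hA hcl⟩⟩,
    fun A hA => ⟨fun u hu => ExtrinsicForms.cb10_compPsiP hu, fun u v hu hv => ?_,
    fun hcl => ⟨ExtrinsicForms.isClosable_measureFormP hL0 hA hcl,
      ExtrinsicForms.exists_closure_measureFormP hL0 hA hcl⟩⟩⟩
  · obtain ⟨h1, h2⟩ := ExtrinsicForms.integrable_integrandM hA hu hv
    exact ⟨h1, h2, ExtrinsicForms.measureFormM_eq hA hu hv⟩
  · obtain ⟨h1, h2⟩ := ExtrinsicForms.integrable_integrandP hA hu hv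
    exact ⟨h1, h2, ExtrinsicForms.measureFormP_eq hA hu hv⟩
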